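/- Let $p$ be a prime, $A_p=\mathbb{Z}[\tfrac1p,e^{2\pi i/p}]\subset\mathbb{C}$, and let $Q$ be a commutative Noetherian $A_p$-algebra. For $f\in Q$, a matrix factorization of $f$ is a finitely generated projective $\mathbb{Z}/2$-graded $Q$-module $P=P_0\oplus P_1$ with an odd $Q$-linear endomorphism $d$ such that $d^2=f\cdot\mathrm{id}_P$; morphisms are the even $Q$-linear maps commuting with $d$, and a homotopy between morphisms $g_1,g_2$ is an odd $Q$-linear map $h$ with $dh+hd=g_1-g_2$. The support of $P$ is the set of primes $\mathfrak{q}$ such that $P_{\mathfrak q}$ is not homotopy equivalent to $0$. For a closed subset $Z\subseteq\operatorname{Spec}Q$ let $mf^Z(Q,f)$ be the category of matrix factorizations of $f$ with support contained in $Z$, and let $K_0(mf^Z(Q,f))$ be the abelian group generated by the classes $[P]$ of its objects, subject to $[P]=[P']+[P'']$ for every short exact sequence $0\to P'\to P\to P''\to 0$ and $[P]=[P']$ whenever $P$ and $P'$ are homotopy equivalent. For an object $P$ of $mf^Z(Q,f)$, let $T^p(P)=P\otimes_Q\cdots\otimes_Q P$ ($p$ factors), a matrix factorization of $pf$ on which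 the symmetric group $\Sigma_p$ acts by permuting the factors with the usual signs for graded objects. For a $p$-th root of unity $\zeta\in\mathbb{Z}[e^{2\pi i/p}]$, let $T^p(P)^{(\zeta)}=\ker(\sigma-\zeta)$, where $\sigma=(1\,2\,\cdots\,p)$, and let $\mathrm{mult}_{1/p}$ be the functor sending a matrix factorization $(\alpha:P_1\to P_0,\ \beta:P_0\to P_1)$ of $pf$ to the matrix factorization $(\alpha,\tfrac1p\beta)$ of $f$. The cyclic Adams operation is the map $\psi^p:K_0(mf^Z(Q,f))\to K_0(mf^Z(Q,f))$ determined by $$\psi^p([P])\otimes 1=\sum_{\zeta}\,[\mathrm{mult}_{1/p}(T^p(P)^{(\zeta)})]\otimes\zeta\ \in\ K_0(mf^Z(Q,f))\otimes_{\mathbb{Z}}\mathbb{Z}[e^{2\pi i/p}]$$ for all objects $P$ of $mf^Z(Q,f)$, the sum ranging over all $p$-th roots of unity $\zeta$. Let $a=(a_1,\dots,a_n)$ be a sequence of elements of $Q$, let $V(a)\subseteq\operatorname{Spec}Q$ be the set of primes containing all $a_i$, and let $K(a)$ be the $\mathbb{Z}/2$-folded Koszul complex of $a$, regarded as an object of $mf^{V(a)}(Q,0)$.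 Then there is exactly one map $\psi^p$ as above on $K_0(mf^{V(a)}(Q,0))$, and it satisfies $$\psi^p([K(a)])=p^n\,[K(a)]\ \in\ K_0(mf^{V(a)}(Q,0)).$$ -/

import Mathlib

open scoped TensorProduct

universe u v

/-- A matrix factorization of `f`: a finitely generated projective `ℤ/2`-graded `Q`-module
`P = P₀ ⊕ P₁` with an odd endomorphism `d` such that `d² = f`.  The grading is recorded by the
projection `e` onto the odd part: `P₀ = ker e`, `P₁ = range e`.  A linear map `g` of graded modules is
even iff `e g = g e`, and odd iff `e g + g e = g`. -/
structure MF (Q : Type u) [CommRing Q] (f : Q) where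
  carrier : Type u
  [addCommGroup : AddCommGroup carrier]
  [module : Module Q carrier]
  [finite : Module.Finite Q carrier]
  [projective : Module.Projective Q carrier]
  e : Module.End Q carrier
  e_mul_e : e * e = e
  d : Module.End Q carrier
  d_odd : e * d + d * e = d
  d_mul_d : d * d = f • (1 : Module.End Q carrier)

namespace MF

attribute [instance] MF.addCommGroup MF.module MF.finite MF.projective

variable {Q : Type u} [CommRing Q] {f : Q}

/-- Morphisms of matrix factorizations: even linear maps commuting with `d`. -/
structure Hom (P P' : MF Q f) where
  toLin : P.carrier →ₗ[Q] P'.carrier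
  comm_e : P'.e ∘ₗ toLin = toLin ∘ₗ P.e
  comm_d : P'.d ∘ₗ toLin = toLin ∘ₗ P.d

/-- The identity morphism. -/
def Hom.id (P : MF Q f) : Hom P P := ⟨LinearMap.id, rfl, rfl⟩

/-- Composition of morphisms. -/
def Hom.comp {P P' P'' : MF Q f} (g : Hom P' P'') (k : Hom P P') : Hom P P'' where
  toLin := g.toLin ∘ₗ k.toLin
  comm_e := by rw [← LinearMap.comp_assoc, g.comm_e, LinearMap.comp_assoc, k.comm_e]; rfl
  comm_d := by rw [← LinearMap.comp_assoc, g.comm_d, LinearMap.comp_assoc, k.comm_d]; rfl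

/-- `g₁` and `g₂` are joined by a homotopy: an odd map `h` with `d h + h d = g₁ - g₂`. -/
def Homotopic {P P' : MF Q f} (g₁ g₂ : Hom P P') : Prop :=
  ∃ h : P.carrier →ₗ[Q] P'.carrier, P'.e ∘ₗ h + h ∘ₗ P.e = h ∧
    P'.d ∘ₗ h + h ∘ₗ P.d = g₁.toLin - g₂.toLin

/-- Homotopy equivalence of matrix factorizations. -/
def HomotopyEquivalent (P P' : MF Q f) : Prop :=
  ∃ (g : Hom P P') (k : Hom P' P),
    Homotopic (k.comp g) (Hom.id P) ∧ Homotopic (g.comp k) (Hom.id P')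

/-- The zero matrix factorization. -/
def zero (Q : Type u) [CommRing Q] (f : Q) : MF Q f where
  carrier := PUnit
  e := 0
  e_mul_e := by simp
  d := 0
  d_odd := by simp
  d_mul_d := by ext

/-- Extension of scalars. -/
def baseChange (S : Type u) [CommRing S] [Algebra Q S] (P : MF Q f) : MF S (algebraMap Q S f) where
  carrier := S ⊗[Q] P.carrier
  e := P.e.baseChange S
  e_mul_e := by rw [← LinearMap.baseChange_mul, P.e_mul_e]
  d := P.d.baseChange S
  d_odd := by
    rw [← LinearMap.baseChange_mul, ← LinearMap.baseChange_mul, ← LinearMap.baseChange_add, P.d_odd]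
  d_mul_d := by
    rw [← LinearMap.baseChange_mul, P.d_mul_d]
    ext x
    simp [TensorProduct.tmul_smul, TensorProduct.smul_tmul', Algebra.smul_def]

/-- The support: the primes `q` for which `P_q` is not homotopy equivalent to zero. -/
def support (P : MF Q f) : Set (PrimeSpectrum Q) :=
  {q | ¬ HomotopyEquivalent (P.baseChange (Localization.AtPrime q.asIdeal))
    (zero (Localization.AtPrime q.asIdeal) (algebraMap Q _ f))}

theorem homotopyEquivalent_zero_iff (P : MF Q f) : HomotopyEquivalent P (zero Q f) ↔
    ∃ h : Module.End Q P.carrier, P.e * h + h * P.e = h ∧ P.d * h + h * P.d = 1 := by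
  constructor
  · rintro ⟨g, k, ⟨h, h1, h2⟩, -⟩
    refine ⟨-h, ?_, ?_⟩
    · have : P.e * h + h * P.e = h := h1
      rw [mul_neg, neg_mul, ← neg_add, this]
    · have h3 : P.d * h + h * P.d = (k.comp g).toLin - 1 := h2
      have h4 : (k.comp g).toLin = 0 := by
        ext x
        change k.toLin (g.toLin x) = 0
        have : g.toLin x = 0 := Subsingleton.elim (α := PUnit) _ _
        rw [this, map_zero]
      rw [mul_neg, neg_mul, ← neg_add, h3, h4, zero_sub, neg_neg]
  · rintro ⟨h, h1, h2⟩
    refine ⟨⟨0, by simp, by simp⟩, ⟨0, by simp, by simp⟩, ⟨-h, ?_, ?_⟩, ⟨0, by simp, ?_⟩⟩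
    · change P.e * (-h) + (-h) * P.e = -h
      rw [mul_neg, neg_mul, ← neg_add, h1]
    · change P.d * (-h) + (-h) * P.d = _
      rw [mul_neg, neg_mul, ← neg_add, h2]
      simp [Hom.comp, Hom.id, Module.End.one_eq_id]
    · refine LinearMap.ext fun x => ?_
      exact Subsingleton.elim (α := PUnit) _ _

/-- A prime `q` is outside the support iff some `s ∉ q` is null-homotopic on `P`. -/
theorem notMem_support_iff (P : MF Q f) (q : PrimeSpectrum Q) : q ∉ P.support ↔
    ∃ s ∉ q.asIdeal, ∃ h : Module.End Q P.carrier,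
      P.e * h + h * P.e = h ∧ P.d * h + h * P.d = s • (1 : Module.End Q P.carrier) := by
  rw [support, Set.mem_ofPred_eq, not_not, homotopyEquivalent_zero_iff]
  let i : P.carrier →ₗ[Q] Localization.AtPrime q.asIdeal ⊗[Q] P.carrier :=
    TensorProduct.mk Q _ P.carrier 1
  have hi : IsLocalizedModule q.asIdeal.primeCompl i := inferInstance
  let E := P.e.baseChange (Localization.AtPrime q.asIdeal)
  let D := P.d.baseChange (Localization.AtPrime q.asIdeal)
  have hie : ∀ x, i (P.e x) = E (i x) := fun x => by simp [i, E]
  have hid : ∀ x, i (P.d x) = D (i x) := fun x => by simp [i, D]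
  change (∃ h : Module.End (Localization.AtPrime q.asIdeal)
    (Localization.AtPrime q.asIdeal ⊗[Q] P.carrier), E * h + h * E = h ∧ D * h + h * D = 1) ↔ _
  constructor
  · rintro ⟨h, h1, h2⟩
    have : Module.FinitePresentation Q P.carrier := Module.finitePresentation_of_projective Q _
    obtain ⟨l, s, hl⟩ := Module.FinitePresentation.exists_lift_of_isLocalizedModule
      q.asIdeal.primeCompl i ((h.restrictScalars Q) ∘ₗ i)
    have hl' : ∀ x, i (l x) = (s : Q) • h (i x) := fun x => LinearMap.congr_fun hl x
    have hE : ∀ (c : Q) y, E (c • y) = c • E y := fun c y => (E.restrictScalars Q).map_smul c y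
    have hD : ∀ (c : Q) y, D (c • y) = c • D y := fun c y => (D.restrictScalars Q).map_smul c y
    obtain ⟨t₁, ht₁⟩ := Module.Finite.exists_smul_of_comp_eq_of_isLocalizedModule
      q.asIdeal.primeCompl i (P.e * l + l * P.e) l (by
        ext x
        have := LinearMap.congr_fun h1 (i x)
        simp only [LinearMap.add_apply, Module.End.mul_apply] at this
        simp only [LinearMap.comp_apply, LinearMap.add_apply, Module.End.mul_apply, map_add, hie,
          hl', hE]
        rw [← smul_add, this])
    obtain ⟨t₂, ht₂⟩ := Module.Finite.exists_smul_of_comp_eq_of_isLocalizedModule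
      q.asIdeal.primeCompl i (P.d * l + l * P.d) ((s : Q) • 1) (by
        ext x
        have := LinearMap.congr_fun h2 (i x)
        simp only [LinearMap.add_apply, Module.End.mul_apply, Module.End.one_apply] at this
        simp only [LinearMap.comp_apply, LinearMap.add_apply, Module.End.mul_apply, map_add, hid,
          hl', hD, LinearMap.smul_apply, map_smul, Module.End.one_apply]
        rw [← smul_add, this])
    refine ⟨(t₁ * t₂ * s : q.asIdeal.primeCompl), (t₁ * t₂ * s).2,
      ((t₁ : Q) * (t₂ : Q)) • l, ?_, ?_⟩
    · have h3 : (t₁ : Q) • (P.e * l + l * P.e) = (t₁ : Q) • l := ht₁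
      rw [mul_smul_comm, smul_mul_assoc, ← smul_add, mul_comm, mul_smul, h3, mul_smul]
    · have h3 : (t₂ : Q) • (P.d * l + l * P.d) = (t₂ : Q) • (s : Q) • 1 := ht₂
      rw [mul_smul_comm, smul_mul_assoc, ← smul_add, mul_smul, h3]
      simp [mul_smul]
  · rintro ⟨s, hs, h, h1, h2⟩
    let c : Localization.AtPrime q.asIdeal :=
      IsLocalization.mk' _ 1 (⟨s, hs⟩ : q.asIdeal.primeCompl)
    have hc : c * algebraMap Q _ s = 1 := by
      simpa [c] using IsLocalization.mk'_spec (Localization.AtPrime q.asIdeal) (1 : Q)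
        (⟨s, hs⟩ : q.asIdeal.primeCompl)
    refine ⟨c • h.baseChange _, ?_, ?_⟩
    · rw [mul_smul_comm, smul_mul_assoc, ← smul_add, ← LinearMap.baseChange_mul,
        ← LinearMap.baseChange_mul, ← LinearMap.baseChange_add, h1]
    · rw [mul_smul_comm, smul_mul_assoc, ← smul_add, ← LinearMap.baseChange_mul,
        ← LinearMap.baseChange_mul, ← LinearMap.baseChange_add, h2]
      refine TensorProduct.AlgebraTensorModule.curry_injective (LinearMap.ext_ring
        (LinearMap.ext fun x => ?_))
      change c • ((1 : Localization.AtPrime q.asIdeal) ⊗ₜ[Q] (s • x)) = 1 ⊗ₜ x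
      rw [TensorProduct.tmul_smul, TensorProduct.smul_tmul', TensorProduct.smul_tmul',
        smul_eq_mul, Algebra.smul_def, mul_one, hc]

theorem support_subset {P : MF Q f} {f' : Q} {P' : MF Q f'}
    (H : ∀ (s : Q) (h : Module.End Q P.carrier), P.e * h + h * P.e = h →
      P.d * h + h * P.d = s • (1 : Module.End Q P.carrier) →
      ∃ (h' : Module.End Q P'.carrier), P'.e * h' + h' * P'.e = h' ∧
        P'.d * h' + h' * P'.d = s • (1 : Module.End Q P'.carrier)) :
    P'.support ⊆ P.support := by
  intro q hq
  by_contra hq'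
  obtain ⟨s, hs, h, h1, h2⟩ := (notMem_support_iff P q).1 hq'
  obtain ⟨h', h3, h4⟩ := H s h h1 h2
  exact (notMem_support_iff P' q).2 ⟨s, hs, h', h3, h4⟩ hq

/-- The functor `mult_c`, sending `(α : P₁ → P₀, β : P₀ → P₁)` to `(α, c β)`: here `α` is `d e` and
`β` is `e d`. -/
def mult (P : MF Q f) (c : Q) (f' : Q) (hf : f' = c * f) : MF Q f' where
  carrier := P.carrier
  e := P.e
  e_mul_e := P.e_mul_e
  d := P.d * P.e + c • (P.e * P.d)
  d_odd := by
    have h1 : P.e * P.d * P.e = 0 := by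
      have h := congrArg (P.e * ·) P.d_odd
      simpa [mul_add, ← mul_assoc, P.e_mul_e] using h
    simp only [mul_add, add_mul, mul_smul_comm, smul_mul_assoc, ← mul_assoc, P.e_mul_e, h1]
    simp [mul_assoc, P.e_mul_e, add_comm]
  d_mul_d := by
    have h1 : P.e * P.d * P.e = 0 := by
      have h := congrArg (P.e * ·) P.d_odd
      simpa [mul_add, ← mul_assoc, P.e_mul_e] using h
    have h2 : P.d * P.e * P.d = f • (1 - P.e) := by
      have h := congrArg (P.d * ·) P.d_odd
      simp only [mul_add, ← mul_assoc, P.d_mul_d, smul_mul_assoc, one_mul] at h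
      rw [smul_sub, ← h, add_sub_cancel_right]
    have e1 : P.d * P.e * (P.d * P.e) = 0 := by
      rw [mul_assoc, ← mul_assoc P.e, h1, mul_zero]
    have e2 : P.e * P.d * (P.e * P.d) = 0 := by
      rw [← mul_assoc, h1, zero_mul]
    have e3 : P.d * P.e * (P.e * P.d) = f • (1 - P.e) := by
      rw [← h2, mul_assoc, ← mul_assoc P.e, P.e_mul_e, mul_assoc]
    have e4 : P.e * P.d * (P.d * P.e) = f • P.e := by
      rw [mul_assoc, ← mul_assoc P.d, P.d_mul_d, smul_mul_assoc, one_mul, mul_smul_comm, P.e_mul_e]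
    simp only [mul_add, add_mul, mul_smul_comm, smul_mul_assoc, e1, e2, e3, e4]
    simp only [smul_zero, add_zero, zero_add, ← smul_add, hf, mul_smul]
    rw [add_sub_cancel]

theorem mult_support (P : MF Q f) (c b : Q) (hb : b * c = 1) (f' : Q) (hf : f' = c * f) :
    (P.mult c f' hf).support ⊆ P.support := by
  refine support_subset fun s h h1 h2 => ?_
  have h3 : P.e * h * P.e = 0 := by
    have h := congrArg (P.e * ·) h1
    simpa [mul_add, ← mul_assoc, P.e_mul_e] using h
  have h4 : P.e * P.d * P.e = 0 := by
    have h := congrArg (P.e * ·) P.d_odd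
    simpa [mul_add, ← mul_assoc, P.e_mul_e] using h
  refine ⟨(P.e * h + b • (h * P.e) : Module.End Q P.carrier), ?_, ?_⟩
  · change P.e * _ + _ * P.e = _
    simp only [mul_add, add_mul, mul_smul_comm, smul_mul_assoc, ← mul_assoc, P.e_mul_e, h3]
    simp [mul_assoc, P.e_mul_e]
  · change (P.d * P.e + c • (P.e * P.d)) * _ + _ * (P.d * P.e + c • (P.e * P.d)) = _
    have e1 : P.d * P.e * (P.e * h) = P.d * (P.e * h) := by
      rw [mul_assoc, ← mul_assoc P.e, P.e_mul_e]
    have e2 : P.d * P.e * (h * P.e) = 0 := by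
      rw [mul_assoc, ← mul_assoc P.e, h3, mul_zero]
    have e3 : P.e * P.d * (P.e * h) = 0 := by rw [← mul_assoc, h4, zero_mul]
    have e4 : P.e * h * (P.e * P.d) = 0 := by rw [← mul_assoc, h3, zero_mul]
    have e5 : h * P.e * (P.d * P.e) = 0 := by
      rw [mul_assoc, ← mul_assoc P.e, h4, mul_zero]
    have e6 : h * P.e * (P.e * P.d) = h * P.e * P.d := by
      rw [mul_assoc, ← mul_assoc P.e, P.e_mul_e, mul_assoc]
    have e7 : P.e * P.d * (h * P.e) + P.e * h * (P.d * P.e) = s • P.e := by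
      have : P.e * P.d * (h * P.e) + P.e * h * (P.d * P.e)
          = P.e * (P.d * h + h * P.d) * P.e := by noncomm_ring
      rw [this, h2]
      simp [P.e_mul_e]
    have e8 : P.d * (P.e * h) + h * P.e * P.d = s • (1 - P.e) := by
      have h5 : P.d * P.e = P.d - P.e * P.d := eq_sub_of_add_eq' P.d_odd
      have h6 : h * P.e = h - P.e * h := eq_sub_of_add_eq' h1
      have : P.d * (P.e * h) + h * P.e * P.d
          = (P.d * h + h * P.d) - P.e * (P.d * h + h * P.d) := by
        rw [← mul_assoc, h5, h6]; noncomm_ring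
      rw [this, h2]
      simp [smul_sub]
    simp only [mul_add, add_mul, mul_smul_comm, smul_mul_assoc, e1, e2, e3, e4, e5, e6, smul_smul,
      mul_comm c b, hb, one_smul, smul_zero, add_zero, zero_add]
    have : P.d * (P.e * h) + P.e * P.d * (h * P.e)
        + (P.e * h * (P.d * P.e) + h * P.e * P.d) = s • (1 : Module.End Q P.carrier) := by
      rw [show P.d * (P.e * h) + P.e * P.d * (h * P.e)
        + (P.e * h * (P.d * P.e) + h * P.e * P.d) = (P.d * (P.e * h) + h * P.e * P.d)
        + (P.e * P.d * (h * P.e) + P.e * h * (P.d * P.e)) by abel, e7, e8, ← smul_add,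
        sub_add_cancel]
    exact this

end MF

/-- A `G`-equivariant matrix factorization. -/
structure GMF (Q : Type u) [CommRing Q] (f : Q) (G : Type v) [Group G] extends MF Q f where
  ρ : G →* Module.End Q carrier
  ρ_e : ∀ g, ρ g * e = e * ρ g
  ρ_d : ∀ g, ρ g * d = d * ρ g

namespace GMF

variable {Q : Type u} [CommRing Q] {f : Q} {G : Type v} [Group G]

/-- The kernel of `g - z`. -/
def eigenspace (X : GMF Q f G) (g : G) (z : Q) : Submodule Q X.carrier :=
  LinearMap.ker (X.ρ g - z • (1 : Module.End Q X.carrier))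

theorem mem_eigenspace {X : GMF Q f G} {g : G} {z : Q} {x : X.carrier} :
    x ∈ X.eigenspace g z ↔ X.ρ g x = z • x := by
  simp [eigenspace, sub_eq_zero]

theorem map_eigenspace (X : GMF Q f G) (g : G) (z : Q) (h : Module.End Q X.carrier)
    (hh : X.ρ g * h = h * X.ρ g) : ∀ x ∈ X.eigenspace g z, h x ∈ X.eigenspace g z := by
  intro x hx
  rw [mem_eigenspace] at hx ⊢
  rw [← Module.End.mul_apply, hh, Module.End.mul_apply, hx, map_smul]

theorem exists_projection (X : GMF Q f G) (g : G) (z : Q) (p : ℕ) (hg : g ^ p = 1)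
    (hz : z ^ p = 1) (hp : IsUnit (p : Q)) :
    ∃ π : X.carrier →ₗ[Q] X.eigenspace g z, π ∘ₗ (X.eigenspace g z).subtype = LinearMap.id := by
  obtain ⟨b, hb⟩ := hp.exists_left_inv
  rcases Nat.eq_zero_or_pos p with rfl | hp0
  · have : Subsingleton X.carrier := by
      have : Subsingleton Q := subsingleton_of_zero_eq_one (by simpa using hb)
      exact Module.subsingleton Q _
    exact ⟨0, Subsingleton.elim _ _⟩
  set w := z ^ (p - 1) with hw
  have hzw : z * w = 1 := by rw [hw, mul_pow_sub_one hp0.ne', hz]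
  set T : Module.End Q X.carrier := w • X.ρ g with hT
  have hTp : T ^ p = 1 := by
    rw [hT, smul_pow, ← map_pow, hg, map_one, hw, ← pow_mul, mul_comm, pow_mul, hz, one_pow,
      one_smul]
  let π : Module.End Q X.carrier := b • ∑ k ∈ Finset.range p, T ^ k
  have hπ : T * π = π := by
    have := mul_geom_sum T p
    rw [hTp, sub_self, sub_mul, one_mul, sub_eq_zero] at this
    simp only [π, mul_smul_comm, this]
  refine ⟨π.codRestrict _ fun x => ?_, ?_⟩
  · rw [mem_eigenspace]
    have h := LinearMap.congr_fun hπ x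
    rw [Module.End.mul_apply] at h
    conv_rhs => rw [← h]
    simp [hT, smul_smul, hzw]
  · ext ⟨x, hx⟩
    rw [mem_eigenspace] at hx
    have hTx : T x = x := by simp [hT, hx, smul_smul, mul_comm w, hzw]
    have hTk : ∀ k : ℕ, (T ^ k) x = x := by
      intro k
      induction k with
      | zero => simp
      | succ k ih => rw [pow_succ, Module.End.mul_apply, hTx, ih]
    change π x = x
    simp only [π, LinearMap.smul_apply, LinearMap.sum_apply, hTk, Finset.sum_const,
      Finset.card_range]
    rw [← Nat.cast_smul_eq_nsmul Q, smul_smul, hb, one_smul]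

/-- The matrix factorization `X^(z) = ker (g - z)`, for `g` of order dividing `p`, `z^p = 1` and `p`
invertible in `Q`. -/
def eigen (X : GMF Q f G) (g : G) (z : Q) (p : ℕ) (hg : g ^ p = 1)
    (hz : z ^ p = 1) (hp : IsUnit (p : Q)) : MF Q f where
  carrier := X.eigenspace g z
  finite := by
    obtain ⟨π, hπ⟩ := X.exists_projection g z p hg hz hp
    exact Module.Finite.of_surjective π fun x => ⟨x, LinearMap.congr_fun hπ x⟩
  projective := by
    obtain ⟨π, hπ⟩ := X.exists_projection g z p hg hz hp
    exact Module.Projective.of_split _ π hπ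
  e := X.e.restrict (X.map_eigenspace g z X.e (X.ρ_e g))
  e_mul_e := by
    ext x
    exact LinearMap.congr_fun X.e_mul_e x
  d := X.d.restrict (X.map_eigenspace g z X.d (X.ρ_d g))
  d_odd := by
    ext x
    exact LinearMap.congr_fun X.d_odd x
  d_mul_d := by
    ext x
    exact LinearMap.congr_fun X.d_mul_d x

theorem eigen_support (X : GMF Q f G) (g : G) (z : Q) (p : ℕ) (hg : g ^ p = 1)
    (hz : z ^ p = 1) (hp : IsUnit (p : Q)) :
    (X.eigen g z p hg hz hp).support ⊆ X.support := by
  refine MF.support_subset fun s h h1 h2 => ?_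
  obtain ⟨b, hb⟩ := hp.exists_left_inv
  let A : Module.End Q X.carrier := X.ρ g
  let A' : Module.End Q X.carrier := X.ρ g⁻¹
  have hAA' : A * A' = 1 := by simp only [A, A', ← map_mul, mul_inv_cancel, map_one]
  have hA'A : A' * A = 1 := by simp only [A, A', ← map_mul, inv_mul_cancel, map_one]
  have hk : ∀ (k : ℕ) (y : Module.End Q X.carrier), X.ρ g * y = y * X.ρ g →
      A ^ k * y = y * A ^ k ∧ A' ^ k * y = y * A' ^ k := by
    intro k y hy
    have c : Commute A y := hy
    refine ⟨(c.pow_left k).eq, ?_⟩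
    have c' : Commute A' y := by
      change A' * y = y * A'
      calc A' * y = A' * (y * (A * A')) := by rw [hAA', mul_one]
        _ = A' * A * y * A' := by rw [← mul_assoc y, ← hy.trans rfl]; simp [A, mul_assoc]
        _ = y * A' := by rw [hA'A, one_mul]
    exact (c'.pow_left k).eq
  have hkk : ∀ k : ℕ, A ^ k * A' ^ k = 1 := by
    intro k
    have c : Commute A A' := by rw [Commute, SemiconjBy, hAA', hA'A]
    rw [← c.mul_pow, hAA', one_pow]
  let H : Module.End Q X.carrier := b • ∑ k ∈ Finset.range p, A ^ k * h * A' ^ k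
  have hlin : ∀ y : Module.End Q X.carrier, X.ρ g * y = y * X.ρ g →
      y * H + H * y = b • ∑ k ∈ Finset.range p, A ^ k * (y * h + h * y) * A' ^ k := by
    intro y hy
    simp only [H, mul_smul_comm, smul_mul_assoc, ← smul_add, Finset.mul_sum, Finset.sum_mul,
      ← Finset.sum_add_distrib]
    congr 1
    refine Finset.sum_congr rfl fun k _ => ?_
    obtain ⟨c1, c2⟩ := hk k y hy
    rw [mul_add, add_mul]
    congr 1
    · rw [← mul_assoc, ← mul_assoc, ← c1, mul_assoc (A ^ k) y h]
    · rw [mul_assoc, c2, ← mul_assoc, mul_assoc (A ^ k) h y]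
  have hH : X.ρ g * H = H * X.ρ g := by
    have hAp : A ^ p = 1 := by simp only [A, ← map_pow, hg, map_one]
    have hA'p : A' ^ p = 1 := by simp only [A', ← map_pow, inv_pow, hg, inv_one, map_one]
    have h3 : A * H * A' = H := by
      simp only [H, mul_smul_comm, smul_mul_assoc, Finset.mul_sum, Finset.sum_mul]
      congr 1
      have : ∀ k, A * (A ^ k * h * A' ^ k) * A' = A ^ (k + 1) * h * A' ^ (k + 1) := by
        intro k
        rw [pow_succ', pow_succ]
        simp only [mul_assoc]
      simp only [this]
      have := Finset.sum_range_succ' (fun k => A ^ k * h * A' ^ k) p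
      rw [Finset.sum_range_succ, hAp, hA'p, pow_zero, pow_zero] at this
      exact (add_right_cancel this).symm
    calc A * H = A * H * (A' * A) := by rw [hA'A, mul_one]
      _ = H * A := by rw [← mul_assoc, h3]
  refine ⟨H.restrict (X.map_eigenspace g z H hH), ?_, ?_⟩
  · have : X.e * H + H * X.e = H := by rw [hlin _ (X.ρ_e g), h1]
    exact LinearMap.ext fun x => Subtype.ext (LinearMap.congr_fun this (Subtype.val x))
  · have : X.d * H + H * X.d = s • 1 := by
      rw [hlin _ (X.ρ_d g), h2]
      simp only [mul_smul_comm, smul_mul_assoc, mul_one, hkk, Finset.sum_const, Finset.card_range]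
      rw [← Nat.cast_smul_eq_nsmul Q, smul_smul, hb, one_smul]
    exact LinearMap.ext fun x => Subtype.ext (LinearMap.congr_fun this (Subtype.val x))

end GMF

namespace MFTensor

variable {Q : Type u} [CommRing Q] {M : Type u} [AddCommGroup M] [Module Q M] {n : ℕ}

open Module PiTensorProduct

/-- The projection of `M ⊗ ⋯ ⊗ M` onto the multihomogeneous part whose odd slots are those in `S`. -/
def parityProj (e : End Q M) (S : Finset (Fin n)) : End Q (⨂[Q] _ : Fin n, M) :=
  PiTensorProduct.map fun i => if i ∈ S then e else 1 - e

/-- The projection of the tensor power onto its odd part. -/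
def oddProj (n : ℕ) (e : End Q M) : End Q (⨂[Q] _ : Fin n, M) :=
  ∑ S : Finset (Fin n) with Odd S.card, parityProj e S

/-- For odd `h`: the operator applying `h` in slot `i`, with the sign
`(-1)^(|v_1| + ⋯ + |v_{i-1}|)` on `v_1 ⊗ ⋯ ⊗ v_n`; note that `1 - 2 e` is `(-1)^|v|`. -/
def slot (e h : End Q M) (i : Fin n) : End Q (⨂[Q] _ : Fin n, M) :=
  PiTensorProduct.map fun j => if j < i then 1 - 2 • e else if j = i then h else 1

/-- The differential of the tensor power. -/
def diff (n : ℕ) (e d : End Q M) : End Q (⨂[Q] _ : Fin n, M) :=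
  ∑ i, slot e d i

/-- The sign of a permutation of homogeneous factors with odd slots `S`: `-1` to the number of
inversions of `σ` between two odd slots. -/
def koszulSign (σ : Equiv.Perm (Fin n)) (S : Finset (Fin n)) : ℤ :=
  (-1) ^ ((S ×ˢ S).filter fun ij => ij.1 < ij.2 ∧ σ ij.2 < σ ij.1).card

/-- The left action `σ (v_1 ⊗ ⋯ ⊗ v_n) = ± v_{σ⁻¹ 1} ⊗ ⋯ ⊗ v_{σ⁻¹ n}` of the symmetric group, where an
adjacent transposition `(i i+1)` acts with the sign `(-1)^(|v_i| |v_{i+1}|)`. -/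
def permAct (e : End Q M) (σ : Equiv.Perm (Fin n)) : End Q (⨂[Q] _ : Fin n, M) :=
  (PiTensorProduct.reindex Q (fun _ => M) σ).toLinearMap ∘ₗ
    ∑ S : Finset (Fin n), (koszulSign σ S : Q) • parityProj e S

/-- `v` is a family of homogeneous elements, odd exactly at the slots in `S`. -/
def Homog (e : End Q M) (S : Finset (Fin n)) (v : Fin n → M) : Prop :=
  ∀ i, e (v i) = if i ∈ S then v i else 0

theorem parityProj_tprod {e : End Q M} {S : Finset (Fin n)} {v : Fin n → M}
    (hv : Homog e S v) (T : Finset (Fin n)) :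
    parityProj e T (tprod Q v) = if T = S then tprod Q v else 0 := by
  rw [parityProj, map_tprod]
  split_ifs with h
  · subst h
    congr 1
    ext i
    have := hv i
    split_ifs at this ⊢ with h
    · exact this
    · simp [this]
  · obtain ⟨i, hi⟩ : ∃ i, ¬ (i ∈ T ↔ i ∈ S) := by
      by_contra! H
      exact h (Finset.ext H)
    refine MultilinearMap.map_coord_zero _ i ?_
    have := hv i
    by_cases hT : i ∈ T <;> by_cases hS : i ∈ S <;> simp_all

theorem oddProj_tprod {e : End Q M} {S : Finset (Fin n)} {v : Fin n → M}
    (hv : Homog e S v) : oddProj n e (tprod Q v) = if Odd S.card then tprod Q v else 0 := by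
  simp only [oddProj, LinearMap.sum_apply, parityProj_tprod hv, Finset.sum_ite_eq',
    Finset.mem_filter, Finset.mem_univ, true_and]

theorem permAct_tprod {e : End Q M} {S : Finset (Fin n)} {v : Fin n → M}
    (hv : Homog e S v) (σ : Equiv.Perm (Fin n)) :
    permAct e σ (tprod Q v) = (koszulSign σ S : Q) • tprod Q fun i => v (σ.symm i) := by
  rw [permAct, LinearMap.comp_apply, LinearMap.sum_apply,
    Finset.sum_eq_single S]
  · rw [LinearMap.smul_apply, parityProj_tprod hv, if_pos rfl, map_smul]
    congr 1
    exact reindex_tprod σ v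
  · intro T _ hT
    rw [LinearMap.smul_apply, parityProj_tprod hv, if_neg hT, smul_zero]
  · simp

theorem slot_tprod {e : End Q M} {S : Finset (Fin n)} {v : Fin n → M}
    (hv : Homog e S v) (h : End Q M) (i : Fin n) :
    slot e h i (tprod Q v) =
      ((∏ j ∈ S, if j < i then (-1 : ℤ) else 1 : ℤ) : Q) • tprod Q (Function.update v i (h (v i))) := by
  have key : ∀ c : Fin n → Q, (tprod Q fun j => c j • Function.update v i (h (v i)) j) =
      (∏ j, c j) • tprod Q (Function.update v i (h (v i))) := fun c =>
    MultilinearMap.map_smul_univ _ c _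
  rw [slot, map_tprod]
  have : (fun j => (if j < i then 1 - 2 • e else if j = i then h else 1 : End Q M) (v j)) =
      fun j => (if j ∈ S ∧ j < i then (-1 : Q) else 1) • Function.update v i (h (v i)) j := by
    ext j
    have hj := hv j
    rcases lt_trichotomy j i with hji | rfl | hji
    · rw [if_pos hji, Function.update_of_ne hji.ne]
      by_cases hS : j ∈ S
      · simp only [hS, if_true] at hj
        simp only [LinearMap.sub_apply, LinearMap.smul_apply, hj, End.one_apply, hS, hji, and_self,
          if_true]
        rw [two_smul, neg_one_smul]; abel
      · simp only [hS, if_false] at hj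
        simp [hj, hS]
    · simp
    · simp [hji.not_gt, hji.ne']
  rw [this, key]
  congr 1
  push_cast
  rw [← Finset.prod_subset (Finset.subset_univ S)]
  · refine Finset.prod_congr rfl fun j hj => ?_
    by_cases h : j < i <;> simp [h, hj]
  · intro j _ hj
    simp [hj]

theorem hom_ext {N : Type*} [AddCommGroup N] [Module Q N] {e : End Q M} (he : e * e = e)
    {φ ψ : (⨂[Q] _ : Fin n, M) →ₗ[Q] N}
    (H : ∀ (S : Finset (Fin n)) (v : Fin n → M), Homog e S v → φ (tprod Q v) = ψ (tprod Q v)) :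
    φ = ψ := by
  refine PiTensorProduct.ext (MultilinearMap.ext fun v => ?_)
  have hv : v = (fun i => e (v i)) + (fun i => v i - e (v i)) := by ext; simp
  have he' : ∀ x, e (e x) = e x := fun x => LinearMap.congr_fun he x
  rw [LinearMap.compMultilinearMap_apply, LinearMap.compMultilinearMap_apply, hv,
    MultilinearMap.map_add_univ, map_sum, map_sum]
  refine Finset.sum_congr rfl fun S _ => H S _ fun i => ?_
  by_cases h : i ∈ S <;> simp [h, he']

theorem Homog.update {e : End Q M} {S : Finset (Fin n)} {v : Fin n → M}
    (hv : Homog e S v) {h : End Q M} (hh : e * h + h * e = h) (i : Fin n) :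
    Homog e (if i ∈ S then S.erase i else insert i S) (Function.update v i (h (v i))) := by
  intro j
  have hx : e (h (v i)) + h (e (v i)) = h (v i) := LinearMap.congr_fun hh (v i)
  rw [hv i] at hx
  have hj := hv j
  by_cases hji : j = i
  · subst hji
    by_cases hS : j ∈ S
    · simpa [hS] using hx
    · simpa [hS] using hx
  · by_cases hS : i ∈ S <;> simp [hji, hS, hj]

theorem Homog.perm {e : End Q M} {S : Finset (Fin n)} {v : Fin n → M}
    (hv : Homog e S v) (σ : Equiv.Perm (Fin n)) :
    Homog e (S.map σ.toEmbedding) (fun i => v (σ.symm i)) := by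
  intro i
  rw [hv]
  simp [Finset.mem_map_equiv]

/-- The sign of a pair of slots: `-1` iff `σ` inverts it. -/
def pairSign (σ : Equiv.Perm (Fin n)) (i j : Fin n) : ℤ :=
  if (i < j ↔ σ i < σ j) then 1 else -1

theorem koszulSign_insert (σ : Equiv.Perm (Fin n)) {S : Finset (Fin n)} {i : Fin n}
    (hi : i ∉ S) : koszulSign σ (insert i S) = koszulSign σ S * ∏ j ∈ S, pairSign σ i j := by
  have hc : ∀ T : Finset (Fin n), koszulSign σ T =
      ∏ a ∈ T, ∏ b ∈ T, if a < b ∧ σ b < σ a then (-1 : ℤ) else 1 := by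
    intro T
    rw [koszulSign, ← Finset.prod_product', Finset.prod_ite]
    simp
  rw [hc, hc, Finset.prod_insert hi, Finset.prod_insert hi]
  have : ∀ a ∈ S, (∏ b ∈ insert i S, if a < b ∧ σ b < σ a then (-1 : ℤ) else 1) =
      (if a < i ∧ σ i < σ a then (-1 : ℤ) else 1) *
        ∏ b ∈ S, if a < b ∧ σ b < σ a then (-1 : ℤ) else 1 := fun a _ => Finset.prod_insert hi
  rw [Finset.prod_congr rfl this, Finset.prod_mul_distrib]
  rw [if_neg (by simp), one_mul, ← mul_assoc, mul_comm, ← Finset.prod_mul_distrib]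
  congr 1
  refine Finset.prod_congr rfl fun j hj => ?_
  have hij : i ≠ j := fun h => hi (h ▸ hj)
  have hij' : σ i ≠ σ j := fun h => hij (σ.injective h)
  unfold pairSign
  rcases lt_or_gt_of_ne hij with h1 | h1 <;> rcases lt_or_gt_of_ne hij' with h2 | h2 <;>
    simp [h1, h2, h1.not_gt, h2.not_gt]

theorem koszulSign_empty (σ : Equiv.Perm (Fin n)) : koszulSign σ ∅ = 1 := by simp [koszulSign]

theorem koszulSign_one (S : Finset (Fin n)) : koszulSign 1 S = 1 := by
  rw [koszulSign, Finset.filter_false_of_mem]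
  · simp
  · rintro ⟨i, j⟩ - ⟨h1, h2⟩
    exact absurd h1 h2.not_gt

theorem koszulSign_mul (τ σ : Equiv.Perm (Fin n)) (S : Finset (Fin n)) :
    koszulSign (τ * σ) S = koszulSign σ S * koszulSign τ (S.map σ.toEmbedding) := by
  induction S using Finset.induction_on with
  | empty => simp [koszulSign_empty]
  | insert i S hi ih =>
    rw [koszulSign_insert _ hi, koszulSign_insert _ hi, Finset.map_insert, koszulSign_insert _
      (by simpa using hi), ih, Finset.prod_map]
    have : ∏ j ∈ S, pairSign (τ * σ) i j =
        (∏ j ∈ S, pairSign σ i j) * ∏ j ∈ S, pairSign τ (σ i) (σ j) := by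
      rw [← Finset.prod_mul_distrib]
      refine Finset.prod_congr rfl fun j hj => ?_
      unfold pairSign
      by_cases h1 : i < j <;> by_cases h2 : σ i < σ j <;> by_cases h3 : τ (σ i) < τ (σ j) <;>
        simp [h1, h2, h3]
    rw [this]
    simp only [Equiv.coe_toEmbedding]
    ring

theorem permAct_one {e : End Q M} (he : e * e = e) : permAct (n := n) e 1 = 1 := by
  refine hom_ext he fun S v hv => ?_
  rw [permAct_tprod hv, koszulSign_one, Int.cast_one, one_smul]
  rfl

theorem permAct_mul {e : End Q M} (he : e * e = e) (τ σ : Equiv.Perm (Fin n)) :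
    permAct e (τ * σ) = permAct e τ * permAct e σ := by
  refine hom_ext he fun S v hv => ?_
  rw [End.mul_apply, permAct_tprod hv, permAct_tprod hv, map_smul, permAct_tprod (hv.perm σ),
    smul_smul, koszulSign_mul, mul_comm, Int.cast_mul, mul_comm]
  rfl

theorem permAct_oddProj {e : End Q M} (he : e * e = e) (σ : Equiv.Perm (Fin n)) :
    permAct e σ * oddProj n e = oddProj n e * permAct e σ := by
  refine hom_ext he fun S v hv => ?_
  rw [End.mul_apply, End.mul_apply, oddProj_tprod hv, permAct_tprod hv, map_smul,
    oddProj_tprod (hv.perm σ), Finset.card_map]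
  split_ifs
  · exact permAct_tprod hv σ
  · simp

theorem sign_identity (σ : Equiv.Perm (Fin n)) (S : Finset (Fin n)) (i : Fin n) (hi : i ∉ S) :
    (∏ j ∈ S, pairSign σ i j) * (∏ j ∈ S, if j < i then (-1 : ℤ) else 1) =
      ∏ j ∈ S.map σ.toEmbedding, if j < σ i then (-1 : ℤ) else 1 := by
  rw [Finset.prod_map, ← Finset.prod_mul_distrib]
  refine Finset.prod_congr rfl fun j hj => ?_
  have hij : i ≠ j := fun h => hi (h ▸ hj)
  have hij' : σ i ≠ σ j := fun h => hij (σ.injective h)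
  unfold pairSign
  rcases lt_or_gt_of_ne hij with h1 | h1 <;> rcases lt_or_gt_of_ne hij' with h2 | h2 <;>
    simp [h1, h2, h1.not_gt, h2.not_gt]

theorem permAct_slot {e d : End Q M} (he : e * e = e) (hd : e * d + d * e = d)
    (σ : Equiv.Perm (Fin n)) (i : Fin n) :
    permAct e σ * slot e d i = slot e d (σ i) * permAct e σ := by
  refine hom_ext he fun S v hv => ?_
  rw [End.mul_apply, End.mul_apply, slot_tprod hv, permAct_tprod hv, map_smul, map_smul,
    slot_tprod (hv.perm σ), permAct_tprod (hv.update hd i), smul_smul, smul_smul]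
  have hvec : (fun j => Function.update v i (d (v i)) (σ.symm j)) =
      Function.update (fun j => v (σ.symm j)) (σ i) (d (v (σ.symm (σ i)))) := by
    ext j
    by_cases h : σ.symm j = i
    · have : j = σ i := by rw [← h]; simp
      subst this
      simp
    · have : j ≠ σ i := fun hh => h (by rw [hh]; simp)
      rw [Function.update_of_ne h, Function.update_of_ne this]
  rw [hvec, ← Int.cast_mul, ← Int.cast_mul]
  congr 2
  have sq : ∀ (T : Finset (Fin n)) (P : Fin n → Prop) [DecidablePred P],
      (∏ j ∈ T, if P j then (-1 : ℤ) else 1) * (∏ j ∈ T, if P j then (-1 : ℤ) else 1) = 1 := by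
    intro T P _
    rw [← Finset.prod_mul_distrib]
    refine Finset.prod_eq_one fun j _ => ?_
    split_ifs <;> simp
  have sq' : ∀ T : Finset (Fin n),
      (∏ j ∈ T, pairSign σ i j) * (∏ j ∈ T, pairSign σ i j) = 1 := by
    intro T
    rw [← Finset.prod_mul_distrib]
    refine Finset.prod_eq_one fun j _ => ?_
    unfold pairSign
    split_ifs <;> simp
  by_cases hi : i ∈ S
  · rw [if_pos hi]
    obtain ⟨T, hT, rfl⟩ : ∃ T, i ∉ T ∧ S = insert i T :=
      ⟨S.erase i, Finset.notMem_erase _ _, (Finset.insert_erase hi).symm⟩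
    rw [Finset.erase_insert hT, Finset.prod_insert hT, koszulSign_insert _ hT, Finset.map_insert,
      Finset.prod_insert (by simpa using hT), ← sign_identity σ T i hT]
    simp only [lt_irrefl, if_false, one_mul, Equiv.coe_toEmbedding]
    linear_combination (-koszulSign σ T * ∏ j ∈ T, if j < i then (-1 : ℤ) else 1) * sq' T
  · rw [if_neg hi, koszulSign_insert _ hi, ← sign_identity σ S i hi]
    ring

theorem permAct_diff {e d : End Q M} (he : e * e = e) (hd : e * d + d * e = d)
    (σ : Equiv.Perm (Fin n)) : permAct e σ * diff n e d = diff n e d * permAct e σ := by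
  rw [diff, Finset.mul_sum, Finset.sum_mul, ← Equiv.sum_comp σ (fun i => slot e d i * permAct e σ)]
  exact Finset.sum_congr rfl fun i _ => permAct_slot he hd σ i

theorem oddProj_mul_self {e : End Q M} (he : e * e = e) :
    oddProj n e * oddProj n e = oddProj n e := by
  refine hom_ext he fun S v hv => ?_
  rw [End.mul_apply, oddProj_tprod hv]
  split_ifs with h
  · rw [oddProj_tprod hv, if_pos h]
  · simp

theorem slot_odd {e h : End Q M} (he : e * e = e) (hh : e * h + h * e = h) (i : Fin n) :
    oddProj n e * slot e h i + slot e h i * oddProj n e = slot e h i := by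
  refine hom_ext he fun S v hv => ?_
  rw [LinearMap.add_apply, End.mul_apply, End.mul_apply, oddProj_tprod hv, slot_tprod hv,
    map_smul, oddProj_tprod (hv.update hh i)]
  by_cases hi : i ∈ S
  · have h2 : Odd S.card ↔ ¬ Odd (S.erase i).card := by
      rw [← Finset.card_erase_add_one hi, Nat.odd_add_one]
    by_cases h1 : Odd S.card
    · have := h2.1 h1
      simp only [hi, h1, this, if_true, if_false, smul_zero, zero_add]
      exact slot_tprod hv h i
    · have : Odd (S.erase i).card := by tauto
      simp only [hi, h1, this, if_true, if_false, map_zero, add_zero]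
  · have h2 : Odd (insert i S).card ↔ ¬ Odd S.card := by
      rw [Finset.card_insert_of_notMem hi, Nat.odd_add_one]
    by_cases h1 : Odd S.card
    · simp only [hi, h1, h2, not_true, if_true, if_false, smul_zero, zero_add]
      exact slot_tprod hv h i
    · simp only [hi, h1, h2, not_false_eq_true, if_true, if_false, map_zero, add_zero]

theorem slot_anticomm {e h k : End Q M} (hh : e * h + h * e = h) {i j : Fin n} (hij : i < j) :
    slot e h i * slot e k j + slot e k j * slot e h i = 0 := by
  rw [← eq_neg_iff_add_eq_zero, slot, slot, ← PiTensorProduct.map_mul, ← PiTensorProduct.map_mul]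
  refine PiTensorProduct.ext (MultilinearMap.ext fun v => ?_)
  rw [LinearMap.compMultilinearMap_apply, LinearMap.compMultilinearMap_apply, LinearMap.neg_apply,
    map_tprod, map_tprod]
  have hs : h * (1 - 2 • e) = -((1 - 2 • e) * h) := by
    have : e * h = h - h * e := eq_sub_of_add_eq hh
    simp only [mul_sub, sub_mul, mul_smul_comm, smul_mul_assoc, one_mul, mul_one, this, smul_sub]
    simp only [two_smul]
    abel
  have key := (tprod Q (s := fun _ : Fin n => M)).map_smul_univ (fun a => if a = i then (-1 : Q) else 1)
    (fun a => (((if a < j then 1 - 2 • e else if a = j then k else 1) *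
      (if a < i then 1 - 2 • e else if a = i then h else 1) : End Q M)) (v a))
  rw [Finset.prod_ite_eq' Finset.univ i, if_pos (Finset.mem_univ _), neg_one_smul] at key
  rw [← key]
  congr 1
  ext1 a
  rcases lt_trichotomy a i with hai | rfl | hai
  · simp [hai, hai.ne, hai.trans hij]
  · have := LinearMap.congr_fun hs (v a)
    simpa [hij] using this
  · simp [hai.not_gt, hai.ne']

theorem slot_self {e h k : End Q M} (he : e * e = e) (i : Fin n) :
    slot e h i * slot e k i = PiTensorProduct.map (Function.update 1 i (h * k)) := by
  rw [slot, slot, ← PiTensorProduct.map_mul]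
  congr 1
  ext1 j
  have : (1 - 2 • e) * (1 - 2 • e) = 1 := by
    simp only [mul_sub, sub_mul, mul_smul_comm, smul_mul_assoc, he, one_mul, mul_one]
    abel
  rcases lt_trichotomy j i with hji | rfl | hji
  · simpa [hji, hji.ne] using this
  · simp
  · simp [hji.not_gt, hji.ne']

theorem diff_mul_self {e d : End Q M} (he : e * e = e) (hd : e * d + d * e = d) {f : Q}
    (hf : d * d = f • 1) : diff n e d * diff n e d = ((n : Q) * f) • 1 := by
  have h1 : ∀ i : Fin n, slot e d i * slot e d i = f • (1 : End Q (⨂[Q] _ : Fin n, M)) := by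
    intro i
    rw [slot_self he, hf, PiTensorProduct.map_update_smul]
    have : Function.update (1 : Fin n → End Q M) i 1 = 1 := Function.update_eq_self i _
    rw [this]
    exact congrArg _ PiTensorProduct.map_one
  rw [diff, Finset.sum_mul_sum, ← Finset.sum_product', ← Finset.diag_union_offDiag,
    Finset.sum_union (Finset.disjoint_diag_offDiag _), Finset.sum_diag]
  simp only [h1]
  have h2 : ∑ x ∈ (Finset.univ : Finset (Fin n)).offDiag, slot e d x.1 * slot e d x.2 = 0 := by
    refine Finset.sum_involution (fun x _ => x.swap) ?_ ?_ ?_ ?_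
    · rintro ⟨i, j⟩ hx
      rw [Finset.mem_offDiag] at hx
      rcases lt_or_gt_of_ne hx.2.2 with h | h
      · exact slot_anticomm hd h
      · exact (add_comm _ _).trans (slot_anticomm hd h)
    · rintro ⟨i, j⟩ hx - h
      rw [Finset.mem_offDiag] at hx
      exact hx.2.2 (congrArg Prod.snd h)
    · rintro ⟨i, j⟩ hx
      simpa [eq_comm] using hx
    · simp
  rw [h2, add_zero, Finset.sum_const, Finset.card_univ, Fintype.card_fin, mul_smul,
    Nat.cast_smul_eq_nsmul]

theorem diff_odd {e d : End Q M} (he : e * e = e) (hd : e * d + d * e = d) :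
    oddProj n e * diff n e d + diff n e d * oddProj n e = diff n e d := by
  simp only [diff, Finset.mul_sum, Finset.sum_mul, ← Finset.sum_add_distrib, slot_odd he hd]

theorem diff_homotopy [NeZero n] {e d h : End Q M} (he : e * e = e)
    (hh : e * h + h * e = h) {s : Q} (hs : d * h + h * d = s • 1) :
    diff n e d * slot e h 0 + slot e h 0 * diff n e d = s • 1 := by
  rw [diff, Finset.mul_sum, Finset.sum_mul, ← Finset.sum_add_distrib, Finset.sum_eq_single 0]
  · rw [slot_self he, slot_self he, ← PiTensorProduct.map_update_add, hs,
      PiTensorProduct.map_update_smul]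
    have : Function.update (1 : Fin n → End Q M) 0 1 = 1 := Function.update_eq_self 0 _
    rw [this]
    exact congrArg _ PiTensorProduct.map_one
  · intro i _ hi
    rw [add_comm]
    exact slot_anticomm hh (Fin.pos_iff_ne_zero.2 hi)
  · simp

theorem projective [Module.Finite Q M] [Module.Projective Q M] :
    Module.Projective Q (⨂[Q] _ : Fin n, M) := by
  obtain ⟨s, hs⟩ := Module.projective_def'.1 (inferInstance : Module.Projective Q M)
  let b : Basis M Q (M →₀ Q) := Finsupp.basisSingleOne
  have : Module.Free Q (⨂[Q] _ : Fin n, (M →₀ Q)) :=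
    Module.Free.of_basis (Basis.piTensorProduct fun _ => b)
  refine Module.Projective.of_split (PiTensorProduct.map fun _ => s)
    (PiTensorProduct.map fun _ => Finsupp.linearCombination Q id) ?_
  rw [← PiTensorProduct.map_comp]
  simp [hs]

end MFTensor

namespace MF

variable {Q : Type u} [CommRing Q] {f : Q}

/-- The tensor power `T^n(P)`, a matrix factorization of `n f` with an action of the symmetric group
`Σ_n`. -/
noncomputable def tensorPower (P : MF Q f) (n : ℕ) : GMF Q ((n : Q) * f) (Equiv.Perm (Fin n)) where
  carrier := ⨂[Q] _ : Fin n, P.carrier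
  projective := MFTensor.projective
  e := MFTensor.oddProj n P.e
  e_mul_e := MFTensor.oddProj_mul_self P.e_mul_e
  d := MFTensor.diff n P.e P.d
  d_odd := MFTensor.diff_odd P.e_mul_e P.d_odd
  d_mul_d := MFTensor.diff_mul_self P.e_mul_e P.d_odd P.d_mul_d
  ρ :=
    { toFun := MFTensor.permAct P.e
      map_one' := MFTensor.permAct_one P.e_mul_e
      map_mul' := MFTensor.permAct_mul P.e_mul_e }
  ρ_e := MFTensor.permAct_oddProj P.e_mul_e
  ρ_d := MFTensor.permAct_diff P.e_mul_e P.d_odd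

theorem tensorPower_support (P : MF Q f) (n : ℕ) [NeZero n] :
    (P.tensorPower n).support ⊆ P.support :=
  support_subset fun _ h h1 h2 => ⟨MFTensor.slot P.e h 0, MFTensor.slot_odd P.e_mul_e h1 0,
    MFTensor.diff_homotopy P.e_mul_e h1 h2⟩

end MF

theorem finRotate_pow (n : ℕ) : finRotate n ^ n = 1 := by
  match n with
  | 0 => simp
  | 1 => exact Subsingleton.elim _ _
  | n + 2 =>
    have := pow_orderOf_eq_one (finRotate (n + 2))
    rwa [← Equiv.Perm.lcm_cycleType, cycleType_finRotate, Multiset.lcm_singleton, normalize_eq] at this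

namespace Koszul

variable {Q : Type u} [CommRing Q] {n : ℕ}

/-- The projection of the exterior algebra of `Q^n` onto its odd part `⨁_{k odd} Λ^k`. -/
noncomputable def oddProj (Q : Type u) [CommRing Q] (n : ℕ) :
    Module.End Q (ExteriorAlgebra Q (Fin n → Q)) :=
  Submodule.projection _ _ (CliffordAlgebra.evenOdd_isCompl (0 : QuadraticForm Q (Fin n → Q))).symm

/-- The Koszul differential: contraction with the linear form `Q^n → Q` sending the `i`-th basis
vector to `a i`. -/
noncomputable def diff (a : Fin n → Q) : Module.End Q (ExteriorAlgebra Q (Fin n → Q)) :=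
  CliffordAlgebra.contractLeft (Q := (0 : QuadraticForm Q (Fin n → Q))) (Fintype.linearCombination Q a)

theorem diff_ι_mul (a : Fin n → Q) (v : Fin n → Q) (x) : diff a (ExteriorAlgebra.ι Q v * x) =
    (Fintype.linearCombination Q a v) • x - ExteriorAlgebra.ι Q v * diff a x := 
  CliffordAlgebra.contractLeft_ι_mul _ _ _

theorem oddProj_ι_mul (v : Fin n → Q) (x : ExteriorAlgebra Q (Fin n → Q)) :
    oddProj Q n (ExteriorAlgebra.ι Q v * x) = ExteriorAlgebra.ι Q v * (x - oddProj Q n x) := by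
  have hc := (CliffordAlgebra.evenOdd_isCompl (0 : QuadraticForm Q (Fin n → Q))).symm
  have h0 : oddProj Q n x ∈ CliffordAlgebra.evenOdd (0 : QuadraticForm Q (Fin n → Q)) 1 :=
    Submodule.projection_apply_mem hc x
  have h1 : x - oddProj Q n x ∈ CliffordAlgebra.evenOdd (0 : QuadraticForm Q (Fin n → Q)) 0 :=
    Submodule.sub_projection_mem hc x
  have hv : ExteriorAlgebra.ι Q v ∈ CliffordAlgebra.evenOdd (0 : QuadraticForm Q (Fin n → Q)) 1 :=
    CliffordAlgebra.ι_mem_evenOdd_one _ v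
  have h2 : ExteriorAlgebra.ι Q v * oddProj Q n x ∈
      CliffordAlgebra.evenOdd (0 : QuadraticForm Q (Fin n → Q)) 0 := by
    have := SetLike.mul_mem_graded hv h0
    rwa [show (1 + 1 : ZMod 2) = 0 from rfl] at this
  have h3 : ExteriorAlgebra.ι Q v * (x - oddProj Q n x) ∈
      CliffordAlgebra.evenOdd (0 : QuadraticForm Q (Fin n → Q)) 1 := by
    have := SetLike.mul_mem_graded hv h1
    rwa [add_zero] at this
  have h4 : ExteriorAlgebra.ι Q v * x = ExteriorAlgebra.ι Q v * (x - oddProj Q n x) +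
      ExteriorAlgebra.ι Q v * oddProj Q n x := by rw [← mul_add, sub_add_cancel]
  have h5 : Submodule.projection _ _ hc _ = 0 := (Submodule.projection_apply_eq_zero_iff hc).2 h2
  have h6 : Submodule.projection _ _ hc _ = _ := Submodule.projection_apply_of_mem_left hc h3
  rw [h4, map_add]
  change Submodule.projection _ _ hc _ + Submodule.projection _ _ hc _ = _
  rw [h5, h6, add_zero]

theorem oddProj_algebraMap (r : Q) :
    oddProj Q n (algebraMap Q (ExteriorAlgebra Q (Fin n → Q)) r) = 0 :=
  (Submodule.projection_apply_eq_zero_iff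
    (CliffordAlgebra.evenOdd_isCompl (0 : QuadraticForm Q (Fin n → Q))).symm).2
    (SetLike.algebraMap_mem_graded _ r)

theorem diff_algebraMap (a : Fin n → Q) (r : Q) :
    diff a (algebraMap Q (ExteriorAlgebra Q (Fin n → Q)) r) = 0 :=
  CliffordAlgebra.contractLeft_algebraMap (Q := (0 : QuadraticForm Q (Fin n → Q))) _ r

theorem diff_odd (a : Fin n → Q) : oddProj Q n * diff a + diff a * oddProj Q n = diff a := by
  refine LinearMap.ext fun x => ?_
  rw [LinearMap.add_apply, Module.End.mul_apply, Module.End.mul_apply]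
  induction x using CliffordAlgebra.left_induction with
  | algebraMap r =>
    have h1 := diff_algebraMap a r
    have h2 := oddProj_algebraMap (n := n) r
    rw [h1, h2, map_zero, map_zero, add_zero]
  | add x y hx hy =>
    simp only [map_add]
    rw [add_add_add_comm, hx, hy]
  | ι_mul x v hx =>
    have h1 := diff_ι_mul a v x
    have h2 := oddProj_ι_mul v x
    have h3 := oddProj_ι_mul v (diff a x)
    have h4 := diff_ι_mul a v (x - oddProj Q n x)
    have hx' : diff a (oddProj Q n x) = diff a x - oddProj Q n (diff a x) := eq_sub_of_add_eq' hx
    rw [h1, h2, h4, map_sub, h3, map_smul, map_sub, hx', sub_sub_cancel, smul_sub, mul_sub]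
    abel

end Koszul

/-- The `ℤ/2`-folded Koszul complex `K(a)`: the exterior algebra of `Q^n`, graded by parity, with the
Koszul differential. -/
noncomputable def MF.koszul {Q : Type u} [CommRing Q] {n : ℕ} (a : Fin n → Q) : MF Q 0 where
  carrier := ExteriorAlgebra Q (Fin n → Q)
  finite := Module.Finite.of_basis (Pi.basisFun Q (Fin n)).ExteriorAlgebra
  projective := 
    have := Module.Free.of_basis (Pi.basisFun Q (Fin n)).ExteriorAlgebra
    inferInstance
  e := Koszul.oddProj Q n
  e_mul_e := Submodule.isIdempotentElem_projection
    (CliffordAlgebra.evenOdd_isCompl (0 : QuadraticForm Q (Fin n → Q))).symm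
  d := Koszul.diff a
  d_odd := Koszul.diff_odd a
  d_mul_d := by
    rw [zero_smul]
    exact LinearMap.ext fun x => CliffordAlgebra.contractLeft_contractLeft _ x

theorem MF.koszul_support {Q : Type u} [CommRing Q] {n : ℕ} (a : Fin n → Q) :
    (MF.koszul a).support ⊆ PrimeSpectrum.zeroLocus (Set.range a) := by
  intro q hq
  by_contra h
  rw [PrimeSpectrum.mem_zeroLocus, Set.not_subset] at h
  obtain ⟨_, ⟨i, rfl⟩, hi⟩ := h
  let t : ExteriorAlgebra Q (Fin n → Q) := ExteriorAlgebra.ι Q (Pi.single i 1)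
  have h1 : Koszul.oddProj Q n * LinearMap.mulLeft Q t + LinearMap.mulLeft Q t * Koszul.oddProj Q n
      = LinearMap.mulLeft Q t := by
    refine LinearMap.ext fun x => ?_
    change Koszul.oddProj Q n (t * x) + t * Koszul.oddProj Q n x = t * x
    rw [Koszul.oddProj_ι_mul, ← mul_add, sub_add_cancel]
  have h2 : Koszul.diff a * LinearMap.mulLeft Q t + LinearMap.mulLeft Q t * Koszul.diff a
      = a i • (1 : Module.End Q (ExteriorAlgebra Q (Fin n → Q))) := by
    refine LinearMap.ext fun x => ?_
    change Koszul.diff a (t * x) + t * Koszul.diff a x = a i • x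
    rw [Koszul.diff_ι_mul, sub_add_cancel]
    simp [Fintype.linearCombination_apply_single]
  exact ((MF.koszul a).notMem_support_iff q).2 ⟨a i, hi, LinearMap.mulLeft Q t, h1, h2⟩ hq

/-- The objects of `mf^Z(Q, f)`: matrix factorizations supported in `Z`. -/
abbrev MFSupp {Q : Type u} [CommRing Q] (f : Q) (Z : Set (PrimeSpectrum Q)) : Type (u + 1) :=
  {P : MF Q f // P.support ⊆ Z}

namespace MF
/-- There is a short exact sequence `0 → P' → P → P'' → 0` of matrix factorizations. -/
def ShortExact {Q : Type u} [CommRing Q] {f : Q} (P' P P'' : MF Q f) : Prop :=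
  ∃ (i : Hom P' P) (π : Hom P P''), Function.Injective i.toLin ∧
    Function.Exact i.toLin π.toLin ∧ Function.Surjective π.toLin
end MF

/-- The relations `[P] = [P'] + [P'']` for short exact sequences, and `[P] = [P']` for homotopy
equivalent objects. -/
def K0Relations {Q : Type u} [CommRing Q] (f : Q) (Z : Set (PrimeSpectrum Q)) :
    Set (FreeAbelianGroup (MFSupp f Z)) :=
  {x | ∃ P' P P'' : MFSupp f Z, MF.ShortExact P'.1 P.1 P''.1 ∧
      x = FreeAbelianGroup.of P - (FreeAbelianGroup.of P' + FreeAbelianGroup.of P'')} ∪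
  {x | ∃ P P' : MFSupp f Z, MF.HomotopyEquivalent P.1 P'.1 ∧
      x = FreeAbelianGroup.of P - FreeAbelianGroup.of P'}

/-- The Grothendieck group `K_0(mf^Z(Q, f))`. -/
abbrev K0 {Q : Type u} [CommRing Q] (f : Q) (Z : Set (PrimeSpectrum Q)) : Type (u + 1) :=
  FreeAbelianGroup (MFSupp f Z) ⧸ AddSubgroup.closure (K0Relations f Z)

/-- The class of an object. -/
def K0.mk {Q : Type u} [CommRing Q] {f : Q} {Z : Set (PrimeSpectrum Q)} (P : MFSupp f Z) : K0 f Z :=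
  QuotientAddGroup.mk (FreeAbelianGroup.of P)


/-- The primitive `p`-th root of unity `exp (2 π i / p)`. -/
noncomputable def zetaC (p : ℕ) : ℂ := Complex.exp (2 * Real.pi * Complex.I / p)

/-- The subring `ℤ[exp (2 π i / p)]` of `ℂ`. -/
abbrev ZZeta (p : ℕ) : Type := Algebra.adjoin ℤ {zetaC p}

/-- The subring `A_p = ℤ[1/p, exp (2 π i / p)]` of `ℂ`. -/
abbrev Ap (p : ℕ) : Type := Algebra.adjoin ℤ {(p : ℂ)⁻¹, zetaC p}

namespace CyclicAdams

variable (p : ℕ)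

/-- The root of unity `exp (2 π i / p)` as an element of `ℤ[exp (2 π i / p)]`. -/
noncomputable def zeta : ZZeta p := ⟨zetaC p, Algebra.subset_adjoin (by simp)⟩

variable (Q : Type u) [CommRing Q] [Algebra (Ap p) Q]

/-- The image of `exp (2 π i / p)` in the `A_p`-algebra `Q`. -/
noncomputable def zetaQ : Q :=
  algebraMap (Ap p) Q ⟨zetaC p, Algebra.subset_adjoin (by simp)⟩

/-- The image of `1/p` in the `A_p`-algebra `Q`. -/
noncomputable def pInv : Q :=
  algebraMap (Ap p) Q ⟨(p : ℂ)⁻¹, Algebra.subset_adjoin (by simp)⟩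

theorem pInv_mul [hp : Fact p.Prime] : pInv p Q * (p : Q) = 1 := by
  rw [pInv, ← map_natCast (algebraMap (Ap p) Q), ← map_mul, ← map_one (algebraMap (Ap p) Q)]
  congr 1
  apply Subtype.ext
  have : (p : ℂ) ≠ 0 := Nat.cast_ne_zero.2 hp.out.ne_zero
  simp [this]

theorem isUnit_p [Fact p.Prime] : IsUnit (p : Q) :=
  IsUnit.of_mul_eq_one_right _ (pInv_mul p Q)

theorem zetaQ_pow [hp : Fact p.Prime] (k : ℕ) : (zetaQ p Q ^ k) ^ p = 1 := by
  have h : zetaQ p Q ^ p = 1 := by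
    rw [zetaQ, ← map_pow, ← map_one (algebraMap (Ap p) Q)]
    congr 1
    apply Subtype.ext
    rw [SubmonoidClass.coe_pow]
    exact (Complex.isPrimitiveRoot_exp p hp.out.ne_zero).pow_eq_one
  rw [← pow_mul, mul_comm, pow_mul, h, one_pow]

variable {Q} {f : Q} {Z : Set (PrimeSpectrum Q)}

/-- The object `mult_{1/p} (T^p(P)^(ζ^k))` of `mf^Z(Q, f)`, where `ζ = exp (2 π i / p)` and the
superscript denotes the eigenspace of the `p`-cycle `(1 2 … p)` for the eigenvalue `ζ^k`. -/
noncomputable def eigenPart [Fact p.Prime] (P : MFSupp f Z) (k : ℕ) : MFSupp f Z :=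
  ⟨((P.1.tensorPower p).eigen (finRotate p) (zetaQ p Q ^ k) p (finRotate_pow p)
      (zetaQ_pow p Q k) (isUnit_p p Q)).mult (pInv p Q) f
        (by rw [← mul_assoc, pInv_mul, one_mul]),
    haveI : NeZero p := ⟨(Fact.out : p.Prime).ne_zero⟩
    ((MF.mult_support _ _ (p : Q) (by rw [mul_comm, pInv_mul]) _ _).trans
      (GMF.eigen_support _ _ _ _ _ _ _)).trans ((P.1.tensorPower_support p).trans P.2)⟩

/-- `ψ` is the cyclic Adams operation `ψ^p = ∑_ζ ζ t^p_ζ` on `K_0(mf^Z(Q, f))`, the sum ranging over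
the `p`-th roots of unity `ζ`, where `t^p_ζ [P] = [mult_{1/p} (T^p(P)^(ζ))]`.  The sum is formed in
`K_0(mf^Z(Q, f)) ⊗ ℤ[exp (2 π i / p)]`, into which `K_0(mf^Z(Q, f))` maps by `x ↦ x ⊗ 1`.
As every element of `K_0` is the class of an object, this equation determines `ψ`. -/
def IsAdams [Fact p.Prime] (ψ : K0 f Z → K0 f Z) : Prop :=
  ∀ P : MFSupp f Z, (ψ (K0.mk P) ⊗ₜ[ℤ] (1 : ZZeta p) : K0 f Z ⊗[ℤ] ZZeta p) =
    ∑ k ∈ Finset.range p, K0.mk (eigenPart p P k) ⊗ₜ[ℤ] (zeta p ^ k)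

end CyclicAdams

/-! Write `σ` for the `p`-cycle, `ζ` for a primitive `p`-th root of unity, and `T^p(P)^(z)` for the
`z`-eigenspace of `σ`.

Existence and uniqueness. For `0 < k < p` the powers `σ^k` are conjugate to `σ` in the symmetric
group, so all eigenspaces with `z ≠ 1` are isomorphic (`mk_eigenPart_eq`). As the nontrivial `p`-th
roots of unity sum to `-1`, the defining sum equals `([T^p(P)^(1)] - [T^p(P)^(ζ)]) ⊗ 1` after
applying `mult_{1/p}`. This difference is additive in `P` (`AdditiveOn.cyclicVal_shortExact`). For
an extension `0 → P' → P → P'' → 0`, filter `T^p(P)` by the number of factors from `P''`. The outer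
graded pieces are `T^p(P')` and `T^p(P'')`. On a mixed piece, with `0 < a < p` factors from `P''`,
scaling slot by slot with suitable powers of `ζ` carries the 1-eigenspace isomorphically onto the
`ζ`-eigenspace, so mixed pieces cancel in the difference. Contractible objects go to zero because
tensor powers and eigenspaces do not enlarge supports. Hence the difference descends to `K_0`. It is
the only solution because every element of `K_0` is the class of an object and `x ↦ x ⊗ 1` is
injective, `ℤ[ζ]` being free over `ℤ` on a basis containing 1.

The Koszul complex. `T^p K(a)` is an exterior algebra on `Q^n ⊗ Q^p`, with `σ` rotating `Q^p`. Since
`1/p` and `ζ` lie in `Q`, a discrete Fourier transform replaces the slots by modes of weight `k`, on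
which `σ` acts by `ζ^k`. The differential is the zeroth Fourier mode of the contraction with `a`, so
it pairs only with the modes of weight 0, and the other modes anticommute with it. Splitting off a
mode of weight `k ≠ 0` writes the complex as a vacuum part plus an occupied part. The latter is a
parity shift of the former with eigenvalues multiplied by `ζ^k`, so the eigenvalue sum acquires the
factor `1 - ζ^k` (`eigenSum_mode`). After all such modes are removed there remains a `σ`-invariant
copy of `K(a)` (`diagonal_mulMap`, `mulMap_diagonal`), which `mult_{1/p}` does not change up to
isomorphism (`MF.koszulMultIso`). The factors multiply to `(∏_{0<k<p} (1 - ζ^k))^n = p^n`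
(`prod_modeList`). -/

namespace MF

variable {Q : Type u} [CommRing Q] {f : Q}

/-! ### Null-homotopic scalars, shifts and cones. -/

theorem e_mul_d (P : MF Q f) : P.e * P.d = P.d * (1 - P.e) := by
  rw [mul_sub, mul_one]; exact eq_sub_of_add_eq P.d_odd

/-- The ideal of scalars that are null-homotopic on `P`. -/
def nullIdeal (P : MF Q f) : Ideal Q where
  carrier := {s | ∃ h : Module.End Q P.carrier, P.e * h + h * P.e = h ∧
    P.d * h + h * P.d = s • (1 : Module.End Q P.carrier)}
  zero_mem' := ⟨0, by simp, by simp⟩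
  add_mem' := by
    rintro s t ⟨h, h1, h2⟩ ⟨k, k1, k2⟩
    refine ⟨h + k, ?_, ?_⟩
    · rw [mul_add, add_mul, add_add_add_comm, h1, k1]
    · rw [mul_add, add_mul, add_add_add_comm, h2, k2, add_smul]
  smul_mem' := by
    rintro c s ⟨h, h1, h2⟩
    refine ⟨c • h, ?_, ?_⟩
    · rw [mul_smul_comm, smul_mul_assoc, ← smul_add, h1]
    · rw [mul_smul_comm, smul_mul_assoc, ← smul_add, h2, smul_smul, smul_eq_mul]

theorem notMem_support_iff_nullIdeal (P : MF Q f) (q : PrimeSpectrum Q) :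
    q ∉ P.support ↔ ∃ s ∉ q.asIdeal, s ∈ P.nullIdeal :=
  P.notMem_support_iff q

/-- Contractibility is a local property: were the ideal of null-homotopic scalars proper, a maximal
ideal containing it would belong to the support. -/
theorem support_eq_empty_iff (P : MF Q f) : P.support = ∅ ↔ (1 : Q) ∈ P.nullIdeal := by
  constructor
  · intro h
    rw [← Ideal.eq_top_iff_one]
    by_contra hne
    obtain ⟨m, hm, hle⟩ := Ideal.exists_le_maximal _ hne
    obtain ⟨s, hs, hs'⟩ := (P.notMem_support_iff_nullIdeal ⟨m, hm.isPrime⟩).1 (by simp [h])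
    exact hs (hle hs')
  · intro h
    refine Set.eq_empty_of_forall_notMem fun q => ?_
    exact (P.notMem_support_iff_nullIdeal q).2 ⟨1, q.asIdeal.one_notMem, h⟩

/-- A scalar that is null-homotopic up to a square-zero error has null-homotopic square. -/
theorem sq_mem_nullIdeal (P : MF Q f) (s : Q) (h : Module.End Q P.carrier)
    (ho : P.e * h + h * P.e = h)
    (hN : (P.d * h + h * P.d - s • 1) * (P.d * h + h * P.d - s • 1) = 0) :
    s * s ∈ P.nullIdeal := by
  set K := P.d * h + h * P.d with hK
  have hdK : P.d * K = K * P.d := by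
    rw [hK, mul_add, add_mul, ← mul_assoc, P.d_mul_d, mul_assoc h, P.d_mul_d]
    simp [mul_assoc, add_comm]
  have heh : P.e * h = h * (1 - P.e) := by rw [mul_sub, mul_one]; exact eq_sub_of_add_eq ho
  have heK : P.e * K = K * P.e := by
    have h1 : P.e * (P.d * h) = P.d * h * P.e := by
      rw [← mul_assoc, P.e_mul_d, mul_assoc, sub_mul, heh, one_mul, mul_assoc]; noncomm_ring
    have h2 : P.e * (h * P.d) = h * P.d * P.e := by
      rw [← mul_assoc, heh, mul_assoc, sub_mul, P.e_mul_d, one_mul, mul_assoc]; noncomm_ring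
    rw [hK, mul_add, add_mul, h1, h2]
  -- Expanding `(K - s)² = 0`. As `K` is even and commutes with `d`, so does the factor `2s - K`,
  -- and `h (2s - K)` is then a null-homotopy of `s²`.
  have hKK : K * ((2 * s) • 1 - K) = (s * s) • 1 := by
    have : K * K = (2 * s) • K - (s * s) • 1 := by
      have h3 := hN
      simp only [sub_mul, mul_sub, mul_smul_comm, smul_mul_assoc, mul_one, one_mul] at h3
      rw [smul_sub, smul_smul] at h3
      have h4 : K * K - ((2 * s) • K - (s * s) • 1) = 0 := by
        rw [← h3, two_mul, add_smul]; abel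
      exact sub_eq_zero.1 h4
    rw [mul_sub, this, mul_smul_comm, mul_one]; abel
  refine ⟨h * ((2 * s) • 1 - K), ?_, ?_⟩
  · rw [mul_assoc, sub_mul, ← heK, smul_mul_assoc, one_mul,
      show (2 * s) • P.e - P.e * K = P.e * ((2 * s) • 1 - K) by simp [mul_sub],
      ← mul_assoc, ← mul_assoc, ← add_mul, ho]
  · rw [mul_assoc, sub_mul, ← hdK, smul_mul_assoc, one_mul,
      show (2 * s) • P.d - P.d * K = P.d * ((2 * s) • 1 - K) by simp [mul_sub],
      ← mul_assoc, ← mul_assoc, ← add_mul, hKK]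

/-- The shift `P[1]`. -/
abbrev shift (P : MF Q f) : MF Q f where
  carrier := P.carrier
  e := 1 - P.e
  e_mul_e := by simp [mul_sub, sub_mul, P.e_mul_e]
  d := -P.d
  d_odd := by
    rw [sub_mul, one_mul, mul_neg, P.e_mul_d]
    noncomm_ring
  d_mul_d := by rw [neg_mul_neg, P.d_mul_d]

theorem support_shift (P : MF Q f) : P.shift.support ⊆ P.support := by
  refine support_subset fun s h h1 h2 => ⟨-h, ?_, ?_⟩
  · change (1 - P.e) * (-h) + (-h) * (1 - P.e) = -h
    conv_rhs => rw [← h1]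
    have : P.e * h = h - h * P.e := eq_sub_of_add_eq h1
    simp only [mul_neg, neg_mul, sub_mul, mul_sub, one_mul, mul_one, this]
    abel
  · change (-P.d) * (-h) + (-h) * (-P.d) = _
    rw [neg_mul_neg, neg_mul_neg]
    exact h2

/-- The mapping cone. -/
abbrev cone {A B : MF Q f} (g : Hom A B) : MF Q f where
  carrier := B.carrier × A.carrier
  e := LinearMap.prodMap B.e (1 - A.e)
  e_mul_e := by
    rw [LinearMap.prodMap_mul, B.e_mul_e]
    simp [mul_sub, sub_mul, A.e_mul_e]
  d := LinearMap.prod (LinearMap.coprod B.d g.toLin) (LinearMap.coprod 0 (-A.d))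
  d_odd := by
    refine LinearMap.ext fun ⟨b, a⟩ => Prod.ext
      (?_ : B.e (B.d b + g.toLin a) + (B.d (B.e b) + g.toLin (a - A.e a)) = B.d b + g.toLin a)
      (?_ : (0 + -A.d a) - A.e (0 + -A.d a) + (0 + -A.d (a - A.e a)) = 0 + -A.d a)
    · have h1 : B.e (B.d b) + B.d (B.e b) = B.d b := LinearMap.congr_fun B.d_odd b
      have h3 : B.e (g.toLin a) = g.toLin (A.e a) := LinearMap.congr_fun g.comm_e a
      conv_rhs => rw [← h1]
      rw [map_add, map_sub, h3]
      abel
    · have h2 : A.e (A.d a) + A.d (A.e a) = A.d a := LinearMap.congr_fun A.d_odd a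
      rw [map_sub, map_add, map_neg, map_zero,
        show A.e (A.d a) = A.d a - A.d (A.e a) from eq_sub_of_add_eq h2]
      abel
  d_mul_d := by
    refine LinearMap.ext fun ⟨b, a⟩ => ?_
    have h1 := LinearMap.congr_fun B.d_mul_d b
    have h2 := LinearMap.congr_fun A.d_mul_d a
    have h3 := LinearMap.congr_fun g.comm_d a
    simp only [Module.End.mul_apply, LinearMap.comp_apply, LinearMap.smul_apply,
      Module.End.one_apply] at h1 h2 h3
    simp [h1, h2, h3]

theorem shortExact_cone {A B : MF Q f} (g : Hom A B) : ShortExact B (cone g) A.shift := by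
  refine ⟨⟨LinearMap.inl Q B.carrier A.carrier, ?_, ?_⟩,
    ⟨LinearMap.snd Q B.carrier A.carrier, ?_, ?_⟩, LinearMap.inl_injective, ?_,
    LinearMap.snd_surjective⟩
  · refine LinearMap.ext fun b => Prod.ext (rfl : B.e b = B.e b)
      (?_ : (0 : A.carrier) - A.e 0 = 0)
    rw [map_zero, sub_zero]
  · refine LinearMap.ext fun b => Prod.ext (?_ : B.d b + g.toLin 0 = B.d b)
      (?_ : (0 : A.carrier) + -A.d 0 = 0)
    · rw [map_zero, add_zero]
    · rw [map_zero, neg_zero, add_zero]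
  · rfl
  · refine LinearMap.ext fun ⟨b, a⟩ => (?_ : -A.d a = 0 + -A.d a)
    rw [zero_add]
  · exact Function.Exact.inl_snd

/-- The matrix with entries `-h_B`, `k` and `h_A` contracts the cone up to the error `g h_A - h_B g
: A → B`. This error is strictly triangular, so its square is zero and `sq_mem_nullIdeal` with `s =
1` applies; no coherence between the two homotopies is needed. -/
theorem support_cone_eq_empty {A B : MF Q f} (g : Hom A B) (k : Hom B A)
    (h1 : Homotopic (k.comp g) (Hom.id A)) (h2 : Homotopic (g.comp k) (Hom.id B)) :
    (cone g).support = ∅ := by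
  obtain ⟨hA, hA1, hA2⟩ := h1
  obtain ⟨hB, hB1, hB2⟩ := h2
  have a1 : ∀ a, A.e (hA a) + hA (A.e a) = hA a := LinearMap.congr_fun hA1
  have b1 : ∀ b, B.e (hB b) + hB (B.e b) = hB b := LinearMap.congr_fun hB1
  have a2 : ∀ a, A.d (hA a) + hA (A.d a) = k.toLin (g.toLin a) - a := LinearMap.congr_fun hA2
  have b2 : ∀ b, B.d (hB b) + hB (B.d b) = g.toLin (k.toLin b) - b := LinearMap.congr_fun hB2
  have ke : ∀ b, A.e (k.toLin b) = k.toLin (B.e b) := LinearMap.congr_fun k.comm_e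
  have kd : ∀ b, A.d (k.toLin b) = k.toLin (B.d b) := LinearMap.congr_fun k.comm_d
  rw [support_eq_empty_iff, ← one_mul (1 : Q)]
  let h : Module.End Q (B.carrier × A.carrier) :=
    LinearMap.prod (LinearMap.coprod (-hB) 0) (LinearMap.coprod k.toLin hA)
  have key : ∀ (b : B.carrier) (a : A.carrier), ((cone g).d * h + h * (cone g).d -
      (1 : Q) • 1 : Module.End Q (B.carrier × A.carrier)) (b, a) =
      (g.toLin (hA a) - hB (g.toLin a), 0) := by
    intro b a
    refine Prod.ext
      (?_ : B.d (-hB b + 0) + g.toLin (k.toLin b + hA a) + (-hB (B.d b + g.toLin a) + 0)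
        - (1 : Q) • b = g.toLin (hA a) - hB (g.toLin a))
      (?_ : 0 + -A.d (k.toLin b + hA a) + (k.toLin (B.d b + g.toLin a) + hA (0 + -A.d a))
        - (1 : Q) • a = 0)
    · rw [map_add g.toLin, show g.toLin (k.toLin b) = B.d (hB b) + hB (B.d b) + b by
        rw [b2]; abel]
      simp only [map_add, map_neg, map_zero, one_smul]
      abel
    · simp only [map_add, map_neg, map_zero, one_smul, kd]
      rw [show k.toLin (g.toLin a) = A.d (hA a) + hA (A.d a) + a by rw [a2]; abel]
      abel
  refine sq_mem_nullIdeal _ 1 h ?_ ?_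
  · refine LinearMap.ext fun ⟨b, a⟩ => Prod.ext
      (?_ : B.e (-hB b + 0) + (-hB (B.e b) + 0) = -hB b + 0)
      (?_ : k.toLin b + hA a - A.e (k.toLin b + hA a) + (k.toLin (B.e b) + hA (a - A.e a)) =
        k.toLin b + hA a)
    · conv_rhs => rw [← b1]
      simp only [map_add, map_neg, map_zero]
      abel
    · simp only [map_add, map_sub, ke]
      rw [show A.e (hA a) = hA a - hA (A.e a) from eq_sub_of_add_eq (a1 a)]
      abel
  · refine LinearMap.ext fun ⟨b, a⟩ => ?_
    have h4 := key b a
    have h5 := key (g.toLin (hA a) - hB (g.toLin a)) 0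
    refine (congrArg _ h4).trans (h5.trans ?_)
    simp

/-! ### Short exact sequences and supports. -/

/-- A short exact sequence together with an even splitting of the underlying modules. -/
structure Splitting (P' P P'' : MF Q f) where
  i : Hom P' P
  t : Hom P P''
  r : P.carrier →ₗ[Q] P'.carrier
  s : P''.carrier →ₗ[Q] P.carrier
  r_e : P'.e ∘ₗ r = r ∘ₗ P.e
  s_e : P.e ∘ₗ s = s ∘ₗ P''.e
  r_i : r ∘ₗ i.toLin = LinearMap.id
  t_s : t.toLin ∘ₗ s = LinearMap.id
  t_i : t.toLin ∘ₗ i.toLin = 0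
  i_r : i.toLin ∘ₗ r = LinearMap.id - s ∘ₗ t.toLin

theorem ShortExact.nonempty_splitting {P' P P'' : MF Q f} (h : ShortExact P' P P'') :
    Nonempty (Splitting P' P P'') := by
  obtain ⟨i, t, hi, hex, ht⟩ := h
  obtain ⟨s0, hs0⟩ := Module.projective_lifting_property t.toLin LinearMap.id ht
  -- The even part of an arbitrary linear section is again a section, because `t` is even. The
  -- retraction `r` is then forced by `i r = 1 - s t`.
  let s : P''.carrier →ₗ[Q] P.carrier :=
    P.e ∘ₗ s0 ∘ₗ P''.e + (1 - P.e) ∘ₗ s0 ∘ₗ (1 - P''.e)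
  have he : ∀ x, P.e (P.e x) = P.e x := fun x => LinearMap.congr_fun P.e_mul_e x
  have he'' : ∀ x, P''.e (P''.e x) = P''.e x := fun x => LinearMap.congr_fun P''.e_mul_e x
  have hte : ∀ x, t.toLin (P.e x) = P''.e (t.toLin x) :=
    fun x => (LinearMap.congr_fun t.comm_e x).symm
  have hie : ∀ x, i.toLin (P'.e x) = P.e (i.toLin x) :=
    fun x => (LinearMap.congr_fun i.comm_e x).symm
  have hs0' : ∀ x, t.toLin (s0 x) = x := fun x => LinearMap.congr_fun hs0 x
  have hs : ∀ x, s x = P.e (s0 (P''.e x)) +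
      (s0 x - s0 (P''.e x) - (P.e (s0 x) - P.e (s0 (P''.e x)))) := by
    intro x
    simp [s]
  have hse : ∀ x, P.e (s x) = s (P''.e x) := by
    intro x
    rw [hs, hs]
    simp [he, he'']
  have hts : ∀ x, t.toLin (s x) = x := by
    intro x
    rw [hs]
    simp [hte, hs0', he'']
  have hti : ∀ x, t.toLin (i.toLin x) = 0 := fun x => (hex _).2 ⟨x, rfl⟩
  let r0 : P.carrier →ₗ[Q] LinearMap.range i.toLin :=
    LinearMap.codRestrict _ (LinearMap.id - s ∘ₗ t.toLin) fun x =>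
      (hex _).1 (by simp [hts])
  let r : P.carrier →ₗ[Q] P'.carrier := (LinearEquiv.ofInjective i.toLin hi).symm ∘ₗ r0
  have hir : ∀ x, i.toLin (r x) = x - s (t.toLin x) := by
    intro x
    have := congrArg Subtype.val ((LinearEquiv.ofInjective i.toLin hi).apply_symm_apply (r0 x))
    exact this
  refine ⟨⟨i, t, r, s, ?_, LinearMap.ext hse, ?_, LinearMap.ext hts, LinearMap.ext hti,
    LinearMap.ext hir⟩⟩
  · refine LinearMap.ext fun x => hi ?_
    simp [hie, hir, hte, hse]
  · refine LinearMap.ext fun x => hi ?_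
    simp [hir, hti]

/-- Null-homotopies of `a` on `P'` and of `b` on `P''` are glued along a module splitting. The
result is a null-homotopy of `ab` on `P` up to an error `N` with `t N = 0` and `N i = 0`. Hence `N²
= 0`, and `(ab)²` is null-homotopic. -/
theorem ShortExact.support_subset {P' P P'' : MF Q f} (h : ShortExact P' P P'') :
    P.support ⊆ P'.support ∪ P''.support := by
  obtain ⟨σ⟩ := h.nonempty_splitting
  intro q hq
  by_contra hq'
  rw [Set.mem_union, not_or, notMem_support_iff, notMem_support_iff] at hq'
  obtain ⟨⟨a, ha, h', h1', h2'⟩, ⟨b, hb, h'', h1'', h2''⟩⟩ := hq'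
  have hab : (a * b) * (a * b) ∉ q.asIdeal := fun hh => by
    rcases q.2.mem_or_mem hh with hh | hh <;> rcases q.2.mem_or_mem hh with hh | hh <;> tauto
  refine (P.notMem_support_iff_nullIdeal q).2 ⟨_, hab, ?_⟩ hq
  have eri : ∀ x, σ.r (σ.i.toLin x) = x := fun x => LinearMap.congr_fun σ.r_i x
  have ets : ∀ x, σ.t.toLin (σ.s x) = x := fun x => LinearMap.congr_fun σ.t_s x
  have eti : ∀ x, σ.t.toLin (σ.i.toLin x) = 0 := fun x => LinearMap.congr_fun σ.t_i x
  have eir : ∀ x, σ.i.toLin (σ.r x) = x - σ.s (σ.t.toLin x) := fun x => LinearMap.congr_fun σ.i_r x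
  have ere : ∀ x, σ.r (P.e x) = P'.e (σ.r x) := fun x => (LinearMap.congr_fun σ.r_e x).symm
  have ese : ∀ x, P.e (σ.s x) = σ.s (P''.e x) := fun x => LinearMap.congr_fun σ.s_e x
  have eie : ∀ x, P.e (σ.i.toLin x) = σ.i.toLin (P'.e x) := LinearMap.congr_fun σ.i.comm_e
  have ete : ∀ x, σ.t.toLin (P.e x) = P''.e (σ.t.toLin x) :=
    fun x => (LinearMap.congr_fun σ.t.comm_e x).symm
  have eid : ∀ x, P.d (σ.i.toLin x) = σ.i.toLin (P'.d x) := LinearMap.congr_fun σ.i.comm_d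
  have etd : ∀ x, σ.t.toLin (P.d x) = P''.d (σ.t.toLin x) :=
    fun x => (LinearMap.congr_fun σ.t.comm_d x).symm
  have k1' : ∀ x, P'.e (h' x) + h' (P'.e x) = h' x := LinearMap.congr_fun h1'
  have k1'' : ∀ x, P''.e (h'' x) + h'' (P''.e x) = h'' x := LinearMap.congr_fun h1''
  have k2' : ∀ x, P'.d (h' x) + h' (P'.d x) = a • x := LinearMap.congr_fun h2'
  have k2'' : ∀ x, P''.d (h'' x) + h'' (P''.d x) = b • x := LinearMap.congr_fun h2''
  let h0 : Module.End Q P.carrier :=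
    b • (σ.i.toLin ∘ₗ h' ∘ₗ σ.r) + a • (σ.s ∘ₗ h'' ∘ₗ σ.t.toLin)
  have hh0 : ∀ x, h0 x = b • σ.i.toLin (h' (σ.r x)) + a • σ.s (h'' (σ.t.toLin x)) := fun _ => rfl
  set N := P.d * h0 + h0 * P.d - (a * b) • 1 with hN
  have hNx : ∀ x, N x = P.d (h0 x) + h0 (P.d x) - (a * b) • x := fun _ => rfl
  have ht : ∀ x, σ.t.toLin (N x) = 0 := by
    intro x
    rw [hNx, hh0, hh0]
    simp only [map_sub, map_add, map_smul, eid, eti, smul_zero, zero_add, etd, ets]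
    rw [← smul_add, k2'', smul_smul, sub_self]
  have hi : ∀ x, N (σ.i.toLin x) = 0 := by
    intro x
    rw [hNx, eid, hh0, hh0, eri, eti, eti, eri]
    simp only [map_zero, smul_zero, add_zero, map_smul, eid]
    rw [← smul_add, ← map_add, k2', map_smul, smul_smul, mul_comm b, sub_self]
  refine sq_mem_nullIdeal _ _ h0 ?_ ?_
  · refine LinearMap.ext fun x => ?_
    rw [LinearMap.add_apply, Module.End.mul_apply, Module.End.mul_apply, hh0, hh0, ere, ete,
      map_add, map_smul, map_smul, eie, ese, add_add_add_comm, ← smul_add, ← smul_add, ← map_add,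
      ← map_add, k1', k1'']
  · rw [← hN]
    refine LinearMap.ext fun x => ?_
    have h3 : N x = σ.i.toLin (σ.r (N x)) := by rw [eir, ht, map_zero, sub_zero]
    rw [Module.End.mul_apply, h3, hi, LinearMap.zero_apply]

/-- An isomorphism of matrix factorizations. -/
structure Iso (A B : MF Q f) where
  hom : Hom A B
  inv : B.carrier →ₗ[Q] A.carrier
  inv_hom : inv ∘ₗ hom.toLin = LinearMap.id
  hom_inv : hom.toLin ∘ₗ inv = LinearMap.id

theorem support_zero : (zero Q f).support = ∅ :=
  (support_eq_empty_iff _).2 ⟨0, by simp, LinearMap.ext fun _ => Subsingleton.elim (α := PUnit) _ _⟩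

/-- With this, invariance under isomorphism is a special case of additivity, and supports of
isomorphic objects are compared by `ShortExact.support_subset`. -/
theorem Iso.shortExact {A B : MF Q f} (φ : Iso A B) : ShortExact A B (zero Q f) := by
  have hl : Function.LeftInverse φ.inv φ.hom.toLin := LinearMap.congr_fun φ.inv_hom
  have hr : Function.RightInverse φ.inv φ.hom.toLin := LinearMap.congr_fun φ.hom_inv
  refine ⟨φ.hom, ⟨0, by simp, by simp⟩, hl.injective, fun y => ?_, fun y => ⟨0, ?_⟩⟩
  · simp [hr.surjective y]
  · exact Subsingleton.elim (α := PUnit) _ _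

theorem Iso.support_subset {A B : MF Q f} (φ : Iso A B) : B.support ⊆ A.support := by
  simpa [support_zero] using φ.shortExact.support_subset

/-! ### Additive invariants and classes in `K_0`. -/

/-- A function on matrix factorizations that is additive on the short exact sequences of objects
supported in `Z` and vanishes on contractible objects. -/
structure AdditiveOn (Z : Set (PrimeSpectrum Q)) {A : Type*} [AddCommGroup A]
    (χ : MF Q f → A) : Prop where
  shortExact : ∀ {P' P P'' : MF Q f}, P'.support ⊆ Z → P.support ⊆ Z → P''.support ⊆ Z →
    ShortExact P' P P'' → χ P = χ P' + χ P''
  contractible : ∀ {P : MF Q f}, P.support = ∅ → χ P = 0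

namespace AdditiveOn

variable {Z : Set (PrimeSpectrum Q)} {A : Type*} [AddCommGroup A] {χ : MF Q f → A}

theorem iso (hχ : AdditiveOn Z χ) {P P' : MF Q f} (φ : Iso P P') (hP : P.support ⊆ Z) :
    χ P = χ P' := by
  have := hχ.shortExact hP (φ.support_subset.trans hP) (by simp [support_zero]) φ.shortExact
  rw [this, hχ.contractible support_zero, add_zero]

/-- The cone of the identity is contractible and is an extension of the shift of `P` by `P`. -/
theorem shift (hχ : AdditiveOn Z χ) {P : MF Q f} (hP : P.support ⊆ Z) :
    χ P.shift = - χ P := by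
  have h0 : Homotopic ((Hom.id P).comp (Hom.id P)) (Hom.id P) := ⟨0, by simp, by
    simp [Hom.comp, Hom.id]⟩
  have h1 := support_cone_eq_empty (Hom.id P) (Hom.id P) h0 h0
  have h2 := hχ.shortExact hP (by simp [h1]) (P.support_shift.trans hP) (shortExact_cone (Hom.id P))
  rw [hχ.contractible h1] at h2
  exact eq_neg_of_add_eq_zero_right h2.symm

/-- The cone of a homotopy equivalence is contractible and is an extension of the shift of `P` by
`P'`. So homotopy invariance need not be part of `AdditiveOn`. -/
theorem homotopyEquivalent (hχ : AdditiveOn Z χ) {P P' : MF Q f} (h : HomotopyEquivalent P P')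
    (hP : P.support ⊆ Z) (hP' : P'.support ⊆ Z) : χ P = χ P' := by
  obtain ⟨g, k, h1, h2⟩ := h
  have h3 := support_cone_eq_empty g k h1 h2
  have h4 := hχ.shortExact hP' (by simp [h3]) (P.support_shift.trans hP) (shortExact_cone g)
  rw [hχ.contractible h3, hχ.shift hP, ← sub_eq_add_neg] at h4
  exact (sub_eq_zero.1 h4.symm).symm

end AdditiveOn

theorem ShortExact.mult {P' P P'' : MF Q f} (h : ShortExact P' P P'') (c f' : Q)
    (hf : f' = c * f) : ShortExact (P'.mult c f' hf) (P.mult c f' hf) (P''.mult c f' hf) := by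
  obtain ⟨i, t, h1, h2, h3⟩ := h
  have key : ∀ {A B : MF Q f} (g : Hom A B), ∃ g' : Hom (A.mult c f' hf) (B.mult c f' hf),
      g'.toLin = g.toLin := by
    intro A B g
    refine ⟨⟨g.toLin, g.comm_e, LinearMap.ext fun x => ?_⟩, rfl⟩
    have he : ∀ x, B.e (g.toLin x) = g.toLin (A.e x) := LinearMap.congr_fun g.comm_e
    have hd : ∀ x, B.d (g.toLin x) = g.toLin (A.d x) := LinearMap.congr_fun g.comm_d
    have h : ∀ x : A.carrier, B.d (B.e (g.toLin x)) + c • (B.e (B.d (g.toLin x))) =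
        g.toLin (A.d (A.e x) + c • (A.e (A.d x))) := fun x => by
      rw [he, hd, hd, he, map_add, map_smul]
    exact h x
  obtain ⟨i', hi⟩ := key i
  obtain ⟨t', ht⟩ := key t
  exact ⟨i', t', hi ▸ h1, hi ▸ ht ▸ h2, ht ▸ h3⟩

theorem AdditiveOn.mult {Z : Set (PrimeSpectrum Q)} {A : Type*} [AddCommGroup A] {f' : Q}
    {χ : MF Q f' → A} (hχ : AdditiveOn Z χ) {b c : Q} (hb : b * c = 1) (hf : f' = c * f) :
    AdditiveOn Z fun P : MF Q f => χ (P.mult c f' hf) where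
  shortExact h' h h'' hs := hχ.shortExact ((mult_support _ c b hb _ hf).trans h')
    ((mult_support _ c b hb _ hf).trans h) ((mult_support _ c b hb _ hf).trans h'') (hs.mult c f' hf)
  contractible h := hχ.contractible (Set.subset_empty_iff.1
    ((mult_support _ c b hb _ hf).trans h.subset))

open Classical in
/-- The class in `K_0(mf^Z(Q, f))` of a matrix factorization supported in `Z`. -/
noncomputable def cls (Z : Set (PrimeSpectrum Q)) (P : MF Q f) : K0 f Z :=
  if h : P.support ⊆ Z then K0.mk ⟨P, h⟩ else 0

theorem cls_val {Z : Set (PrimeSpectrum Q)} (P : MFSupp f Z) : cls Z P.1 = K0.mk P :=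
  dif_pos P.2

theorem additiveOn_cls (Z : Set (PrimeSpectrum Q)) : AdditiveOn (f := f) Z (cls Z) where
  shortExact {P' P P''} h' h h'' hs := by
    rw [cls, cls, cls, dif_pos h, dif_pos h', dif_pos h'']
    refine (QuotientAddGroup.eq_iff_sub_mem).2 (AddSubgroup.subset_closure (Or.inl
      ⟨⟨P', h'⟩, ⟨P, h⟩, ⟨P'', h''⟩, hs, rfl⟩))
  contractible {P} h := by
    have hP : P.support ⊆ Z := by simp [h]
    have h0 : (zero Q f).support ⊆ Z := by simp [support_zero]
    have h1 : K0.mk ⟨P, hP⟩ = K0.mk (⟨zero Q f, h0⟩ : MFSupp f Z) := by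
      refine (QuotientAddGroup.eq_iff_sub_mem).2 (AddSubgroup.subset_closure (Or.inr
        ⟨⟨P, hP⟩, ⟨zero Q f, h0⟩, ?_, rfl⟩))
      obtain ⟨k, k1, k2⟩ := (support_eq_empty_iff P).1 h
      exact (homotopyEquivalent_zero_iff P).2 ⟨k, k1, by rw [k2, one_smul]⟩
    -- The relation `[0] = [0] + [0]` forces `[0] = 0`.
    have h2 : ShortExact (zero Q f) (zero Q f) (zero Q f) :=
      (⟨Hom.id _, LinearMap.id, rfl, rfl⟩ : Iso (zero Q f) (zero Q f)).shortExact
    have h3 : K0.mk (⟨zero Q f, h0⟩ : MFSupp f Z) =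
        K0.mk (⟨zero Q f, h0⟩ : MFSupp f Z) + K0.mk (⟨zero Q f, h0⟩ : MFSupp f Z) :=
      (QuotientAddGroup.eq_iff_sub_mem).2 (AddSubgroup.subset_closure (Or.inl
        ⟨⟨_, h0⟩, ⟨_, h0⟩, ⟨_, h0⟩, h2, rfl⟩))
    rw [cls, dif_pos hP, h1]
    exact left_eq_add.1 h3

end MF

/-- Negatives are represented by shifts. Sums are represented by direct sums, obtained here as the
cone of the zero map from the shift of `P'` to `P`; the two shifts of `P'` cancel in sign. -/
theorem K0.mk_surjective {Q : Type u} [CommRing Q] {f : Q} {Z : Set (PrimeSpectrum Q)} :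
    Function.Surjective (K0.mk : MFSupp f Z → K0 f Z) := by
  have hneg : ∀ P : MFSupp f Z, K0.mk ⟨P.1.shift, P.1.support_shift.trans P.2⟩ = - K0.mk P := by
    intro P
    rw [← MF.cls_val, ← MF.cls_val, ← (MF.additiveOn_cls Z).shift P.2]
  have hadd : ∀ P P' : MFSupp f Z, ∃ R, K0.mk R = K0.mk P + K0.mk P' := by
    intro P P'
    let g : MF.Hom P'.1.shift P.1 := ⟨0, by simp, by simp⟩
    have hs' : P'.1.shift.support ⊆ Z := P'.1.support_shift.trans P'.2
    have hs := MF.shortExact_cone g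
    have hs'' : P'.1.shift.shift.support ⊆ Z := (P'.1.shift.support_shift).trans hs'
    have hc : (MF.cone g).support ⊆ Z :=
      hs.support_subset.trans (Set.union_subset P.2 hs'')
    refine ⟨⟨MF.cone g, hc⟩, ?_⟩
    have := (MF.additiveOn_cls Z).shortExact P.2 hc hs'' hs
    rw [(MF.additiveOn_cls Z).shift hs', (MF.additiveOn_cls Z).shift P'.2, neg_neg, MF.cls_val,
      MF.cls_val] at this
    rw [← this]
    exact (MF.cls_val ⟨_, hc⟩).symm
  intro x
  induction x using QuotientAddGroup.induction_on with
  | H x =>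
    induction x using FreeAbelianGroup.induction_on with
    | zero =>
      refine ⟨⟨MF.zero Q f, by simp [MF.support_zero]⟩, ?_⟩
      rw [← MF.cls_val, (MF.additiveOn_cls Z).contractible MF.support_zero]
      rfl
    | of P => exact ⟨P, rfl⟩
    | neg P _ => exact ⟨_, hneg P⟩
    | add x y hx hy =>
      obtain ⟨P, hP⟩ := hx
      obtain ⟨P', hP'⟩ := hy
      obtain ⟨R, hR⟩ := hadd P P'
      exact ⟨R, by rw [hR, hP, hP']; rfl⟩

/-! ### Cutting a matrix factorization by an even idempotent. -/

namespace MF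

variable {Q : Type u} [CommRing Q] {f : Q}

/-- An even idempotent whose range is a matrix factorization under the compressed differential. -/
structure IsCut (X : MF Q f) (π : Module.End Q X.carrier) : Prop where
  idem : π * π = π
  even : X.e * π = π * X.e
  diff : π * X.d * π * X.d * π = f • π

/-- The range of an even idempotent `π`, with the compressed differential `π d`. -/
abbrev cut (X : MF Q f) (π : Module.End Q X.carrier) (h : X.IsCut π) : MF Q f where
  carrier := LinearMap.range π
  finite := Module.Finite.of_surjective π.rangeRestrict π.surjective_rangeRestrict
  projective := Module.Projective.of_split (LinearMap.range π).subtype π.rangeRestrict <| by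
    ext ⟨x, y, rfl⟩
    exact LinearMap.congr_fun h.idem y
  e := X.e.restrict (p := LinearMap.range π) (q := LinearMap.range π) <| by
    rintro _ ⟨y, rfl⟩
    exact ⟨X.e y, (LinearMap.congr_fun h.even y).symm⟩
  e_mul_e := by
    ext x
    exact LinearMap.congr_fun X.e_mul_e x
  d := (π * X.d).restrict (p := LinearMap.range π) (q := LinearMap.range π) fun x _ => ⟨X.d x, rfl⟩
  d_odd := by
    have : X.e * (π * X.d) + π * X.d * X.e = π * X.d := by
      rw [← mul_assoc, h.even, mul_assoc, mul_assoc, ← mul_add, X.d_odd]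
    ext x
    exact LinearMap.congr_fun this x
  d_mul_d := by
    ext ⟨x, y, rfl⟩
    exact LinearMap.congr_fun h.diff y

/-- Isomorphisms between cuts. -/
def cutIso {X X' : MF Q f} {π : Module.End Q X.carrier} {π' : Module.End Q X'.carrier}
    (h : X.IsCut π) (h' : X'.IsCut π') (u : X.carrier →ₗ[Q] X'.carrier)
    (v : X'.carrier →ₗ[Q] X.carrier) (hvu : v ∘ₗ u = π) (huv : u ∘ₗ v = π')
    (he : X'.e ∘ₗ u = u ∘ₗ X.e) (hd : π' ∘ₗ X'.d ∘ₗ u ∘ₗ π = π' ∘ₗ u ∘ₗ X.d ∘ₗ π) :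
    Iso (X.cut π h) (X'.cut π' h') :=
  have h1 : ∀ x, v (u x) = π x := LinearMap.congr_fun hvu
  have h2 : ∀ x, u (v x) = π' x := LinearMap.congr_fun huv
  have h3 : ∀ x, π (π x) = π x := LinearMap.congr_fun h.idem
  have h4 : ∀ x, π' (π' x) = π' x := LinearMap.congr_fun h'.idem
  { hom :=
    { toLin := u.restrict (p := LinearMap.range π) (q := LinearMap.range π') <| by
        rintro _ ⟨y, rfl⟩
        exact ⟨u y, by rw [← h1, h2]⟩
      comm_e := by
        ext ⟨x, y, rfl⟩
        exact LinearMap.congr_fun he (π y)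
      comm_d := by
        ext ⟨x, y, rfl⟩
        refine (LinearMap.congr_fun hd y).trans ?_
        change π' (u (X.d (π y))) = u (π (X.d (π y)))
        rw [← h2, h1] }
    inv := v.restrict (p := LinearMap.range π') (q := LinearMap.range π) <| by
        rintro _ ⟨y, rfl⟩
        exact ⟨v y, by rw [← h1, h2]⟩
    inv_hom := by
      ext ⟨x, y, rfl⟩
      exact (h1 _).trans (h3 _)
    hom_inv := by
      ext ⟨x, y, rfl⟩
      exact (h2 _).trans (h4 _) }

theorem IsCut.of_commute {X : MF Q f} {π : Module.End Q X.carrier} (hi : π * π = π)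
    (he : X.e * π = π * X.e) (hd : X.d * π = π * X.d) : X.IsCut π where
  idem := hi
  even := he
  diff := by
    rw [mul_assoc, mul_assoc, hd, mul_assoc, ← mul_assoc π π, hi, ← mul_assoc X.d π, hd,
      mul_assoc, X.d_mul_d, ← mul_assoc, hi, mul_smul_comm, mul_one]

theorem IsCut.one (X : MF Q f) : X.IsCut 1 := .of_commute (by simp) (by simp) (by simp)

/-- Every matrix factorization is the cut by the identity. -/
def cutOne (X : MF Q f) : Iso (X.cut 1 (.one X)) X where
  hom := ⟨(LinearMap.range (1 : Module.End Q X.carrier)).subtype, rfl, rfl⟩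
  inv := LinearMap.rangeRestrict 1
  inv_hom := rfl
  hom_inv := rfl

/-- Only the range of `π` is assumed `d`-stable, not its kernel: this is the situation of a step of
a filtration. -/
theorem IsCut.of_stable {X : MF Q f} {π : Module.End Q X.carrier} (hi : π * π = π)
    (he : X.e * π = π * X.e) (hd : X.d * π = π * X.d * π) : X.IsCut π where
  idem := hi
  even := he
  diff := by
    rw [← hd, mul_assoc, mul_assoc, ← mul_assoc π, ← hd, ← mul_assoc, X.d_mul_d, smul_mul_assoc,
      one_mul]

theorem sub_mul_d_mul_sub {X : MF Q f} {A B : Module.End Q X.carrier}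
    (hBA : B * A = A) (hAA : A * A = A)
    (hA : X.d * A = A * X.d * A) :
    (B - A) * X.d * A = 0 := by
  rw [mul_assoc, hA, ← mul_assoc, ← mul_assoc, sub_mul B, hBA, hAA, sub_self, zero_mul, zero_mul]

/-- The range of `B` is the direct sum of the ranges of `A` and `B - A`. Since the range of `A` is
`d`-stable, it is a subobject, and the range of `B - A` with the compressed differential is the
quotient. -/
theorem shortExact_cut {X : MF Q f} {A B : Module.End Q X.carrier} (hAB : A * B = A)
    (hBA : B * A = A) (cA : X.IsCut A) (cB : X.IsCut B) (cBA : X.IsCut (B - A))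
    (hA : X.d * A = A * X.d * A) :
    ShortExact (X.cut A cA) (X.cut B cB) (X.cut (B - A) cBA) := by
  have eAA : ∀ x, A (A x) = A x := LinearMap.congr_fun cA.idem
  have eBB : ∀ x, B (B x) = B x := LinearMap.congr_fun cB.idem
  have eAB : ∀ x, A (B x) = A x := LinearMap.congr_fun hAB
  have eBA : ∀ x, B (A x) = A x := LinearMap.congr_fun hBA
  have hle : LinearMap.range A ≤ LinearMap.range B := by
    rintro _ ⟨y, rfl⟩
    exact ⟨A y, eBA y⟩
  refine ⟨⟨Submodule.inclusion hle, ?_, ?_⟩,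
    ⟨(B - A).restrict (p := LinearMap.range B) (q := LinearMap.range (B - A)) fun x _ => ⟨x, rfl⟩,
      ?_, ?_⟩, Submodule.inclusion_injective hle, ?_, ?_⟩
  · rfl
  · ext ⟨x, y, rfl⟩
    change B (X.d (A y)) = A (X.d (A y))
    have : X.d (A y) = A (X.d (A y)) := LinearMap.congr_fun hA y
    rw [this, eBA, eAA]
  · ext ⟨x, y, rfl⟩
    exact LinearMap.congr_fun cBA.even _
  · ext ⟨x, y, rfl⟩
    have h1 : (B - A) * X.d * (B - A) = (B - A) * (B * X.d) * B := by
      rw [mul_sub, sub_mul_d_mul_sub hBA cA.idem hA, sub_zero, ← mul_assoc (B - A) B,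
        sub_mul B A B, cB.idem, hAB]
    have h2 := LinearMap.congr_fun h1 (B y)
    simp only [Module.End.mul_apply, eBB] at h2
    exact h2
  · rintro ⟨x, y, rfl⟩
    constructor
    · intro h
      have h' : B (B y) - A (B y) = 0 := congrArg Subtype.val h
      rw [eBB, sub_eq_zero] at h'
      exact ⟨⟨A (B y), B y, rfl⟩, Subtype.ext h'.symm⟩
    · rintro ⟨⟨_, z, rfl⟩, h⟩
      have h' : A z = B y := congrArg Subtype.val h
      refine Subtype.ext (?_ : B (B y) - A (B y) = 0)
      rw [← h', eBA, eAA, sub_self]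
  · rintro ⟨_, y, rfl⟩
    refine ⟨⟨B y, y, rfl⟩, Subtype.ext (?_ : B (B y) - A (B y) = B y - A y)⟩
    rw [eBB, eAB]

/-- A null-homotopy `h` on `X` compresses to `π h` on the range, because `π` commutes with `d`. -/
theorem support_cut {X : MF Q f} {π : Module.End Q X.carrier} (hπ : X.IsCut π)
    (hd : X.d * π = π * X.d) : (X.cut π hπ).support ⊆ X.support := by
  refine support_subset fun s h h1 h2 => ?_
  refine ⟨(π * h).restrict (p := LinearMap.range π) (q := LinearMap.range π) fun x _ => ⟨h x, rfl⟩,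
    ?_, ?_⟩
  · ext ⟨x, y, rfl⟩
    have h3 : ∀ y, X.e (π y) = π (X.e y) := LinearMap.congr_fun hπ.even
    have h4 : ∀ y, X.e (h y) + h (X.e y) = h y := LinearMap.congr_fun h1
    change X.e (π (h (π y))) + π (h (X.e (π y))) = π (h (π y))
    rw [h3 (h _), ← map_add, h4]
  · ext ⟨x, y, rfl⟩
    have h3 : ∀ y, X.d (π y) = π (X.d y) := LinearMap.congr_fun hd
    have h4 : ∀ y, X.d (h y) + h (X.d y) = s • y := LinearMap.congr_fun h2
    have h5 : ∀ x, π (π x) = π x := LinearMap.congr_fun hπ.idem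
    change π (X.d (π (h (π y)))) + π (h (π (X.d (π y)))) = s • π y
    rw [h3 (h _), h5, ← h3 (π y), h5, ← map_add, h4, map_smul, h5]

end MF

/-! ### Projections onto eigenspaces of an operator of finite order. -/

section eigenProj

variable {Q : Type u} [CommRing Q] {M M' : Type*} [AddCommGroup M] [Module Q M] [AddCommGroup M']
  [Module Q M'] {b z w : Q} {p : ℕ}

/-- The projection onto the `z`-eigenspace of an operator of order dividing `p`; here `b = 1/p`. -/
def eigenProj (b z : Q) (p : ℕ) (T : Module.End Q M) : Module.End Q M :=
  b • ∑ k ∈ Finset.range p, (z ^ (p - 1) • T) ^ k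

/-- Here `z ^ (p - 1)` plays the role of `z⁻¹`. The operator `z⁻¹ T` has `p`-th power 1, so it fixes
its own geometric sum. -/
theorem mul_eigenProj (hz : z ^ p = 1) {T : Module.End Q M} (hT : T ^ p = 1) :
    T * eigenProj b z p T = z • eigenProj b z p T := by
  rcases Nat.eq_zero_or_pos p with rfl | hp0
  · simp [eigenProj]
  have h := mul_geom_sum (z ^ (p - 1) • T) p
  rw [smul_pow, hT, ← pow_mul, mul_comm, pow_mul, hz, one_pow, one_smul, sub_self, sub_mul, one_mul,
    sub_eq_zero] at h
  conv_rhs => rw [eigenProj, ← h]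
  rw [eigenProj, mul_smul_comm, smul_mul_assoc, smul_comm z b, smul_smul z, mul_pow_sub_one hp0.ne',
    hz, one_smul]

theorem eigenProj_apply_of_eigen (hb : b * p = 1) (hz : z ^ p = 1) {T : Module.End Q M} {x : M}
    (hx : T x = z • x) : eigenProj b z p T x = x := by
  rcases Nat.eq_zero_or_pos p with rfl | hp0
  · have : Subsingleton Q := subsingleton_of_zero_eq_one (by simpa using hb)
    have := Module.subsingleton Q M
    exact Subsingleton.elim _ _
  have hTx : (z ^ (p - 1) • T) x = x := by
    rw [LinearMap.smul_apply, hx, smul_smul, pow_sub_one_mul hp0.ne', hz, one_smul]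
  have hTk : ∀ k : ℕ, ((z ^ (p - 1) • T) ^ k) x = x := by
    intro k
    induction k with
    | zero => simp
    | succ k ih => rw [pow_succ, Module.End.mul_apply, hTx, ih]
  simp only [eigenProj, LinearMap.smul_apply, LinearMap.sum_apply, hTk, Finset.sum_const,
    Finset.card_range]
  rw [← Nat.cast_smul_eq_nsmul Q, smul_smul, hb, one_smul]

theorem eigenProj_mul_self (hb : b * p = 1) (hz : z ^ p = 1) {T : Module.End Q M}
    (hT : T ^ p = 1) : eigenProj b z p T * eigenProj b z p T = eigenProj b z p T :=
  LinearMap.ext fun x => eigenProj_apply_of_eigen hb hz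
    (LinearMap.congr_fun (mul_eigenProj hz hT) x)

/-- The map `C` multiplies eigenvalues by `w`. It is applied to the twisting operators on the mixed
levels and to the creation operators. -/
theorem eigenProj_comp (hw : w ^ p = 1) {T : Module.End Q M} {T' : Module.End Q M'}
    {C : M →ₗ[Q] M'} (h : T' ∘ₗ C = w • (C ∘ₗ T)) :
    eigenProj b (z * w) p T' ∘ₗ C = C ∘ₗ eigenProj b z p T := by
  rcases Nat.eq_zero_or_pos p with rfl | hp0
  · simp [eigenProj]
  have h1 : ∀ x, ((z * w) ^ (p - 1) • T') (C x) = C ((z ^ (p - 1) • T) x) := by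
    intro x
    have : T' (C x) = w • C (T x) := LinearMap.congr_fun h x
    rw [LinearMap.smul_apply, this, smul_smul, mul_pow, mul_assoc, pow_sub_one_mul hp0.ne', hw,
      mul_one, LinearMap.smul_apply, map_smul]
  have h2 : ∀ (k : ℕ) x, (((z * w) ^ (p - 1) • T') ^ k) (C x) = C (((z ^ (p - 1) • T) ^ k) x) := by
    intro k
    induction k with
    | zero => simp
    | succ k ih => intro x; rw [pow_succ, pow_succ, Module.End.mul_apply, h1, ih]; rfl
  refine LinearMap.ext fun x => ?_
  simp [eigenProj, LinearMap.sum_apply, h2, map_sum]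

theorem eigenProj_comm {T : Module.End Q M} {T' : Module.End Q M'}
    {C : M →ₗ[Q] M'} (h : T' ∘ₗ C = C ∘ₗ T) :
    eigenProj b z p T' ∘ₗ C = C ∘ₗ eigenProj b z p T := by
  simpa using eigenProj_comp (b := b) (z := z) (p := p) (w := 1) (one_pow _) (by simpa using h)

/-- On vectors fixed by `T` the projection is a scalar, namely a normalized sum of powers of `z⁻¹`.
It will be 1 or 0 according to whether the eigenvalue `z = ζ^k` is trivial. -/
theorem eigenProj_mul_of_fixed {T y : Module.End Q M} (h : T * y = y) :
    eigenProj b z p T * y = (b * ∑ k ∈ Finset.range p, (z ^ (p - 1)) ^ k) • y := by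
  have : ∀ k : ℕ, (z ^ (p - 1) • T) ^ k * y = (z ^ (p - 1)) ^ k • y := by
    intro k
    rw [smul_pow, smul_mul_assoc]
    congr 1
    induction k with
    | zero => simp
    | succ k ih => rw [pow_succ, mul_assoc, h, ih]
  rw [eigenProj, smul_mul_assoc, Finset.sum_mul, Finset.sum_congr rfl fun k _ => this k,
    ← Finset.sum_smul, smul_smul]

end eigenProj

namespace GMF

variable {Q : Type u} [CommRing Q] {f : Q} {G : Type v} [Group G] {b z : Q} {p : ℕ} {g : G}

theorem isCut_eigenProj (X : GMF Q f G) (hb : b * p = 1) (hz : z ^ p = 1) (hg : g ^ p = 1) :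
    X.IsCut (eigenProj b z p (X.ρ g)) :=
  have hT : X.ρ g ^ p = 1 := by rw [← map_pow, hg, map_one]
  .of_commute (eigenProj_mul_self hb hz hT) (eigenProj_comm (X.ρ_e g)).symm
    (eigenProj_comm (X.ρ_d g)).symm

/-- The eigenspace is the cut by the eigenprojection. -/
def eigenIso (X : GMF Q f G) (hb : b * p = 1) (hz : z ^ p = 1) (hg : g ^ p = 1)
    (hp : IsUnit (p : Q)) : MF.Iso (X.eigen g z p hg hz hp)
      (X.toMF.cut (eigenProj b z p (X.ρ g)) (X.isCut_eigenProj hb hz hg)) :=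
  have hT : X.ρ g ^ p = 1 := by rw [← map_pow, hg, map_one]
  have h1 : ∀ x : X.carrier, x ∈ X.eigenspace g z → eigenProj b z p (X.ρ g) x = x := fun x hx =>
    eigenProj_apply_of_eigen hb hz (mem_eigenspace.1 hx)
  have h2 : X.eigenspace g z = LinearMap.range (eigenProj b z p (X.ρ g)) := by
    refine le_antisymm (fun x hx => ⟨x, h1 x hx⟩) ?_
    rintro _ ⟨x, rfl⟩
    exact mem_eigenspace.2 (LinearMap.congr_fun (mul_eigenProj hz hT) x)
  { hom :=
    { toLin := Submodule.inclusion h2.le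
      comm_e := rfl
      comm_d := by
        ext x
        exact h1 _ (X.map_eigenspace g z X.d (X.ρ_d g) x.1 x.2) }
    inv := Submodule.inclusion h2.ge
    inv_hom := rfl
    hom_inv := rfl }

/-- The eigenspaces for `(g, z)` and `(g', z')` are isomorphic if `t` maps one onto the other. -/
def eigenIsoOfConj (X : GMF Q f G) {g' : G} {z' : Q} (hz : z ^ p = 1) (hg : g ^ p = 1)
    (hz' : z' ^ p = 1) (hg' : g' ^ p = 1) (hp : IsUnit (p : Q)) (t : G)
    (h : ∀ x ∈ X.eigenspace g z, X.ρ t x ∈ X.eigenspace g' z')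
    (h' : ∀ x ∈ X.eigenspace g' z', X.ρ t⁻¹ x ∈ X.eigenspace g z) :
    MF.Iso (X.eigen g z p hg hz hp) (X.eigen g' z' p hg' hz' hp) where
  hom :=
  { toLin := (X.ρ t).restrict h
    comm_e := by
      ext x
      exact Subtype.ext (LinearMap.congr_fun (X.ρ_e t) x.1).symm
    comm_d := by
      ext x
      exact Subtype.ext (LinearMap.congr_fun (X.ρ_d t) x.1).symm }
  inv := (X.ρ t⁻¹).restrict h'
  inv_hom := by
    ext x
    have : X.ρ t⁻¹ * X.ρ t = 1 := by rw [← map_mul, inv_mul_cancel, map_one]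
    exact Subtype.ext (LinearMap.congr_fun this x.1)
  hom_inv := by
    ext x
    have : X.ρ t * X.ρ t⁻¹ = 1 := by rw [← map_mul, mul_inv_cancel, map_one]
    exact Subtype.ext (LinearMap.congr_fun this x.1)

end GMF

/-! ### Values of additive invariants on cuts and filtrations. -/

namespace MF

variable {Q : Type u} [CommRing Q] {f : Q} {Z : Set (PrimeSpectrum Q)}

/-- The cut by `π` is defined and supported in `Z`. -/
def CutIn (Z : Set (PrimeSpectrum Q)) (X : MF Q f) (π : Module.End Q X.carrier) : Prop :=
  ∃ h : X.IsCut π, (X.cut π h).support ⊆ Z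

open Classical in
/-- The value of `χ` on the cut by `π`. -/
noncomputable def cutVal {A : Type*} [AddCommGroup A] (χ : MF Q f → A) (X : MF Q f)
    (π : Module.End Q X.carrier) : A :=
  if h : X.IsCut π then χ (X.cut π h) else 0

variable {A : Type*} [AddCommGroup A] {χ : MF Q f → A}

theorem cutVal_eq {X : MF Q f} {π : Module.End Q X.carrier} (h : X.IsCut π) :
    cutVal χ X π = χ (X.cut π h) :=
  dif_pos h

theorem CutIn.of_commute {X : MF Q f} {π : Module.End Q X.carrier} (hX : X.support ⊆ Z)
    (hi : π * π = π) (he : X.e * π = π * X.e) (hd : X.d * π = π * X.d) : CutIn Z X π :=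
  ⟨.of_commute hi he hd, (support_cut _ hd).trans hX⟩

theorem CutIn.iso {X X' : MF Q f} {π : Module.End Q X.carrier}
    {π' : Module.End Q X'.carrier} (h : CutIn Z X π) (h' : X'.IsCut π')
    (u : X.carrier →ₗ[Q] X'.carrier) (v : X'.carrier →ₗ[Q] X.carrier) (hvu : v ∘ₗ u = π)
    (huv : u ∘ₗ v = π') (he : X'.e ∘ₗ u = u ∘ₗ X.e)
    (hd : π' ∘ₗ X'.d ∘ₗ u ∘ₗ π = π' ∘ₗ u ∘ₗ X.d ∘ₗ π) :
    CutIn Z X' π' :=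
  ⟨h', (cutIso h.1 h' u v hvu huv he hd).support_subset.trans h.2⟩

theorem AdditiveOn.cutVal_iso (hχ : AdditiveOn Z χ) {X X' : MF Q f} {π : Module.End Q X.carrier}
    {π' : Module.End Q X'.carrier} (h : CutIn Z X π) (h' : X'.IsCut π')
    (u : X.carrier →ₗ[Q] X'.carrier) (v : X'.carrier →ₗ[Q] X.carrier) (hvu : v ∘ₗ u = π)
    (huv : u ∘ₗ v = π') (he : X'.e ∘ₗ u = u ∘ₗ X.e)
    (hd : π' ∘ₗ X'.d ∘ₗ u ∘ₗ π = π' ∘ₗ u ∘ₗ X.d ∘ₗ π) :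
    cutVal χ X π = cutVal χ X' π' := by
  rw [cutVal_eq h.1, cutVal_eq h']
  exact hχ.iso (cutIso h.1 h' u v hvu huv he hd) h.2

theorem isCut_zero (X : MF Q f) : X.IsCut 0 := .of_commute (by simp) (by simp) (by simp)

theorem support_cut_zero (X : MF Q f) : (X.cut 0 X.isCut_zero).support = ∅ := by
  refine (support_eq_empty_iff _).2 ⟨0, by simp, LinearMap.ext fun x => ?_⟩
  have : Subsingleton (X.cut 0 X.isCut_zero).carrier :=
    ⟨fun ⟨x, y, hy⟩ ⟨x', y', hy'⟩ => Subtype.ext (hy.symm.trans hy')⟩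
  exact Subsingleton.elim _ _

theorem CutIn.zero (X : MF Q f) : CutIn Z X 0 :=
  ⟨X.isCut_zero, by rw [support_cut_zero]; exact Set.empty_subset _⟩

theorem AdditiveOn.cutVal_zero (hχ : AdditiveOn Z χ) (X : MF Q f) : cutVal χ X 0 = 0 := by
  rw [cutVal_eq X.isCut_zero, hχ.contractible X.support_cut_zero]

theorem AdditiveOn.cutVal_one (hχ : AdditiveOn Z χ) {X : MF Q f} (hX : X.support ⊆ Z) :
    cutVal χ X 1 = χ X := by
  rw [cutVal_eq (.one X)]
  exact hχ.iso X.cutOne ((support_cut _ (by simp)).trans hX)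

theorem AdditiveOn.cutVal_add (hχ : AdditiveOn Z χ) {X : MF Q f} {A B : Module.End Q X.carrier}
    (hAB : A * B = A) (hBA : B * A = A) (cA : CutIn Z X A) (cB : X.IsCut B)
    (cBA : CutIn Z X (B - A)) (hA : X.d * A = A * X.d * A) :
    CutIn Z X B ∧ cutVal χ X B = cutVal χ X A + cutVal χ X (B - A) := by
  have hs := shortExact_cut hAB hBA cA.1 cB cBA.1 hA
  have hB : (X.cut B cB).support ⊆ Z := hs.support_subset.trans (Set.union_subset cA.2 cBA.2)
  refine ⟨⟨cB, hB⟩, ?_⟩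
  rw [cutVal_eq cA.1, cutVal_eq cB, cutVal_eq cBA.1]
  exact hχ.shortExact cA.2 hB cBA.2 hs

/-- Additivity along a filtration given by orthogonal idempotents `E a`, where the differential is
the sum of a part commuting with the `E a` and a part `δ` lowering the index. -/
theorem AdditiveOn.cutVal_filtration (hχ : AdditiveOn Z χ) {X : MF Q f} {n : ℕ}
    (E : ℕ → Module.End Q X.carrier) {ε δ : Module.End Q X.carrier} (hε : ε * ε = ε)
    (hεe : X.e * ε = ε * X.e) (hεd : X.d * ε = ε * X.d)
    (hE : ∀ a b, E a * E b = if a = b then E a else 0) (hsum : ∑ a ∈ Finset.range n, E a = 1)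
    (hEe : ∀ a, X.e * E a = E a * X.e) (hEε : ∀ a, ε * E a = E a * ε)
    (hEd : ∀ a, (X.d - δ) * E a = E a * (X.d - δ))
    (hδ : ∀ a b, a + 1 ≠ b → E a * δ * E b = 0)
    (hcut : ∀ a < n, CutIn Z X (ε * E a)) :
    cutVal χ X ε = ∑ a ∈ Finset.range n, cutVal χ X (ε * E a) := by
  -- The projection onto the filtration step of indices below `m`.
  let F : ℕ → Module.End Q X.carrier := fun m => ∑ a ∈ Finset.range m, E a
  have hFS : ∀ m, F (m + 1) = F m + E m := fun m => Finset.sum_range_succ _ _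
  have hEF : ∀ b m, E b * F m = if b < m then E b else 0 := by
    intro b m
    simp only [F, Finset.mul_sum, hE, Finset.sum_ite_eq, Finset.mem_range]
  have hFE : ∀ b m, F m * E b = if b < m then E b else 0 := by
    intro b m
    simp only [F, Finset.sum_mul, hE, Finset.sum_ite_eq', Finset.mem_range]
  have hFF : ∀ m, F m * F m = F m := by
    intro m
    have : ∀ b ∈ Finset.range m, E b * F m = E b := fun b hb => by
      rw [hEF, if_pos (Finset.mem_range.1 hb)]
    conv_lhs => rw [show F m = ∑ a ∈ Finset.range m, E a from rfl, Finset.sum_mul]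
    exact Finset.sum_congr rfl this
  have hFε : ∀ m, ε * F m = F m * ε := fun m => by
    simp only [F, Finset.mul_sum, Finset.sum_mul, hEε]
  have hFe : ∀ m, X.e * F m = F m * X.e := fun m => by
    simp only [F, Finset.mul_sum, Finset.sum_mul, hEe]
  have hFd : ∀ m, (X.d - δ) * F m = F m * (X.d - δ) := fun m => by
    simp only [F, Finset.mul_sum, Finset.sum_mul, hEd]
  -- The blocks of `(1 - F m) δ F m` go from an index `b < m` to an index `a ≥ m`. They vanish since
  -- `δ` only maps index `a + 1` to `a`.
  have hFδ : ∀ m ≤ n, δ * F m = F m * δ * F m := by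
    intro m hm
    have h1 : (1 - F m) * δ * F m = 0 := by
      rw [← hsum, ← Finset.sum_range_add_sum_Ico _ hm, add_sub_cancel_left, Finset.sum_mul,
        Finset.sum_mul]
      refine Finset.sum_eq_zero fun a ha => ?_
      rw [show F m = ∑ b ∈ Finset.range m, E b from rfl, Finset.mul_sum]
      refine Finset.sum_eq_zero fun b hb => hδ a b ?_
      rw [Finset.mem_Ico] at ha
      rw [Finset.mem_range] at hb
      omega
    rw [sub_mul, sub_mul, one_mul, sub_eq_zero] at h1
    exact h1
  have hFst : ∀ m ≤ n, X.d * F m = F m * X.d * F m := by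
    intro m hm
    have h1 := hFd m
    have h2 : F m * (X.d - δ) * F m = (X.d - δ) * F m := by
      rw [← hFd, mul_assoc, hFF]
    calc X.d * F m = (X.d - δ) * F m + δ * F m := by rw [sub_mul, sub_add_cancel]
      _ = F m * (X.d - δ) * F m + F m * δ * F m := by rw [h2, ← hFδ m hm]
      _ = F m * X.d * F m := by rw [mul_sub, sub_mul, sub_add_cancel]
  have hεF : ∀ m l, ε * F m * (ε * F l) = ε * (F m * F l) := fun m l => by
    rw [mul_assoc, ← mul_assoc (F m), ← hFε, mul_assoc ε, ← mul_assoc, hε]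
  have hst : ∀ m ≤ n, X.d * (ε * F m) = ε * F m * X.d * (ε * F m) := by
    intro m hm
    calc X.d * (ε * F m) = ε * (F m * X.d * F m) := by
          rw [← mul_assoc, hεd, mul_assoc, hFst m hm]
      _ = ε * ε * F m * X.d * F m := by rw [hε]; simp only [mul_assoc]
      _ = ε * F m * (ε * X.d) * F m := by
          rw [mul_assoc ε ε, show ε * (ε * F m) = ε * (F m * ε) by rw [hFε]]; simp only [mul_assoc]
      _ = ε * F m * X.d * (ε * F m) := by rw [← hεd]; simp only [mul_assoc]
  have hcutF : ∀ m ≤ n, X.IsCut (ε * F m) := fun m hm =>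
    .of_stable (by rw [hεF, hFF]) (by rw [← mul_assoc, hεe, mul_assoc, hFe, mul_assoc]) (hst m hm)
  -- The support condition is carried through the induction: that of the larger step follows from
  -- the smaller step and the graded piece.
  have main : ∀ m ≤ n, CutIn Z X (ε * F m) ∧
      cutVal χ X (ε * F m) = ∑ a ∈ Finset.range m, cutVal χ X (ε * E a) := by
    intro m
    induction m with
    | zero =>
      intro _
      have : ε * F 0 = 0 := by simp [F]
      rw [this, hχ.cutVal_zero]
      exact ⟨CutIn.zero X, by simp⟩
    | succ m ih =>
      intro hm
      obtain ⟨h1, h2⟩ := ih (by omega)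
      have hsub : ε * F (m + 1) - ε * F m = ε * E m := by rw [hFS, mul_add, add_sub_cancel_left]
      have hFm : F m * F (m + 1) = F m := by
        rw [hFS, mul_add, hFF, hFE, if_neg (lt_irrefl m), add_zero]
      have hFm' : F (m + 1) * F m = F m := by
        rw [hFS, add_mul, hFF, hEF, if_neg (lt_irrefl m), add_zero]
      have := hχ.cutVal_add (by rw [hεF, hFm]) (by rw [hεF, hFm']) h1 (hcutF _ hm)
        (by rw [hsub]; exact hcut m hm) (hst m (by omega))
      refine ⟨this.1, ?_⟩
      rw [this.2, hsub, h2, Finset.sum_range_succ]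
  have hfin := (main n le_rfl).2
  rwa [show F n = 1 from hsum, mul_one] at hfin

end MF

/-! ### Levels of the tensor power: how many factors lie in the range of `q`. -/

namespace MFTensor

variable {Q : Type u} [CommRing Q] {M N : Type u} [AddCommGroup M] [Module Q M] [AddCommGroup N]
  [Module Q N] {n : ℕ} {e : Module.End Q M} {e' : Module.End Q N}

open Module PiTensorProduct

/-- Even maps preserve the parities of the factors, so both sides carry the same Koszul sign and
only the slots are relabelled. -/
theorem permAct_comp_map (he : e * e = e) (g : Fin n → M →ₗ[Q] N)
    (hg : ∀ i, e' ∘ₗ g i = g i ∘ₗ e) (σ : Equiv.Perm (Fin n)) :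
    permAct e' σ ∘ₗ PiTensorProduct.map g =
      PiTensorProduct.map (fun i => g (σ.symm i)) ∘ₗ permAct e σ := by
  refine hom_ext he fun S v hv => ?_
  have hv' : Homog e' S fun i => g i (v i) := by
    intro i
    have : e' (g i (v i)) = g i (e (v i)) := LinearMap.congr_fun (hg i) (v i)
    rw [this, hv i]
    split_ifs <;> simp
  rw [LinearMap.comp_apply, map_tprod, permAct_tprod hv', LinearMap.comp_apply, permAct_tprod hv,
    map_smul, map_tprod]

theorem map_comp_parityProj (g : M →ₗ[Q] N) (hg : e' ∘ₗ g = g ∘ₗ e) (S : Finset (Fin n)) :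
    parityProj e' S ∘ₗ PiTensorProduct.map (fun _ => g) =
      PiTensorProduct.map (fun _ => g) ∘ₗ parityProj e S := by
  rw [parityProj, parityProj, ← PiTensorProduct.map_comp, ← PiTensorProduct.map_comp]
  congr 1
  ext1 i
  split_ifs
  · exact hg
  · rw [LinearMap.sub_comp, hg, LinearMap.comp_sub]; rfl

theorem map_comp_oddProj (g : M →ₗ[Q] N) (hg : e' ∘ₗ g = g ∘ₗ e) :
    oddProj n e' ∘ₗ PiTensorProduct.map (fun _ => g) =
      PiTensorProduct.map (fun _ => g) ∘ₗ oddProj n e := by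
  refine LinearMap.ext fun x => ?_
  simp only [oddProj, LinearMap.comp_apply, LinearMap.sum_apply, map_sum]
  exact Finset.sum_congr rfl fun S _ => LinearMap.congr_fun (map_comp_parityProj g hg S) x

theorem map_comp_slot (g : M →ₗ[Q] N) (hg : e' ∘ₗ g = g ∘ₗ e) {d : End Q M} {d' : End Q N}
    (hd : d' ∘ₗ g = g ∘ₗ d) (i : Fin n) :
    slot e' d' i ∘ₗ PiTensorProduct.map (fun _ => g) =
      PiTensorProduct.map (fun _ => g) ∘ₗ slot e d i := by
  rw [slot, slot, ← PiTensorProduct.map_comp, ← PiTensorProduct.map_comp]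
  congr 1
  ext1 j
  split_ifs
  · rw [LinearMap.sub_comp, LinearMap.smul_comp, hg, LinearMap.comp_sub, LinearMap.comp_smul]; rfl
  · exact hd
  · rfl

theorem map_comp_diff (g : M →ₗ[Q] N) (hg : e' ∘ₗ g = g ∘ₗ e) {d : End Q M} {d' : End Q N}
    (hd : d' ∘ₗ g = g ∘ₗ d) :
    diff n e' d' ∘ₗ PiTensorProduct.map (fun _ => g) =
      PiTensorProduct.map (fun _ => g) ∘ₗ diff n e d := by
  refine LinearMap.ext fun x => ?_
  simp only [diff, LinearMap.comp_apply, LinearMap.sum_apply, map_sum]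
  exact Finset.sum_congr rfl fun i _ => LinearMap.congr_fun (map_comp_slot g hg hd i) x

theorem slot_add (e h k : End Q M) (i : Fin n) : slot e (h + k) i = slot e h i + slot e k i := by
  -- Written as an update at `i`, the operator is visibly linear in `h`.
  have key : ∀ h : End Q M, slot e h i = PiTensorProduct.map (Function.update
      (fun j => if j < i then 1 - 2 • e else 1) i h) := by
    intro h
    rw [slot]
    congr 1
    ext1 j
    by_cases hj : j = i
    · subst hj; simp
    · simp [hj]
  rw [key, key, key, PiTensorProduct.map_update_add]

/-- The projection onto the part of the tensor power with exactly `a` factors in the range of `q`. -/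
def levelProj (n : ℕ) (q : End Q M) (a : ℕ) : End Q (⨂[Q] _ : Fin n, M) :=
  ∑ S : Finset (Fin n) with S.card = a, parityProj q S

variable {q : End Q M}

theorem levelProj_tprod {S : Finset (Fin n)} {v : Fin n → M} (hv : Homog q S v) (a : ℕ) :
    levelProj n q a (tprod Q v) = if S.card = a then tprod Q v else 0 := by
  simp only [levelProj, LinearMap.sum_apply, parityProj_tprod hv, Finset.sum_ite_eq',
    Finset.mem_filter, Finset.mem_univ, true_and]

theorem levelProj_mul (hq : q * q = q) (a b : ℕ) :
    levelProj n q a * levelProj n q b = if a = b then levelProj n q a else 0 := by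
  refine hom_ext hq fun S v hv => ?_
  rw [End.mul_apply, levelProj_tprod hv]
  by_cases h : S.card = b
  · rw [if_pos h, levelProj_tprod hv, h]
    by_cases hab : a = b
    · subst hab; rw [if_pos rfl, if_pos rfl, levelProj_tprod hv, if_pos h]
    · rw [if_neg hab, if_neg (Ne.symm hab)]; rfl
  · rw [if_neg h, map_zero]
    by_cases hab : a = b
    · subst hab; rw [if_pos rfl, levelProj_tprod hv, if_neg h]
    · rw [if_neg hab]; rfl

theorem sum_levelProj (hq : q * q = q) : ∑ a ∈ Finset.range (n + 1), levelProj n q a = 1 := by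
  refine hom_ext hq fun S v hv => ?_
  rw [LinearMap.sum_apply]
  simp only [levelProj_tprod hv]
  rw [Finset.sum_ite_eq, if_pos]
  · rfl
  · rw [Finset.mem_range, Nat.lt_succ_iff]
    exact (Finset.card_le_univ S).trans_eq (Fintype.card_fin n)

theorem parityProj_comm (hqe : e * q = q * e) (S T : Finset (Fin n)) :
    parityProj e S * parityProj q T = parityProj q T * parityProj e S := by
  rw [parityProj, parityProj, ← PiTensorProduct.map_mul, ← PiTensorProduct.map_mul]
  congr 1
  ext1 i
  split_ifs <;> simp only [mul_sub, sub_mul, one_mul, mul_one, hqe] <;> abel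

theorem oddProj_levelProj (hqe : e * q = q * e) (a : ℕ) :
    oddProj n e * levelProj n q a = levelProj n q a * oddProj n e := by
  rw [oddProj, levelProj, Finset.sum_mul_sum, Finset.sum_mul_sum, Finset.sum_comm]
  simp only [parityProj_comm hqe]

theorem slot_parityProj (hqe : e * q = q * e) {d : End Q M} (hd : d * q = q * d) (i : Fin n)
    (S : Finset (Fin n)) : slot e d i * parityProj q S = parityProj q S * slot e d i := by
  rw [slot, parityProj, ← PiTensorProduct.map_mul, ← PiTensorProduct.map_mul]
  congr 1
  ext1 j
  split_ifs <;> simp only [mul_sub, sub_mul, one_mul, mul_one, smul_mul_assoc, mul_smul_comm, hqe,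
    hd, smul_sub] <;> abel

theorem diff_levelProj (hqe : e * q = q * e) {d : End Q M} (hd : d * q = q * d) (a : ℕ) :
    diff n e d * levelProj n q a = levelProj n q a * diff n e d := by
  rw [diff, levelProj, Finset.sum_mul_sum, Finset.sum_mul_sum, Finset.sum_comm]
  simp only [slot_parityProj hqe hd]

theorem diff_add (e h k : End Q M) : diff n e (h + k) = diff n e h + diff n e k := by
  simp only [diff, slot_add, Finset.sum_add_distrib]

/-- The conditions on `δ` say that it kills `ker q` and has values in `ker q`. Applied in slot `i`,
it removes exactly `i` from the set of slots lying in the range of `q` and leaves the other slots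
alone. If the cardinalities do not differ by one, some tensor factor of the composite is zero. -/
theorem parityProj_slot_parityProj (hq : q * q = q) (hqe : e * q = q * e) {δ : End Q M}
    (h1 : q * δ = 0) (h2 : δ * q = δ) (i : Fin n) {S T : Finset (Fin n)}
    (h : T.card + 1 ≠ S.card) : parityProj q T * slot e δ i * parityProj q S = 0 := by
  rw [slot, parityProj, parityProj, ← PiTensorProduct.map_mul, ← PiTensorProduct.map_mul]
  obtain ⟨j, hj⟩ : ∃ j, ((if j ∈ T then q else 1 - q) *
      (if j < i then 1 - 2 • e else if j = i then δ else 1) *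
      (if j ∈ S then q else 1 - q) : End Q M) = 0 := by
    by_contra! hne
    have hi : i ∉ T ∧ i ∈ S := by
      have := hne i
      by_contra hc
      refine this ?_
      rw [if_neg (lt_irrefl i), if_pos rfl]
      by_cases hT : i ∈ T
      · rw [if_pos hT, h1, zero_mul]
      · have hS : i ∉ S := fun hS => hc ⟨hT, hS⟩
        rw [if_neg hS, mul_assoc, mul_sub, mul_one, h2, sub_self, mul_zero]
    have hj : ∀ j ≠ i, j ∈ T ↔ j ∈ S := by
      intro j hji
      have := hne j
      by_contra hc
      refine this ?_
      have h3 : ∀ y : End Q M, y * q = q * y → q * y * (1 - q) = 0 ∧ (1 - q) * y * q = 0 := by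
        intro y hy
        constructor
        · rw [mul_sub, mul_one, mul_assoc, hy, ← mul_assoc, hq, sub_self]
        · rw [mul_assoc, hy, ← mul_assoc, sub_mul, one_mul, hq, sub_self, zero_mul]
      have h4 : (1 - 2 • e) * q = q * (1 - 2 • e) := by
        simp only [mul_sub, sub_mul, one_mul, mul_one, smul_mul_assoc, mul_smul_comm, hqe]
      rw [if_neg hji]
      by_cases hT : j ∈ T <;> by_cases hS : j ∈ S
      · tauto
      · rw [if_pos hT, if_neg hS]
        split_ifs
        · exact (h3 _ h4).1
        · exact (h3 1 (by simp)).1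
      · rw [if_neg hT, if_pos hS]
        split_ifs
        · exact (h3 _ h4).2
        · exact (h3 1 (by simp)).2
      · tauto
    refine h ?_
    have : S = insert i T := by
      ext j
      by_cases hji : j = i
      · subst hji; simp [hi.2]
      · simp [hji, hj j hji]
    rw [this, Finset.card_insert_of_notMem hi.1]
  refine PiTensorProduct.ext (MultilinearMap.ext fun v => ?_)
  rw [LinearMap.compMultilinearMap_apply, map_tprod]
  refine MultilinearMap.map_coord_zero _ j ?_
  exact LinearMap.congr_fun hj (v j)

theorem levelProj_diff_levelProj (hq : q * q = q) (hqe : e * q = q * e) {δ : End Q M}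
    (h1 : q * δ = 0) (h2 : δ * q = δ) {a b : ℕ} (h : a + 1 ≠ b) :
    levelProj n q a * diff n e δ * levelProj n q b = 0 := by
  simp only [levelProj, diff, Finset.sum_mul, Finset.mul_sum]
  refine Finset.sum_eq_zero fun S hS => Finset.sum_eq_zero fun i _ =>
    Finset.sum_eq_zero fun T hT => parityProj_slot_parityProj hq hqe h1 h2 _ ?_
  simp only [Finset.mem_filter, Finset.mem_univ, true_and] at hS hT
  omega

theorem permAct_parityProj (he : e * e = e) (hqe : e * q = q * e) (σ : Equiv.Perm (Fin n))
    (S : Finset (Fin n)) :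
    permAct e σ * parityProj q S = parityProj q (S.map σ.toEmbedding) * permAct e σ := by
  refine (permAct_comp_map he (fun i => if i ∈ S then q else 1 - q) (fun i => ?_) σ).trans ?_
  · split_ifs
    · exact hqe
    · change e * (1 - q) = (1 - q) * e
      rw [mul_sub, sub_mul, hqe, one_mul, mul_one]
  · rw [parityProj]
    simp only [Finset.mem_map_equiv]
    rfl

theorem permAct_levelProj (he : e * e = e) (hqe : e * q = q * e) (σ : Equiv.Perm (Fin n)) (a : ℕ) :
    permAct e σ * levelProj n q a = levelProj n q a * permAct e σ := by
  rw [levelProj, Finset.mul_sum, Finset.sum_mul]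
  refine Finset.sum_bij (fun S _ => S.map σ.toEmbedding) ?_ ?_ ?_ ?_
  · simp
  · intro S _ T _ h
    exact Finset.map_injective _ h
  · intro T hT
    refine ⟨T.map σ.symm.toEmbedding, by simpa using hT, ?_⟩
    ext i
    simp [Finset.mem_map_equiv]
  · intro S _
    exact permAct_parityProj he hqe σ S

end MFTensor

/-! ### Comparing cuts with different differentials or idempotents. -/

namespace MF

variable {Q : Type u} [CommRing Q] {f : Q} {Z : Set (PrimeSpectrum Q)}
  {A : Type*} [AddCommGroup A] {χ : MF Q f → A}

/-- The matrix factorization with the same graded module and another differential. -/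
abbrev withDiff (X : MF Q f) (d' : Module.End Q X.carrier) (h1 : X.e * d' + d' * X.e = d')
    (h2 : d' * d' = f • (1 : Module.End Q X.carrier)) : MF Q f where
  carrier := X.carrier
  e := X.e
  e_mul_e := X.e_mul_e
  d := d'
  d_odd := h1
  d_mul_d := h2

/-- A cut sees the differential only through its compression `π d π`. -/
theorem AdditiveOn.cutVal_withDiff (hχ : AdditiveOn Z χ) {X : MF Q f}
    {d' : Module.End Q X.carrier} (h1 : X.e * d' + d' * X.e = d')
    (h2 : d' * d' = f • (1 : Module.End Q X.carrier)) {π : Module.End Q X.carrier}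
    (hπ : CutIn Z (X.withDiff d' h1 h2) π) (hd : π * X.d * π = π * d' * π) :
    CutIn Z X π ∧ cutVal χ (X.withDiff d' h1 h2) π = cutVal χ X π := by
  have hi : π * π = π := hπ.1.idem
  have hsq : ∀ y : Module.End Q X.carrier, π * y * π * y * π = π * y * π * (π * y * π) := by
    intro y
    calc π * y * π * y * π = π * y * (π * π) * y * π := by rw [hi]
      _ = _ := by simp only [mul_assoc]
  have hc : X.IsCut π := ⟨hi, hπ.1.even, by
    rw [hsq, hd, ← hsq]
    exact hπ.1.diff⟩
  have hd' : π * X.d * π * π = π * π * d' * π := by rw [hi, mul_assoc _ π π, hi, hd]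
  exact ⟨hπ.iso hc π π hi hi hπ.1.even.symm.symm hd', hχ.cutVal_iso hπ hc π π hi hi hπ.1.even hd'⟩

/-- Idempotents of the form `v u` and `u v` have isomorphic ranges. As `u` and `v` are morphisms,
both idempotents commute with the differentials, and the isomorphism is one of matrix
factorizations. -/
theorem AdditiveOn.cutVal_swap (hχ : AdditiveOn Z χ) {X X' : MF Q f} (hX : X.support ⊆ Z)
    {u : X.carrier →ₗ[Q] X'.carrier} {v : X'.carrier →ₗ[Q] X.carrier}
    {π : Module.End Q X.carrier} {π' : Module.End Q X'.carrier} (hπ : π * π = π)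
    (hπ' : π' * π' = π') (hvu : v ∘ₗ u = π) (huv : u ∘ₗ v = π')
    (hue : X'.e ∘ₗ u = u ∘ₗ X.e) (hve : X.e ∘ₗ v = v ∘ₗ X'.e)
    (hud : X'.d ∘ₗ u = u ∘ₗ X.d) (hvd : X.d ∘ₗ v = v ∘ₗ X'.d) :
    cutVal χ X π = cutVal χ X' π' := by
  have h1 : X.e * π = π * X.e := by
    subst hvu
    change X.e ∘ₗ v ∘ₗ u = v ∘ₗ u ∘ₗ X.e
    rw [← hue, ← LinearMap.comp_assoc, hve]; rfl
  have h2 : X.d * π = π * X.d := by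
    subst hvu
    change X.d ∘ₗ v ∘ₗ u = v ∘ₗ u ∘ₗ X.d
    rw [← hud, ← LinearMap.comp_assoc, hvd]; rfl
  have h3 : X'.e * π' = π' * X'.e := by
    subst huv
    change X'.e ∘ₗ u ∘ₗ v = u ∘ₗ v ∘ₗ X'.e
    rw [← hve, ← LinearMap.comp_assoc, hue]; rfl
  have h4 : X'.d * π' = π' * X'.d := by
    subst huv
    change X'.d ∘ₗ u ∘ₗ v = u ∘ₗ v ∘ₗ X'.d
    rw [← hvd, ← LinearMap.comp_assoc, hud]; rfl
  refine hχ.cutVal_iso (.of_commute hX hπ h1 h2) (.of_commute hπ' h3 h4) u v hvu huv hue ?_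
  change π' ∘ₗ (X'.d ∘ₗ u) ∘ₗ π = _
  rw [hud]
  rfl

end MF

/-! ### Twisting the slots by roots of unity. -/

/-- The rotation adds one to the slot number; at the wrap-around from the last slot to slot 0 the
condition `y ^ p = 1` is used. -/
theorem pow_finRotate {Q : Type*} [CommRing Q] {p : ℕ} {y : Q} (hy : y ^ p = 1) (i : Fin p) :
    y ^ (finRotate p i : ℕ) = y * y ^ (i : ℕ) := by
  obtain _ | m := p
  · exact i.elim0
  · rw [← pow_succ']
    by_cases hi : i = Fin.last m
    · subst hi
      rw [finRotate_last, Fin.val_last, hy, Fin.val_zero, pow_zero]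
    · rw [coe_finRotate_of_ne_last hi]

namespace MFTensor

variable {Q : Type u} [CommRing Q] {M : Type u} [AddCommGroup M] [Module Q M] {n : ℕ}
  {e q : Module.End Q M}

open Module PiTensorProduct

theorem map_mul_parityProj (g : Fin n → End Q M) (hg : ∀ i, q * g i = g i * q)
    (S : Finset (Fin n)) :
    PiTensorProduct.map g * parityProj q S = parityProj q S * PiTensorProduct.map g := by
  rw [parityProj, ← PiTensorProduct.map_mul, ← PiTensorProduct.map_mul]
  congr 1
  ext1 i
  split_ifs <;> simp only [mul_sub, sub_mul, one_mul, mul_one, hg]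

theorem map_mul_levelProj (g : Fin n → End Q M) (hg : ∀ i, q * g i = g i * q) (a : ℕ) :
    PiTensorProduct.map g * levelProj n q a = levelProj n q a * PiTensorProduct.map g := by
  simp only [levelProj, Finset.mul_sum, Finset.sum_mul, map_mul_parityProj g hg]

theorem map_mul_oddProj (g : Fin n → End Q M) (hg : ∀ i, e * g i = g i * e) :
    PiTensorProduct.map g * oddProj n e = oddProj n e * PiTensorProduct.map g := by
  simp only [oddProj, Finset.mul_sum, Finset.sum_mul, map_mul_parityProj g hg]

theorem map_mul_diff (g : Fin n → End Q M) (hg : ∀ i, e * g i = g i * e) {d : End Q M}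
    (hd : ∀ i, d * g i = g i * d) :
    PiTensorProduct.map g * diff n e d = diff n e d * PiTensorProduct.map g := by
  simp only [diff, Finset.mul_sum, Finset.sum_mul]
  refine Finset.sum_congr rfl fun i _ => ?_
  rw [slot, ← PiTensorProduct.map_mul, ← PiTensorProduct.map_mul]
  congr 1
  ext1 j
  split_ifs <;> simp only [mul_sub, sub_mul, one_mul, mul_one, smul_mul_assoc, mul_smul_comm, hg, hd]

/-- The operator scaling the vectors whose factors in the range of `q` are exactly those in the
slots `S` by `∏ i ∈ S, c i`. -/
def scale (q : End Q M) (c : Fin n → Q) : End Q (⨂[Q] _ : Fin n, M) :=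
  PiTensorProduct.map fun i => 1 + (c i - 1) • q

theorem scale_factor_comm {y : End Q M} (hy : y * q = q * y) (c : Q) :
    y * (1 + (c - 1) • q) = (1 + (c - 1) • q) * y := by
  simp only [mul_add, add_mul, one_mul, mul_one, smul_mul_assoc, mul_smul_comm, hy]

theorem scale_mul (hq : q * q = q) (c c' : Fin n → Q) :
    scale q c * scale q c' = scale q fun i => c i * c' i := by
  rw [scale, scale, scale, ← PiTensorProduct.map_mul]
  congr 1
  ext1 i
  simp only [mul_add, add_mul, one_mul, mul_one, smul_mul_assoc, mul_smul_comm, hq, smul_smul]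
  module

theorem scale_one : scale q (fun _ : Fin n => 1) = 1 := by
  simp only [scale, sub_self, zero_smul, add_zero]
  exact PiTensorProduct.map_one

theorem scale_mul_levelProj (hq : q * q = q) (c : Q) (a : ℕ) :
    scale q (fun _ : Fin n => c) * levelProj n q a = c ^ a • levelProj n q a := by
  refine hom_ext hq fun S v hv => ?_
  rw [End.mul_apply, LinearMap.smul_apply, levelProj_tprod hv]
  split_ifs with h
  · rw [scale, map_tprod]
    have : (fun i => (1 + (c - 1) • q) (v i)) = fun i => (if i ∈ S then c else 1) • v i := by
      ext1 i
      rw [LinearMap.add_apply, LinearMap.smul_apply, hv i]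
      split_ifs
      · rw [End.one_apply, sub_smul, one_smul, add_sub_cancel]
      · simp
    rw [this, MultilinearMap.map_smul_univ, Finset.prod_ite_mem, Finset.univ_inter,
      Finset.prod_const, h]
  · simp

/-- Moving every factor one slot onwards changes its scaling factor `y ^ i` by one power of `y`
whenever it lies in the range of `q`. On level `a` this happens `a` times. -/
theorem permAct_scale (he : e * e = e) (hqe : e * q = q * e) {y : Q} (hq : q * q = q)
    (hy : y ^ n = 1) (a : ℕ) :
    y ^ a • (permAct e (finRotate n) * (scale q (fun i => y ^ (i : ℕ)) * levelProj n q a)) =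
      scale q (fun i => y ^ (i : ℕ)) * levelProj n q a * permAct e (finRotate n) := by
  have h1 : ∀ c : Fin n → Q, permAct e (finRotate n) * scale q c =
      scale q (fun i => c ((finRotate n).symm i)) * permAct e (finRotate n) := fun c =>
    permAct_comp_map he (fun i => 1 + (c i - 1) • q)
      (fun i => scale_factor_comm hqe (c i)) (finRotate n)
  have h2 : scale q (fun i : Fin n => y ^ (((finRotate n).symm i : Fin n) : ℕ)) *
      scale q (fun _ => y) = scale q (fun i => y ^ (i : ℕ)) := by
    rw [scale_mul hq]
    congr 1
    ext1 i
    conv_rhs => rw [← (finRotate n).apply_symm_apply i, pow_finRotate hy]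
    rw [mul_comm]
  calc y ^ a • (permAct e (finRotate n) * (scale q (fun i => y ^ (i : ℕ)) * levelProj n q a))
      = permAct e (finRotate n) * (scale q (fun i => y ^ (i : ℕ)) *
          (scale q (fun _ => y) * levelProj n q a)) := by
        rw [scale_mul_levelProj hq, mul_smul_comm, mul_smul_comm]
    _ = scale q (fun i : Fin n => y ^ (((finRotate n).symm i : Fin n) : ℕ)) *
          (permAct e (finRotate n) * scale q (fun _ => y)) * levelProj n q a := by
        rw [← mul_assoc, h1]; simp only [mul_assoc]
    _ = _ := by
        rw [h1, ← mul_assoc, h2, mul_assoc, permAct_levelProj he hqe, mul_assoc]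

theorem levelProj_zero : levelProj n q 0 = PiTensorProduct.map fun _ => 1 - q := by
  rw [levelProj]
  simp only [Finset.card_eq_zero]
  rw [Finset.filter_eq' Finset.univ ∅, if_pos (Finset.mem_univ _), Finset.sum_singleton, parityProj]
  simp

theorem levelProj_self : levelProj n q n = PiTensorProduct.map fun _ => q := by
  have : (Finset.univ.filter fun S : Finset (Fin n) => S.card = n) = {Finset.univ} := by
    ext S
    simp [← Finset.card_eq_iff_eq_univ]
  rw [levelProj, this, Finset.sum_singleton, parityProj]
  simp

end MFTensor

namespace MF

variable {Q : Type u} [CommRing Q] {f : Q} {Z : Set (PrimeSpectrum Q)}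
  {A : Type*} [AddCommGroup A]

/-- The value of `χ` on the `z`-eigenspace of the cyclic permutation on the tensor power. -/
noncomputable def cyclicVal {p : ℕ} (χ : MF Q (p * f) → A) (b z : Q) (P : MF Q f) : A :=
  cutVal χ (P.tensorPower p).toMF (eigenProj b z p (MFTensor.permAct P.e (finRotate p)))

theorem permAct_finRotate_pow (P : MF Q f) (p : ℕ) :
    MFTensor.permAct P.e (finRotate p) ^ p = 1 := by
  have : ((P.tensorPower p).ρ (finRotate p)) ^ p = 1 := by
    rw [← map_pow, finRotate_pow, map_one]
  exact this

theorem AdditiveOn.cyclicVal_eq {p : ℕ} [NeZero p] {χ : MF Q (p * f) → A} (hχ : AdditiveOn Z χ)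
    {b z : Q} (hb : b * p = 1) (hz : z ^ p = 1) (hp : IsUnit (p : Q)) {P : MF Q f}
    (hP : P.support ⊆ Z) : cyclicVal χ b z P =
      χ ((P.tensorPower p).eigen (finRotate p) z p (finRotate_pow p) hz hp) := by
  refine (cutVal_eq ((P.tensorPower p).isCut_eigenProj hb hz (finRotate_pow p))).trans ?_
  exact (hχ.iso ((P.tensorPower p).eigenIso hb hz (finRotate_pow p) hp)
    ((GMF.eigen_support _ _ _ _ _ _ _).trans ((P.tensorPower_support p).trans hP))).symm

end MF

/-! ### Additivity of differences of eigenspaces of tensor powers. -/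

namespace MF

variable {Q : Type u} [CommRing Q] {f : Q} {Z : Set (PrimeSpectrum Q)}
  {A : Type*} [AddCommGroup A]

open MFTensor

/-- The block diagonal part `d - (1 - q) d q` of the differential, for an idempotent `q` whose kernel
is `d`-stable. -/
def diagDiff (P : MF Q f) (q : Module.End Q P.carrier) : Module.End Q P.carrier :=
  P.d - P.d * q + q * P.d

section diagDiff

variable {P : MF Q f} {q : Module.End Q P.carrier} 

theorem diagDiff_comm (hq : q * q = q) (hqd : q * P.d * q = q * P.d) :
    P.diagDiff q * q = q * P.diagDiff q := by
  simp only [diagDiff, sub_mul, add_mul, mul_sub, mul_add, hqd, mul_assoc, hq]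
  simp only [← mul_assoc, hq, hqd]
  abel

theorem diagDiff_odd (hqe : P.e * q = q * P.e) :
    P.e * P.diagDiff q + P.diagDiff q * P.e = P.diagDiff q := by
  have h1 : P.e * (P.d * q) + P.d * q * P.e = P.d * q := by
    rw [mul_assoc, ← hqe, ← mul_assoc, ← mul_assoc, ← add_mul, P.d_odd]
  have h2 : P.e * (q * P.d) + q * P.d * P.e = q * P.d := by
    rw [← mul_assoc, hqe, mul_assoc, mul_assoc, ← mul_add, P.d_odd]
  calc P.e * P.diagDiff q + P.diagDiff q * P.e = (P.e * P.d + P.d * P.e) -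
        (P.e * (P.d * q) + P.d * q * P.e) + (P.e * (q * P.d) + q * P.d * P.e) := by
          rw [diagDiff]; noncomm_ring
    _ = P.diagDiff q := by rw [P.d_odd, h1, h2, diagDiff]

theorem diagDiff_mul_self (hq : q * q = q) (hqd : q * P.d * q = q * P.d) :
    P.diagDiff q * P.diagDiff q = f • (1 : Module.End Q P.carrier) := by
  have hdd : ∀ y, P.d * (P.d * y) = f • y := fun y => by
    rw [← mul_assoc, P.d_mul_d, smul_mul_assoc, one_mul]
  have h1 : q * (P.d * q) = q * P.d := by rw [← mul_assoc, hqd]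
  have h2 : q * (P.d * (q * P.d)) = f • q := by
    rw [← mul_assoc P.d, ← mul_assoc, h1, mul_assoc, P.d_mul_d, mul_smul_comm, mul_one]
  have h3 : ∀ y, q * (q * y) = q * y := fun y => by rw [← mul_assoc, hq]
  simp only [diagDiff, sub_mul, add_mul, mul_sub, mul_add, mul_assoc, hdd, h1, h2, h3, P.d_mul_d,
    mul_smul_comm, mul_one, hq]
  abel

end diagDiff

/-- The matrix factorization with the block diagonal part of the differential. -/
abbrev diag (P : MF Q f) {q : Module.End Q P.carrier} (hq : q * q = q) (hqe : P.e * q = q * P.e)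
    (hqd : q * P.d * q = q * P.d) : MF Q f :=
  P.withDiff (P.diagDiff q) (diagDiff_odd hqe) (diagDiff_mul_self hq hqd)

variable {p : ℕ} {χ : MF Q (p * f) → A} {b y z : Q}

theorem eigenProj_mul_levelProj_mul_self {P : MF Q f} {q : Module.End Q P.carrier} (hb : b * p = 1)
    (hy : y ^ p = 1) (hq : q * q = q) (hqe : P.e * q = q * P.e) (a : ℕ) :
    eigenProj b y p (permAct P.e (finRotate p)) * levelProj p q a *
      (eigenProj b y p (permAct P.e (finRotate p)) * levelProj p q a) =
    eigenProj b y p (permAct P.e (finRotate p)) * levelProj p q a := by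
  have hεE : eigenProj b y p (permAct P.e (finRotate p)) * levelProj p q a =
    levelProj p q a * eigenProj b y p (permAct P.e (finRotate p)) :=
    eigenProj_comm (permAct_levelProj P.e_mul_e hqe _ a)
  rw [mul_assoc, ← mul_assoc (levelProj p q a), ← hεE, mul_assoc (eigenProj _ _ _ _),
    levelProj_mul hq, if_pos rfl, ← mul_assoc,
    eigenProj_mul_self hb hy (P.permAct_finRotate_pow p)]

theorem eigenProj_permAct_oddProj (P : MF Q f) :
    oddProj p P.e * eigenProj b y p (permAct P.e (finRotate p)) =
      eigenProj b y p (permAct P.e (finRotate p)) * oddProj p P.e :=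
  (eigenProj_comm (permAct_oddProj P.e_mul_e (finRotate p))).symm

theorem eigenProj_permAct_diff (P : MF Q f) :
    diff p P.e P.d * eigenProj b y p (permAct P.e (finRotate p)) =
      eigenProj b y p (permAct P.e (finRotate p)) * diff p P.e P.d :=
  (eigenProj_comm (permAct_diff P.e_mul_e P.d_odd (finRotate p))).symm

theorem eigenProj_levelProj_oddProj {P : MF Q f} {q : Module.End Q P.carrier}
    (hqe : P.e * q = q * P.e) (a : ℕ) :
    oddProj p P.e * (eigenProj b y p (permAct P.e (finRotate p)) * levelProj p q a) =
      eigenProj b y p (permAct P.e (finRotate p)) * levelProj p q a * oddProj p P.e := by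
  rw [← mul_assoc, eigenProj_permAct_oddProj, mul_assoc, oddProj_levelProj hqe, mul_assoc]

theorem eigenProj_levelProj_diff {P : MF Q f} {q : Module.End Q P.carrier}
    (hqe : P.e * q = q * P.e) (hqd : P.d * q = q * P.d) (a : ℕ) :
    diff p P.e P.d * (eigenProj b y p (permAct P.e (finRotate p)) * levelProj p q a) =
      eigenProj b y p (permAct P.e (finRotate p)) * levelProj p q a * diff p P.e P.d := by
  rw [← mul_assoc, eigenProj_permAct_diff, mul_assoc, diff_levelProj hqe hqd, mul_assoc]

/-- The kernel of `q` is a subobject of `P`, so the tensor power is filtered by the number of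
factors in the range of `q`. The off-diagonal part of `d` lowers this number by one. The graded
pieces therefore do not see it and may be computed with the block diagonal differential. -/
theorem AdditiveOn.cyclicVal_eq_sum [NeZero p] (hχ : AdditiveOn Z χ) (hb : b * p = 1)
    (hy : y ^ p = 1) {P : MF Q f} {q : Module.End Q P.carrier} (hq : q * q = q)
    (hqe : P.e * q = q * P.e) (hqd : q * P.d * q = q * P.d)
    (hP : (P.diag hq hqe hqd).support ⊆ Z) :
    cyclicVal χ b y P = ∑ a ∈ Finset.range (p + 1), cutVal χ ((P.diag hq hqe hqd).tensorPower p).toMF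
      (eigenProj b y p (permAct P.e (finRotate p)) * levelProj p q a) := by
  have hd₀q : P.diagDiff q * q = q * P.diagDiff q := diagDiff_comm hq hqd
  have hX₀ : ((P.diag hq hqe hqd).tensorPower p).support ⊆ Z :=
    ((P.diag hq hqe hqd).tensorPower_support p).trans hP
  -- This is `(1 - q) d q`, because `q d q = q d`.
  let δ : Module.End Q P.carrier := P.d * q - q * P.d
  have hδ1 : q * δ = 0 := by rw [mul_sub, ← mul_assoc, hqd, ← mul_assoc, hq, sub_self]
  have hδ2 : δ * q = δ := by rw [sub_mul, hqd, mul_assoc, hq]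
  have hdiff : diff p P.e P.d - diff p P.e δ = diff p P.e (P.diagDiff q) := by
    rw [sub_eq_iff_eq_add, ← diff_add]
    congr 1
    simp only [diagDiff, δ]
    abel
  have hTE : ∀ a, permAct P.e (finRotate p) * levelProj p q a =
    levelProj p q a * permAct P.e (finRotate p) := permAct_levelProj P.e_mul_e hqe _
  let ε : Module.End Q (⨂[Q] _ : Fin p, P.carrier) := eigenProj b y p (permAct P.e (finRotate p))
  have hεE : ∀ a, ε * levelProj p q a = levelProj p q a * ε := fun a => eigenProj_comm (hTE a)
  have hδE : ∀ a c, a + 1 ≠ c → levelProj p q a * diff p P.e δ * levelProj p q c = 0 :=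
    fun a c hac => levelProj_diff_levelProj hq hqe hδ1 hδ2 hac
  have hzero : ∀ a, ε * levelProj p q a * diff p P.e δ * (ε * levelProj p q a) = 0 := by
    intro a
    calc ε * levelProj p q a * diff p P.e δ * (ε * levelProj p q a)
        = ε * levelProj p q a * diff p P.e δ * (levelProj p q a * ε) := by rw [hεE]
      _ = ε * (levelProj p q a * diff p P.e δ * levelProj p q a) * ε := by simp only [mul_assoc]
      _ = 0 := by rw [hδE a a (by omega), mul_zero, zero_mul]
  have hd : ∀ a, ε * levelProj p q a * diff p P.e P.d * (ε * levelProj p q a) =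
      ε * levelProj p q a * diff p P.e (P.diagDiff q) * (ε * levelProj p q a) := fun a => by
    rw [← hdiff, mul_sub, sub_mul, hzero, sub_zero]
  have hcut : ∀ a, CutIn Z (P.tensorPower p).toMF (ε * levelProj p q a) ∧
      cutVal χ ((P.diag hq hqe hqd).tensorPower p).toMF (ε * levelProj p q a) =
        cutVal χ (P.tensorPower p).toMF (ε * levelProj p q a) := fun a =>
    hχ.cutVal_withDiff (X := (P.tensorPower p).toMF)
      ((P.diag hq hqe hqd).tensorPower p).d_odd ((P.diag hq hqe hqd).tensorPower p).d_mul_d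
      (CutIn.of_commute (X := ((P.diag hq hqe hqd).tensorPower p).toMF) hX₀
        (eigenProj_mul_levelProj_mul_self hb hy hq hqe a) (eigenProj_levelProj_oddProj hqe a)
        (eigenProj_levelProj_diff (P := P.diag hq hqe hqd) hqe hd₀q a)) (hd a)
  rw [Finset.sum_congr rfl fun a _ => (hcut a).2]
  exact hχ.cutVal_filtration (X := (P.tensorPower p).toMF) (fun a => levelProj p q a)
    (δ := diff p P.e δ) (eigenProj_mul_self hb hy (P.permAct_finRotate_pow p))
    P.eigenProj_permAct_oddProj P.eigenProj_permAct_diff (levelProj_mul hq) (sum_levelProj hq)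
    (oddProj_levelProj hqe) hεE (fun a => (congrArg (· * levelProj p q a) hdiff).trans
      ((diff_levelProj hqe hd₀q a).trans (congrArg (levelProj p q a * ·) hdiff.symm))) hδE
    (fun a _ => (hcut a).1)

/-- The tensor power of a retract is the range of the tensor power of the idempotent `v u`,
compatibly with permutations. This identifies the two extreme levels of the filtration. -/
theorem AdditiveOn.cutVal_retract [NeZero p] (hχ : AdditiveOn Z χ) (hb : b * p = 1) (hy : y ^ p = 1)
    {P P' : MF Q f} (hP' : P'.support ⊆ Z) (u : Hom P P') (v : Hom P' P)
    (huv : u.toLin ∘ₗ v.toLin = LinearMap.id) :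
    cutVal χ (P.tensorPower p).toMF (eigenProj b y p (permAct P.e (finRotate p)) *
      PiTensorProduct.map fun _ => v.toLin ∘ₗ u.toLin) = cyclicVal χ b y P' := by
  let U : (⨂[Q] _ : Fin p, P.carrier) →ₗ[Q] (⨂[Q] _ : Fin p, P'.carrier) :=
    PiTensorProduct.map fun _ => u.toLin
  let V : (⨂[Q] _ : Fin p, P'.carrier) →ₗ[Q] (⨂[Q] _ : Fin p, P.carrier) :=
    PiTensorProduct.map fun _ => v.toLin
  let ε : Module.End Q (⨂[Q] _ : Fin p, P.carrier) := eigenProj b y p (permAct P.e (finRotate p))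
  let ε' : Module.End Q (⨂[Q] _ : Fin p, P'.carrier) := eigenProj b y p (permAct P'.e (finRotate p))
  have hUV : U ∘ₗ V = LinearMap.id := by
    rw [← PiTensorProduct.map_comp]
    simp only [huv]
    exact PiTensorProduct.map_id
  have hVU : V ∘ₗ U = PiTensorProduct.map fun _ => v.toLin ∘ₗ u.toLin :=
    (PiTensorProduct.map_comp _ _).symm
  have hU : ε' ∘ₗ U = U ∘ₗ ε :=
    eigenProj_comm (permAct_comp_map P.e_mul_e (fun _ => u.toLin) (fun _ => u.comm_e) _)
  have hV : ε ∘ₗ V = V ∘ₗ ε' :=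
    eigenProj_comm (permAct_comp_map P'.e_mul_e (fun _ => v.toLin) (fun _ => v.comm_e) _)
  have hε' : ε' ∘ₗ ε' = ε' := eigenProj_mul_self hb hy (P'.permAct_finRotate_pow p)
  have hε : ε ∘ₗ ε = ε := eigenProj_mul_self hb hy (P.permAct_finRotate_pow p)
  rw [← hVU]
  have hUe : oddProj p P'.e ∘ₗ U = U ∘ₗ oddProj p P.e := map_comp_oddProj u.toLin u.comm_e
  have hVe : oddProj p P.e ∘ₗ V = V ∘ₗ oddProj p P'.e := map_comp_oddProj v.toLin v.comm_e
  have hUd : diff p P'.e P'.d ∘ₗ U = U ∘ₗ diff p P.e P.d := map_comp_diff u.toLin u.comm_e u.comm_d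
  have hVd : diff p P.e P.d ∘ₗ V = V ∘ₗ diff p P'.e P'.d := map_comp_diff v.toLin v.comm_e v.comm_d
  have h1 : oddProj p P'.e ∘ₗ ε' = ε' ∘ₗ oddProj p P'.e := P'.eigenProj_permAct_oddProj
  have h2 : diff p P'.e P'.d ∘ₗ ε' = ε' ∘ₗ diff p P'.e P'.d := P'.eigenProj_permAct_diff
  have hVUi : (V ∘ₗ U) ∘ₗ (V ∘ₗ U) = V ∘ₗ U := by
    rw [LinearMap.comp_assoc, ← LinearMap.comp_assoc U, hUV]; rfl
  have h3 : (ε ∘ₗ V ∘ₗ U) ∘ₗ (ε ∘ₗ V ∘ₗ U) = ε ∘ₗ V ∘ₗ U := by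
    have : (V ∘ₗ U) ∘ₗ ε = ε ∘ₗ (V ∘ₗ U) := by
      rw [LinearMap.comp_assoc, ← hU, ← LinearMap.comp_assoc, ← hV]; rfl
    calc (ε ∘ₗ V ∘ₗ U) ∘ₗ (ε ∘ₗ V ∘ₗ U) = ε ∘ₗ ((V ∘ₗ U) ∘ₗ ε) ∘ₗ (V ∘ₗ U) := rfl
      _ = (ε ∘ₗ ε) ∘ₗ ((V ∘ₗ U) ∘ₗ (V ∘ₗ U)) := by rw [this]; rfl
      _ = _ := by rw [hε, hVUi]
  refine (hχ.cutVal_swap (X := (P'.tensorPower p).toMF) (X' := (P.tensorPower p).toMF)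
    (u := V ∘ₗ ε') (v := ε' ∘ₗ U) (π := ε') (π' := ε ∘ₗ V ∘ₗ U)
    ((P'.tensorPower_support p).trans hP') hε' h3 ?_ ?_ ?_ ?_ ?_ ?_).symm
  · calc (ε' ∘ₗ U) ∘ₗ V ∘ₗ ε' = ε' ∘ₗ (U ∘ₗ V) ∘ₗ ε' := rfl
      _ = ε' := by rw [hUV, LinearMap.id_comp, hε']
  · calc (V ∘ₗ ε') ∘ₗ ε' ∘ₗ U = (V ∘ₗ ε' ∘ₗ ε') ∘ₗ U := rfl
      _ = ε ∘ₗ V ∘ₗ U := by rw [hε', ← hV]; rfl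
  · calc oddProj p P.e ∘ₗ V ∘ₗ ε' = (oddProj p P.e ∘ₗ V) ∘ₗ ε' := rfl
      _ = V ∘ₗ oddProj p P'.e ∘ₗ ε' := by rw [hVe]; rfl
      _ = (V ∘ₗ ε') ∘ₗ oddProj p P'.e := by rw [h1]; rfl
  · calc oddProj p P'.e ∘ₗ ε' ∘ₗ U = (oddProj p P'.e ∘ₗ ε') ∘ₗ U := rfl
      _ = ε' ∘ₗ oddProj p P'.e ∘ₗ U := by rw [h1]; rfl
      _ = (ε' ∘ₗ U) ∘ₗ oddProj p P.e := by rw [hUe]; rfl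
  · calc diff p P.e P.d ∘ₗ V ∘ₗ ε' = (diff p P.e P.d ∘ₗ V) ∘ₗ ε' := rfl
      _ = V ∘ₗ diff p P'.e P'.d ∘ₗ ε' := by rw [hVd]; rfl
      _ = (V ∘ₗ ε') ∘ₗ diff p P'.e P'.d := by rw [h2]; rfl
  · calc diff p P'.e P'.d ∘ₗ ε' ∘ₗ U = (diff p P'.e P'.d ∘ₗ ε') ∘ₗ U := rfl
      _ = ε' ∘ₗ diff p P'.e P'.d ∘ₗ U := by rw [h2]; rfl
      _ = (ε' ∘ₗ U) ∘ₗ diff p P.e P.d := by rw [hUd]; rfl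

/-- On level `a` the twist by powers of `y` is an automorphism of the matrix factorization, since
`q` commutes with `e` and `d`, and it multiplies eigenvalues of the rotation by `y^(-a)`. As `0 < a
< p` is invertible modulo the prime `p`, some power `y` of `z` satisfies `y^(-a) = z`, so the twist
takes the 1-eigenspace to the `z`-eigenspace. -/
theorem AdditiveOn.cutVal_mixed (hp : p.Prime) (hχ : AdditiveOn Z χ) (hb : b * p = 1)
    (hz : z ^ p = 1) {P : MF Q f} (hP : P.support ⊆ Z) {q : Module.End Q P.carrier} (hq : q * q = q)
    (hqe : P.e * q = q * P.e) (hqd : P.d * q = q * P.d) {a : ℕ} (ha : a ≠ 0) (hap : a < p) :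
    cutVal χ (P.tensorPower p).toMF
      (eigenProj b 1 p (permAct P.e (finRotate p)) * levelProj p q a) =
    cutVal χ (P.tensorPower p).toMF
      (eigenProj b z p (permAct P.e (finRotate p)) * levelProj p q a) := by
  have : NeZero p := ⟨hp.ne_zero⟩
  -- The twist uses `y = w ^ r` with `w = z⁻¹`, so that `y ^ a = z⁻¹`.
  obtain ⟨r, hr⟩ : ∃ r, a * r ≡ 1 [MOD p] := by
    have hc : Nat.Coprime a p := ((Nat.Prime.coprime_iff_not_dvd hp).2
      (Nat.not_dvd_of_pos_of_lt (Nat.pos_of_ne_zero ha) hap)).symm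
    obtain ⟨r, hr⟩ := Nat.exists_mul_mod_eq_one_of_coprime hc hp.one_lt
    exact ⟨r, by rw [Nat.ModEq, hr.2, Nat.mod_eq_of_lt hp.one_lt]⟩
  have hpow : ∀ k l : ℕ, k ≡ l [MOD p] → z ^ k = z ^ l := fun k l hkl => by
    rw [pow_eq_pow_mod k hz, hkl, ← pow_eq_pow_mod l hz]
  set w := z ^ (p - 1) with hw
  have hzw : z * w = 1 := by rw [hw, mul_pow_sub_one hp.ne_zero, hz]
  have hwp : w ^ p = 1 := by rw [hw, ← pow_mul, mul_comm, pow_mul, hz, one_pow]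
  have hya : (w ^ r) ^ a * z = 1 := by
    have : z ^ (a * r) = z := by rw [hpow _ _ hr, pow_one]
    calc (w ^ r) ^ a * z = (w ^ r) ^ a * z ^ (a * r) := by rw [this]
      _ = (z * w) ^ (a * r) := by ring
      _ = 1 := by rw [hzw, one_pow]
  have hy : (w ^ r) ^ p = 1 := by rw [← pow_mul, mul_comm, pow_mul, hwp, one_pow]
  have hy' : (z ^ r) ^ p = 1 := by rw [← pow_mul, mul_comm, pow_mul, hz, one_pow]
  let T : Module.End Q (⨂[Q] _ : Fin p, P.carrier) := permAct P.e (finRotate p)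
  let E : Module.End Q (⨂[Q] _ : Fin p, P.carrier) := levelProj p q a
  let θ : Module.End Q (⨂[Q] _ : Fin p, P.carrier) := scale q fun i => (w ^ r) ^ (i : ℕ)
  let θ' : Module.End Q (⨂[Q] _ : Fin p, P.carrier) := scale q fun i => (z ^ r) ^ (i : ℕ)
  have hθθ' : θ * θ' = 1 := by
    rw [scale_mul hq, ← scale_one (q := q)]
    congr 1
    ext1 i
    rw [← mul_pow, ← mul_pow, mul_comm w, hzw, one_pow, one_pow]
  have hθ'θ : θ' * θ = 1 := by
    rw [scale_mul hq, ← scale_one (q := q)]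
    congr 1
    ext1 i
    rw [← mul_pow, ← mul_pow, hzw, one_pow, one_pow]
  have hEE : E * E = E := by rw [levelProj_mul hq, if_pos rfl]
  have hθE : ∀ c : Fin p → Q, scale q c * E = E * scale q c := fun c =>
    map_mul_levelProj _ (fun i => scale_factor_comm rfl _) a
  have hθE1 : θ * E = E * θ := hθE _
  have hθE2 : θ' * E = E * θ' := hθE _
  have hθe : ∀ c : Fin p → Q, oddProj p P.e * scale q c = scale q c * oddProj p P.e := fun c =>
    (map_mul_oddProj _ (fun i => scale_factor_comm hqe _)).symm
  have hθd : ∀ c : Fin p → Q, diff p P.e P.d * scale q c = scale q c * diff p P.e P.d := fun c =>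
    (map_mul_diff _ (fun i => scale_factor_comm hqe _) (fun i => scale_factor_comm hqd _)).symm
  let ε : Q → Module.End Q (⨂[Q] _ : Fin p, P.carrier) := fun y => eigenProj b y p T
  have hT : T * (θ * E) = z • (θ * E * T) := by
    rw [← permAct_scale P.e_mul_e hqe hq hy a, smul_smul, mul_comm z, hya, one_smul]
  have hεθ : ε z * (θ * E) = θ * E * ε 1 := by
    have := eigenProj_comp (b := b) (z := 1) hz hT
    rw [one_mul] at this
    exact this
  have hεE : ∀ y, ε y * E = E * ε y := fun y =>
    eigenProj_comm (permAct_levelProj P.e_mul_e hqe _ a)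
  have hεε : ∀ y, y ^ p = 1 → ε y * ε y = ε y := fun y hy =>
    eigenProj_mul_self hb hy (P.permAct_finRotate_pow p)
  have hevu : θ' * (ε z * E) * (θ * (ε 1 * E)) = ε 1 * E := by
    calc θ' * (ε z * E) * (θ * (ε 1 * E)) = θ' * (ε z * (E * θ) * E * ε 1) := by
          rw [hεE 1]; simp only [mul_assoc]
      _ = θ' * (ε z * (θ * E) * (E * ε 1)) := by rw [← hθE1]; simp only [mul_assoc]
      _ = θ' * θ * (E * (ε 1 * E) * ε 1) := by rw [hεθ]; simp only [mul_assoc]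
      _ = E * E * (ε 1 * ε 1) := by rw [hεE, hθ'θ, one_mul]; simp only [mul_assoc]
      _ = ε 1 * E := by rw [hEE, hεε 1 (one_pow _), hεE]
  have heuv : θ * (ε 1 * E) * (θ' * (ε z * E)) = ε z * E := by
    calc θ * (ε 1 * E) * (θ' * (ε z * E)) = θ * E * ε 1 * θ' * (ε z * E) := by
          rw [hεE]; simp only [mul_assoc]
      _ = ε z * θ * (E * θ') * (ε z * E) := by rw [← hεθ]; simp only [mul_assoc]
      _ = ε z * (θ * θ') * (E * (ε z * E)) := by rw [← hθE2]; simp only [mul_assoc]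
      _ = ε z * ε z * (E * E) := by rw [hθθ', mul_one, ← mul_assoc E, ← hεE]; simp only [mul_assoc]
      _ = ε z * E := by rw [hEE, hεε z hz]
  have hc : ∀ (D : Module.End Q (⨂[Q] _ : Fin p, P.carrier)) (y : Q) (c : Fin p → Q),
      D * scale q c = scale q c * D → D * (ε y * E) = ε y * E * D →
      D * (scale q c * (ε y * E)) = scale q c * (ε y * E) * D := fun D y c h1 h2 => by
    rw [← mul_assoc, h1, mul_assoc, h2, ← mul_assoc]
  refine hχ.cutVal_swap (X := (P.tensorPower p).toMF) (X' := (P.tensorPower p).toMF)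
    (u := θ * (ε 1 * E)) (v := θ' * (ε z * E)) ((P.tensorPower_support p).trans hP)
    (eigenProj_mul_levelProj_mul_self hb (one_pow _) hq hqe a)
    (eigenProj_mul_levelProj_mul_self hb hz hq hqe a) hevu heuv ?_ ?_ ?_ ?_
  · exact hc _ _ _ (hθe _) (eigenProj_levelProj_oddProj hqe a)
  · exact hc _ _ _ (hθe _) (eigenProj_levelProj_oddProj hqe a)
  · exact hc _ _ _ (hθd _) (eigenProj_levelProj_diff hqe hqd a)
  · exact hc _ _ _ (hθd _) (eigenProj_levelProj_diff hqe hqd a)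

/-- Differences of the values on the eigenspaces of the cyclic permutation are additive: on the
mixed part of the tensor power of an extension, all eigenspaces are isomorphic. -/
theorem AdditiveOn.cyclicVal_shortExact (hp : p.Prime) (hχ : AdditiveOn Z χ) (hb : b * p = 1)
    (hz : z ^ p = 1) {P' P P'' : MF Q f} (hP' : P'.support ⊆ Z) (hP'' : P''.support ⊆ Z)
    (h : ShortExact P' P P'') :
    cyclicVal χ b 1 P - cyclicVal χ b z P = (cyclicVal χ b 1 P' - cyclicVal χ b z P') +
      (cyclicVal χ b 1 P'' - cyclicVal χ b z P'') := by
  have : NeZero p := ⟨hp.ne_zero⟩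
  obtain ⟨σ⟩ := h.nonempty_splitting
  have eri : ∀ x, σ.r (σ.i.toLin x) = x := fun x => LinearMap.congr_fun σ.r_i x
  have ets : ∀ x, σ.t.toLin (σ.s x) = x := fun x => LinearMap.congr_fun σ.t_s x
  have eti : ∀ x, σ.t.toLin (σ.i.toLin x) = 0 := fun x => LinearMap.congr_fun σ.t_i x
  have eir : ∀ x, σ.i.toLin (σ.r x) = x - σ.s (σ.t.toLin x) := fun x => LinearMap.congr_fun σ.i_r x
  have ese : ∀ x, P.e (σ.s x) = σ.s (P''.e x) := fun x => LinearMap.congr_fun σ.s_e x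
  have ete : ∀ x, σ.t.toLin (P.e x) = P''.e (σ.t.toLin x) :=
    fun x => (LinearMap.congr_fun σ.t.comm_e x).symm
  have eid : ∀ x, P.d (σ.i.toLin x) = σ.i.toLin (P'.d x) := LinearMap.congr_fun σ.i.comm_d
  have etd : ∀ x, σ.t.toLin (P.d x) = P''.d (σ.t.toLin x) :=
    fun x => (LinearMap.congr_fun σ.t.comm_d x).symm
  have hi : Function.Injective σ.i.toLin := Function.LeftInverse.injective eri
  -- Its kernel is the image of `P'` and its range a copy of `P''`. The compatibility `hqd`
  -- expresses that the image of `P'` is `d`-stable.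
  let q : Module.End Q P.carrier := σ.s ∘ₗ σ.t.toLin
  have hqx : ∀ x, q x = σ.s (σ.t.toLin x) := fun _ => rfl
  have hq : q * q = q := LinearMap.ext fun x => congrArg σ.s (ets _)
  have hqe : P.e * q = q * P.e := LinearMap.ext fun x => by
    rw [Module.End.mul_apply, Module.End.mul_apply, hqx, hqx, ese, ete]
  have hqd : q * P.d * q = q * P.d := LinearMap.ext fun x => by
    rw [Module.End.mul_apply, Module.End.mul_apply, Module.End.mul_apply, hqx, hqx, etd, ets, hqx,
      etd]
  have hd₀q : P.diagDiff q * q = q * P.diagDiff q := diagDiff_comm hq hqd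
  have h₀i : ∀ x, P.diagDiff q (σ.i.toLin x) = σ.i.toLin (P'.d x) := fun x => by
    rw [diagDiff, LinearMap.add_apply, LinearMap.sub_apply, Module.End.mul_apply,
      Module.End.mul_apply, hqx, hqx, eti, eid, eti]
    simp
  have h₀t : ∀ x, σ.t.toLin (P.diagDiff q x) = P''.d (σ.t.toLin x) := fun x => by
    rw [diagDiff, LinearMap.add_apply, LinearMap.sub_apply, Module.End.mul_apply,
      Module.End.mul_apply, hqx, hqx, map_add, map_sub, ets, etd, etd, ets, sub_self, zero_add]
  have h₀s : ∀ x, P.diagDiff q (σ.s x) = σ.s (P''.d x) := fun x => by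
    have h1 : P.diagDiff q (q (σ.s x)) = q (P.diagDiff q (σ.s x)) := LinearMap.congr_fun hd₀q _
    rw [hqx, hqx, ets, h₀t, ets] at h1
    exact h1
  have h₀r : ∀ x, P'.d (σ.r x) = σ.r (P.diagDiff q x) := fun x => by
    refine hi ?_
    rw [← h₀i, eir, eir, map_sub, h₀s, h₀t]
  -- The direct sum of `P'` and `P''`, realized on the module of `P`; the splitting maps are
  -- morphisms for its differential.
  let P₀ : MF Q f := P.diag hq hqe hqd
  let i₀ : Hom P' P₀ := ⟨σ.i.toLin, σ.i.comm_e, LinearMap.ext h₀i⟩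
  let t₀ : Hom P₀ P'' := ⟨σ.t.toLin, σ.t.comm_e, LinearMap.ext fun x => (h₀t x).symm⟩
  let r₀ : Hom P₀ P' := ⟨σ.r, σ.r_e, LinearMap.ext h₀r⟩
  let s₀ : Hom P'' P₀ := ⟨σ.s, σ.s_e, LinearMap.ext h₀s⟩
  have hP₀ : P₀.support ⊆ Z := by
    have : ShortExact P' P₀ P'' := by
      refine ⟨i₀, t₀, hi, fun x => ⟨fun hx => ⟨σ.r x, ?_⟩, ?_⟩, Function.RightInverse.surjective ets⟩
      · change σ.i.toLin (σ.r x) = x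
        rw [eir, show σ.t.toLin x = 0 from hx, map_zero, sub_zero]
      · rintro ⟨y, rfl⟩
        exact eti y
    exact this.support_subset.trans (Set.union_subset hP' hP'')
  have h1q : 1 - q = i₀.toLin ∘ₗ r₀.toLin := σ.i_r.symm
  -- Level 0 gives the tensor power of `P'` and level `p` that of `P''`; the sum over the levels
  -- between is independent of `y` by `cutVal_mixed`.
  have key : ∀ y, y ^ p = 1 → cyclicVal χ b y P = (∑ a ∈ Finset.Ico 1 p,
      cutVal χ (P₀.tensorPower p).toMF (eigenProj b y p (permAct P.e (finRotate p)) *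
        levelProj p q a)) + (cyclicVal χ b y P' + cyclicVal χ b y P'') := by
    intro y hy
    rw [hχ.cyclicVal_eq_sum hb hy hq hqe hqd hP₀, Finset.range_eq_Ico,
      Finset.sum_eq_sum_Ico_succ_bot (Nat.succ_pos p), Finset.sum_Ico_succ_top hp.one_le,
      levelProj_zero, levelProj_self, h1q]
    have h1 := hχ.cutVal_retract hb hy hP' r₀ i₀ σ.r_i
    have h2 := hχ.cutVal_retract hb hy hP'' t₀ s₀ σ.t_s
    rw [← h1, ← h2, add_left_comm]
    rfl
  rw [key 1 (one_pow _), key z hz, Finset.sum_congr rfl fun a ha => hχ.cutVal_mixed hp hb hz hP₀ hq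
    hqe hd₀q (Nat.one_le_iff_ne_zero.1 (Finset.mem_Ico.1 ha).1) (Finset.mem_Ico.1 ha).2]
  abel

end MF

/-! ### Existence and uniqueness of the Adams operation. -/

/-- Since `p` is prime, the power is again a `p`-cycle, and cycles of equal length are conjugate. -/
theorem exists_conj_finRotate_pow {p k : ℕ} (hp : p.Prime) (hk : 0 < k) (hkp : k < p) :
    ∃ t : Equiv.Perm (Fin p), t * finRotate p ^ k * t⁻¹ = finRotate p := by
  obtain ⟨m, rfl⟩ := Nat.exists_eq_add_of_le' hp.two_le
  have hc : (finRotate (m + 2)).IsCycle := isCycle_finRotate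
  have ho : orderOf (finRotate (m + 2)) = m + 2 := by
    rw [← Equiv.Perm.lcm_cycleType, cycleType_finRotate, Multiset.lcm_singleton, normalize_eq]
  have hc' : (finRotate (m + 2) ^ k).IsCycle :=
    hc.isCycle_pow_pos_of_lt_prime_order (by rwa [ho]) k hk (by rwa [ho])
  have ho' : orderOf (finRotate (m + 2) ^ k) = m + 2 := by
    rw [orderOf_pow' _ hk.ne', ho, Nat.Coprime.gcd_eq_one, Nat.div_one]
    exact (Nat.Prime.coprime_iff_not_dvd hp).2 (Nat.not_dvd_of_pos_of_lt hk hkp)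
  refine isConj_iff.1 (hc'.isConj hc ?_)
  rw [← hc'.orderOf, ← hc.orderOf, ho, ho']

namespace MF

variable {Q : Type u} [CommRing Q] {f : Q} {Z : Set (PrimeSpectrum Q)}
  {A : Type*} [AddCommGroup A]

theorem AdditiveOn.cyclicVal_sub {p : ℕ} (hp : p.Prime) {χ : MF Q (p * f) → A}
    (hχ : AdditiveOn Z χ) {b z : Q} (hb : b * p = 1) (hz : z ^ p = 1) :
    AdditiveOn Z fun P : MF Q f => cyclicVal χ b 1 P - cyclicVal χ b z P where
  shortExact h' _ h'' hs := hχ.cyclicVal_shortExact hp hb hz h' h'' hs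
  contractible {P} h := by
    have : NeZero p := ⟨hp.ne_zero⟩
    have hpu : IsUnit (p : Q) := IsUnit.of_mul_eq_one_right _ hb
    have h0 : ∀ y, y ^ p = 1 → cyclicVal χ b y P = 0 := by
      intro y hy
      rw [hχ.cyclicVal_eq hb hy hpu (by simp [h])]
      exact hχ.contractible (Set.subset_empty_iff.1
        ((GMF.eigen_support _ _ _ _ _ _ _).trans ((P.tensorPower_support p).trans h.subset)))
    rw [h0 1 (one_pow _), h0 z hz, sub_zero]

end MF

namespace CyclicAdams

variable (p : ℕ) {Q : Type u} [CommRing Q] [Algebra (Ap p) Q] {f : Q} {Z : Set (PrimeSpectrum Q)}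

/-- The class in `K_0(mf^Z(Q, f))` of `mult_{1/p}` of a matrix factorization of `p f`. -/
noncomputable def multClass [Fact p.Prime] (f : Q) (Z : Set (PrimeSpectrum Q)) (X : MF Q (p * f)) :
    K0 f Z :=
  MF.cls Z (X.mult (pInv p Q) f (by rw [← mul_assoc, pInv_mul, one_mul]))

variable [hp : Fact p.Prime]

theorem additiveOn_multClass : MF.AdditiveOn Z (multClass p f Z) :=
  (MF.additiveOn_cls Z).mult (b := (p : Q)) (by rw [mul_comm, pInv_mul]) _

theorem mk_eigenPart (P : MFSupp f Z) (k : ℕ) : K0.mk (eigenPart p P k) =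
    MF.cyclicVal (multClass p f Z) (pInv p Q) (zetaQ p Q ^ k) P.1 := by
  have : NeZero p := ⟨hp.out.ne_zero⟩
  rw [(additiveOn_multClass p).cyclicVal_eq (pInv_mul p Q) (zetaQ_pow p Q k) (isUnit_p p Q) P.2,
    ← MF.cls_val]
  rfl

/-- The `ζ`-eigenspace of `σ` lies in the `ζ^k`-eigenspace of `σ^k`, and a permutation `t`
conjugating `σ^k` to `σ` carries it into the `ζ^k`-eigenspace of `σ`. For the inverse, apply `t⁻¹`
and then raise to a power `l` with `k l ≡ 1` modulo `p`. -/
theorem mk_eigenPart_eq (P : MFSupp f Z) {k : ℕ} (hk : 0 < k) (hkp : k < p) :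
    K0.mk (eigenPart p P k) = K0.mk (eigenPart p P 1) := by
  have : NeZero p := ⟨hp.out.ne_zero⟩
  set z := zetaQ p Q with hz
  have hzp : z ^ p = 1 := by simpa using zetaQ_pow p Q 1
  obtain ⟨t, ht⟩ := exists_conj_finRotate_pow hp.out hk hkp
  obtain ⟨l, hl⟩ : ∃ l, k * l % p = 1 := by
    have hc : Nat.Coprime k p := ((Nat.Prime.coprime_iff_not_dvd hp.out).2
      (Nat.not_dvd_of_pos_of_lt hk hkp)).symm
    obtain ⟨l, hl⟩ := Nat.exists_mul_mod_eq_one_of_coprime hc hp.out.one_lt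
    exact ⟨l, hl.2⟩
  let X := P.1.tensorPower p
  let s := finRotate p
  have hpow : ∀ (g : Equiv.Perm (Fin p)) (y : Q) (m : ℕ), ∀ x ∈ X.eigenspace g y,
      x ∈ X.eigenspace (g ^ m) (y ^ m) := by
    intro g y m x hx
    rw [GMF.mem_eigenspace] at hx ⊢
    induction m with
    | zero => simp
    | succ m ih =>
      rw [pow_succ, map_mul, Module.End.mul_apply, hx, map_smul, ih, smul_smul, pow_succ,
        mul_comm y]
  have hconj : ∀ (g g' t : Equiv.Perm (Fin p)) (y : Q), t * g * t⁻¹ = g' →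
      ∀ x ∈ X.eigenspace g y, X.ρ t x ∈ X.eigenspace g' y := by
    intro g g' t y h x hx
    rw [GMF.mem_eigenspace] at hx ⊢
    rw [← h, ← Module.End.mul_apply, ← map_mul, inv_mul_cancel_right, map_mul, Module.End.mul_apply,
      hx, map_smul]
  have h1 : ∀ x ∈ X.eigenspace s (z ^ 1), X.ρ t x ∈ X.eigenspace s (z ^ k) := by
    intro x hx
    rw [pow_one] at hx
    exact hconj _ _ t _ ht x (hpow s z k x hx)
  have h2 : ∀ x ∈ X.eigenspace s (z ^ k), X.ρ t⁻¹ x ∈ X.eigenspace s (z ^ 1) := by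
    intro x hx
    have h3 := hconj s (s ^ k) t⁻¹ (z ^ k) (by
      conv_lhs => rw [show s = t * s ^ k * t⁻¹ from ht.symm]
      group) x hx
    have h4 := hpow _ _ l _ h3
    rwa [← pow_mul, ← pow_mul, pow_eq_pow_mod _ (finRotate_pow p), pow_eq_pow_mod (k * l) hzp, hl,
      pow_one] at h4
  rw [mk_eigenPart, mk_eigenPart,
    (additiveOn_multClass p).cyclicVal_eq (pInv_mul p Q) (zetaQ_pow p Q k) (isUnit_p p Q) P.2,
    (additiveOn_multClass p).cyclicVal_eq (pInv_mul p Q) (zetaQ_pow p Q 1) (isUnit_p p Q) P.2]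
  exact ((additiveOn_multClass p).iso (X.eigenIsoOfConj (zetaQ_pow p Q 1) (finRotate_pow p)
    (zetaQ_pow p Q k) (finRotate_pow p) (isUnit_p p Q) t h1 h2)
    ((GMF.eigen_support _ _ _ _ _ _ _).trans ((P.1.tensorPower_support p).trans P.2))).symm

theorem isPrimitiveRoot_zetaC : IsPrimitiveRoot (zetaC p) p :=
  Complex.isPrimitiveRoot_exp p hp.out.ne_zero

theorem isPrimitiveRoot_zeta : IsPrimitiveRoot (zeta p) p :=
  IsPrimitiveRoot.of_map_of_injective (f := (Algebra.adjoin ℤ {zetaC p}).val) 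
    (isPrimitiveRoot_zetaC p) Subtype.val_injective

/-- The ring `ℤ[ζ]` has a power basis over `ℤ`, whose first element is 1. The corresponding
coordinate function gives a left inverse, whatever torsion `G` has. -/
theorem tmul_one_injective {G : Type*} [AddCommGroup G] :
    Function.Injective fun x : G => (x ⊗ₜ[ℤ] (1 : ZZeta p) : G ⊗[ℤ] ZZeta p) := by
  have hint : IsIntegral ℤ (zetaC p) := (isPrimitiveRoot_zetaC p).isIntegral hp.out.pos
  let B : PowerBasis ℤ (ZZeta p) := Algebra.adjoin.powerBasis' hint
  let ρ : ZZeta p →ₗ[ℤ] ℤ := B.basis.coord ⟨0, B.dim_pos⟩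
  have hρ : ρ 1 = 1 := by
    have h := B.basis_eq_pow ⟨0, B.dim_pos⟩
    rw [pow_zero] at h
    change B.basis.coord ⟨0, B.dim_pos⟩ 1 = 1
    rw [← h, Module.Basis.coord_apply, Module.Basis.repr_self, Finsupp.single_eq_same]
  have hl : Function.LeftInverse (fun y => TensorProduct.rid ℤ G (LinearMap.lTensor G ρ y))
      fun x : G => (x ⊗ₜ[ℤ] (1 : ZZeta p) : G ⊗[ℤ] ZZeta p) := by
    intro x
    simp only [LinearMap.lTensor_tmul, hρ, TensorProduct.rid_tmul, one_smul]
  exact hl.injective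

/-- All terms with `k ≠ 0` have the same class, and the nontrivial roots of unity sum to `-1`. -/
theorem sum_eigenPart (P : MFSupp f Z) :
    ∑ k ∈ Finset.range p, K0.mk (eigenPart p P k) ⊗ₜ[ℤ] (zeta p ^ k) =
      ((K0.mk (eigenPart p P 0) - K0.mk (eigenPart p P 1)) ⊗ₜ[ℤ] (1 : ZZeta p) :
        K0 f Z ⊗[ℤ] ZZeta p) := by
  have h0 := (isPrimitiveRoot_zeta p).geom_sum_eq_zero hp.out.one_lt
  rw [Finset.range_eq_Ico, Finset.sum_eq_sum_Ico_succ_bot hp.out.pos, zero_add, pow_zero] at h0 ⊢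
  rw [Finset.sum_congr rfl fun k hk => by
    rw [mk_eigenPart_eq p P (Finset.mem_Ico.1 hk).1 (Finset.mem_Ico.1 hk).2],
    ← TensorProduct.tmul_sum, eq_neg_of_add_eq_zero_right h0, TensorProduct.tmul_neg,
    TensorProduct.sub_tmul, sub_eq_add_neg]

/-- The difference of the classes of the 1- and `ζ`-eigenspaces respects the relations by
`cyclicVal_sub`. Uniqueness is `K0.mk_surjective` together with `tmul_one_injective`. -/
theorem existsUnique_isAdams : ∃! ψ : K0 f Z → K0 f Z, IsAdams p ψ := by
  have hadd := (additiveOn_multClass (f := f) (Z := Z) p).cyclicVal_sub hp.out (pInv_mul p Q)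
    (zetaQ_pow p Q 1)
  set χ := fun P : MF Q f => MF.cyclicVal (multClass p f Z) (pInv p Q) 1 P -
    MF.cyclicVal (multClass p f Z) (pInv p Q) (zetaQ p Q ^ 1) P with hχ
  have hχ' : ∀ P : MFSupp f Z, χ P.1 = K0.mk (eigenPart p P 0) - K0.mk (eigenPart p P 1) := by
    intro P
    rw [mk_eigenPart, mk_eigenPart, pow_zero]
  let ψ₀ : FreeAbelianGroup (MFSupp f Z) →+ K0 f Z := FreeAbelianGroup.lift fun P => χ P.1
  have hψ₀ : ∀ P, ψ₀ (FreeAbelianGroup.of P) = χ P.1 := fun P =>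
    FreeAbelianGroup.lift_apply_of _ _
  have hker : AddSubgroup.closure (K0Relations f Z) ≤ ψ₀.ker := by
    rw [AddSubgroup.closure_le]
    rintro x (⟨P', P, P'', hs, rfl⟩ | ⟨P, P', hh, rfl⟩)
    · rw [SetLike.mem_coe, AddMonoidHom.mem_ker, map_sub, map_add, hψ₀, hψ₀, hψ₀,
        hadd.shortExact P'.2 P.2 P''.2 hs, sub_self]
    · rw [SetLike.mem_coe, AddMonoidHom.mem_ker, map_sub, hψ₀, hψ₀,
        hadd.homotopyEquivalent hh P.2 P'.2, sub_self]
  refine ⟨QuotientAddGroup.lift _ ψ₀ hker, fun P => ?_, fun ψ hψ => funext fun x => ?_⟩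
  · rw [sum_eigenPart, ← hχ']
    congr 1
    exact hψ₀ P
  · obtain ⟨P, rfl⟩ := K0.mk_surjective x
    apply tmul_one_injective p
    refine (hψ P).trans ?_
    rw [sum_eigenPart, ← hχ']
    congr 1
    exact (hψ₀ P).symm

end CyclicAdams

/-! ### Splitting off pairs of creation and annihilation operators. -/

namespace MF

variable {Q : Type u} [CommRing Q] {f : Q} {Z : Set (PrimeSpectrum Q)}
  {A : Type*} [AddCommGroup A] {χ : MF Q f → A}

theorem IsCut.shift {X : MF Q f} {π : Module.End Q X.carrier} (h : X.IsCut π) :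
    X.shift.IsCut π where
  idem := h.idem
  even := by
    change (1 - X.e) * π = π * (1 - X.e)
    rw [sub_mul, mul_sub, h.even, one_mul, mul_one]
  diff := by
    change π * (-X.d) * π * (-X.d) * π = f • π
    simp only [mul_neg, neg_mul, neg_neg, h.diff]

theorem AdditiveOn.cutVal_shift (hχ : AdditiveOn Z χ) {X : MF Q f} {π : Module.End Q X.carrier}
    (h : CutIn Z X π) : cutVal χ X.shift π = - cutVal χ X π := by
  rw [cutVal_eq h.1, cutVal_eq h.1.shift, ← hχ.shift h.2]
  refine (hχ.iso (P := (X.cut π h.1).shift) (P' := X.shift.cut π h.1.shift)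
    ⟨⟨LinearMap.id, ?_, ?_⟩, LinearMap.id, rfl, rfl⟩ ((support_shift _).trans h.2)).symm
  · ext x
    rfl
  · ext x
    exact map_neg π (X.d x.1)

/-- An odd map anticommuting with `d` is a morphism from the shift of `X` to `X`; the shift produces
the sign. -/
theorem AdditiveOn.cutVal_oddSwap (hχ : AdditiveOn Z χ) {X : MF Q f} (hX : X.support ⊆ Z)
    {u v π π' : Module.End Q X.carrier} (hπ : π * π = π) (hπ' : π' * π' = π')
    (hvu : v * u = π) (huv : u * v = π') (hue : X.e * u + u * X.e = u)
    (hve : X.e * v + v * X.e = v) (hud : X.d * u + u * X.d = 0) (hvd : X.d * v + v * X.d = 0) :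
    cutVal χ X π' = - cutVal χ X π := by
  have hu : X.e * u = u * (1 - X.e) := by rw [mul_sub, mul_one]; exact eq_sub_of_add_eq hue
  have hv : X.e * v = v * (1 - X.e) := by rw [mul_sub, mul_one]; exact eq_sub_of_add_eq hve
  have hv' : (1 - X.e) * v = v * X.e := by rw [sub_mul, hv, one_mul]; noncomm_ring
  have he : X.e * π = π * X.e := by
    rw [← hvu, ← mul_assoc, hv, mul_assoc, sub_mul, hu, one_mul, mul_assoc]; noncomm_ring
  have hd : X.d * π = π * X.d := by
    rw [← hvu, ← mul_assoc, eq_neg_of_add_eq_zero_left hvd, neg_mul, mul_assoc,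
      eq_neg_of_add_eq_zero_left hud, mul_neg, neg_neg, mul_assoc]
  rw [← hχ.cutVal_shift (CutIn.of_commute hX hπ he hd)]
  refine (hχ.cutVal_swap (X := X.shift) (X' := X) ((support_shift X).trans hX) (u := u) (v := v)
    hπ hπ' hvu huv hu hv' ?_ ?_).symm
  · change X.d * u = u * (-X.d)
    rw [mul_neg]
    exact eq_neg_of_add_eq_zero_left hud
  · change (-X.d) * v = v * X.d
    rw [neg_mul]
    exact (eq_neg_of_add_eq_zero_right hvd).symm

/-- Splitting off a pair of creation and annihilation operators of weights `y` and `y⁻¹`. -/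
theorem AdditiveOn.cutVal_mode (hχ : AdditiveOn Z χ) {X : MF Q f} (hX : X.support ⊆ Z) {p : ℕ}
    {b y y' z : Q} (hb : b * p = 1) (hy : y ^ p = 1) (hz : z ^ p = 1) (hyy' : y * y' = 1)
    {T C D π : Module.End Q X.carrier} (hT : T ^ p = 1) (hTe : Commute X.e T) (hTd : Commute X.d T)
    (hDD : D * D = 0) (hCD : C * D + D * C = 1) (hTC : T * C = y • (C * T))
    (hTD : T * D = y' • (D * T)) (hCe : X.e * C + C * X.e = C) (hDe : X.e * D + D * X.e = D)
    (hCd : X.d * C + C * X.d = 0) (hDd : X.d * D + D * X.d = 0) (hπ : π * π = π)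
    (hπe : Commute X.e π) (hπd : Commute X.d π) (hπT : Commute T π) (hπC : Commute C π)
    (hπD : Commute D π) :
    cutVal χ X (eigenProj b (z * y) p T * π) =
      cutVal χ X (eigenProj b (z * y) p T * (π * (D * C))) -
      cutVal χ X (eigenProj b z p T * (π * (D * C))) := by
  have hzy : (z * y) ^ p = 1 := by rw [mul_pow, hz, hy, one_mul]
  set ε := eigenProj b (z * y) p T with hε
  set ε' := eigenProj b z p T with hε'
  have hεC : ε * C = C * ε' := eigenProj_comp hy hTC
  have comm : ∀ (w : Q) (x : Module.End Q X.carrier), Commute T x → Commute (eigenProj b w p T) x :=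
    fun w x h => eigenProj_comm h
  have hidem : ∀ w : Q, w ^ p = 1 → IsIdempotentElem (eigenProj b w p T) := fun w hw =>
    eigenProj_mul_self hb hw hT
  have hu : X.e * C = C * (1 - X.e) := by rw [mul_sub, mul_one]; exact eq_sub_of_add_eq hCe
  have hv : X.e * D = D * (1 - X.e) := by rw [mul_sub, mul_one]; exact eq_sub_of_add_eq hDe
  have hCd' := eq_neg_of_add_eq_zero_left hCd
  have hDd' := eq_neg_of_add_eq_zero_left hDd
  -- `D C` projects onto the vacuum `ker D` of the mode, and `C D = 1 - D C` onto its occupied part.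
  have hDCi : IsIdempotentElem (D * C) := by
    have h1 : C * D = 1 - D * C := eq_sub_of_add_eq hCD
    calc D * C * (D * C) = D * (C * D) * C := by simp only [mul_assoc]
      _ = D * C - D * D * C * C := by rw [h1]; noncomm_ring
      _ = D * C := by rw [hDD, zero_mul, zero_mul, sub_zero]
  have hCDeq : C * D = 1 - D * C := eq_sub_of_add_eq hCD
  have hDCT : Commute T (D * C) := by
    change T * (D * C) = D * C * T
    rw [← mul_assoc, hTD, smul_mul_assoc, mul_assoc, hTC, mul_smul_comm, smul_smul, mul_comm y',
      hyy', one_smul, mul_assoc]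
  have hDCe : Commute X.e (D * C) := by
    change X.e * (D * C) = D * C * X.e
    rw [← mul_assoc, hv, mul_assoc, sub_mul, hu, one_mul, mul_assoc]; noncomm_ring
  have hDCd : Commute X.d (D * C) := by
    change X.d * (D * C) = D * C * X.d
    rw [← mul_assoc, hDd', neg_mul, mul_assoc, hCd', mul_neg, neg_neg, mul_assoc]
  have hπDC : Commute π (D * C) := hπD.symm.mul_right hπC.symm
  have hεe : ∀ w, Commute X.e (eigenProj b w p T) := fun w => (comm w _ hTe.symm).symm
  have hεd : ∀ w, Commute X.d (eigenProj b w p T) := fun w => (comm w _ hTd.symm).symm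
  have hi1 : IsIdempotentElem (π * (D * C)) := IsIdempotentElem.mul_of_commute hπDC hπ hDCi
  have hcut : ∀ w x, w ^ p = 1 → IsIdempotentElem x → Commute T x → Commute X.e x → Commute X.d x →
      CutIn Z X (eigenProj b w p T * x) := fun w x hw hx h1 h2 h3 =>
    .of_commute hX (IsIdempotentElem.mul_of_commute (comm w x h1) (hidem w hw) hx)
      ((hεe w).mul_right h2) ((hεd w).mul_right h3)
  have hπ1 : π * (C * D) = π - π * (D * C) := by rw [hCDeq, mul_sub, mul_one]
  have hsub : ε * π - ε * (π * (D * C)) = ε * (π * (C * D)) := by rw [hπ1, mul_sub]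
  have hi2 : IsIdempotentElem (π * (C * D)) := by
    rw [hCDeq]
    exact IsIdempotentElem.mul_of_commute ((Commute.one_right π).sub_right hπDC) hπ hDCi.one_sub
  have c1 := hcut (z * y) (π * (D * C)) hzy hi1 (hπT.mul_right hDCT) (hπe.mul_right hDCe)
    (hπd.mul_right hDCd)
  have c2 := hcut (z * y) π hzy hπ hπT hπe hπd
  have c3 := hcut (z * y) (π * (C * D)) hzy hi2
    (by rw [hπ1]; exact hπT.sub_right (hπT.mul_right hDCT))
    (by rw [hπ1]; exact hπe.sub_right (hπe.mul_right hDCe))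
    (by rw [hπ1]; exact hπd.sub_right (hπd.mul_right hDCd))
  have hεi : ε * ε = ε := hidem _ hzy
  have hεπ : Commute ε π := comm _ _ hπT
  have hAB : ε * (π * (D * C)) * (ε * π) = ε * (π * (D * C)) := by
    have h1 : Commute ε (π * (D * C)) := comm _ _ (hπT.mul_right hDCT)
    have h2 : Commute π (π * (D * C)) := (Commute.refl π).mul_right hπDC
    calc ε * (π * (D * C)) * (ε * π) = ε * ε * (π * (π * (D * C))) := by
          rw [h2.eq, mul_assoc, ← mul_assoc (π * (D * C)) ε, ← h1.eq]; simp only [mul_assoc]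
      _ = ε * (π * (D * C)) := by rw [hεi, ← mul_assoc π, hπ]
  have hBA : ε * π * (ε * (π * (D * C))) = ε * (π * (D * C)) := by
    calc ε * π * (ε * (π * (D * C))) = ε * (π * ε) * (π * (D * C)) := by simp only [mul_assoc]
      _ = ε * ε * (π * π * (D * C)) := by rw [← hεπ.eq]; simp only [mul_assoc]
      _ = _ := by rw [hεi, hπ]
  have hst : X.d * (ε * (π * (D * C))) = ε * (π * (D * C)) * X.d * (ε * (π * (D * C))) := by
    have h1 : Commute X.d (ε * (π * (D * C))) := (hεd _).mul_right (hπd.mul_right hDCd)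
    rw [mul_assoc _ X.d, h1.eq, ← mul_assoc _ _ X.d, c1.1.idem]
  have hadd := (hχ.cutVal_add hAB hBA c1 c2.1 (by rw [hsub]; exact c3) hst).2
  -- The odd operator `C` identifies the vacuum part of eigenvalue `z` with the occupied part of
  -- eigenvalue `z y`.
  have hswap : cutVal χ X (ε * (π * (C * D))) = - cutVal χ X (ε' * (π * (D * C))) := by
    have hπD' : X.e * (ε' * (π * D)) + ε' * (π * D) * X.e = ε' * (π * D) := by
      have h1 : Commute X.e (ε' * π) := (hεe _).mul_right hπe
      calc X.e * (ε' * (π * D)) + ε' * (π * D) * X.e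
          = X.e * (ε' * π) * D + ε' * π * (D * X.e) := by simp only [mul_assoc]
        _ = ε' * π * (X.e * D + D * X.e) := by rw [h1.eq, mul_add]; simp only [mul_assoc]
        _ = ε' * (π * D) := by rw [hDe, mul_assoc]
    have hπD'' : X.d * (ε' * (π * D)) + ε' * (π * D) * X.d = 0 := by
      have h1 : Commute X.d (ε' * π) := (hεd _).mul_right hπd
      calc X.d * (ε' * (π * D)) + ε' * (π * D) * X.d
          = X.d * (ε' * π) * D + ε' * π * (D * X.d) := by simp only [mul_assoc]
        _ = ε' * π * (X.d * D + D * X.d) := by rw [h1.eq, mul_add]; simp only [mul_assoc]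
        _ = 0 := by rw [hDd, mul_zero]
    refine hχ.cutVal_oddSwap hX (u := C) (v := ε' * (π * D))
      (hcut z (π * (D * C)) hz hi1 (hπT.mul_right hDCT) (hπe.mul_right hDCe)
        (hπd.mul_right hDCd)).1.idem c3.1.idem (by simp only [mul_assoc]) ?_ hCe hπD' hCd hπD''
    rw [← mul_assoc, ← hεC, mul_assoc, ← mul_assoc C, hπC.eq, mul_assoc π]
  rw [hadd, hsub, hswap, sub_eq_add_neg]

end MF

theorem Finset.sum_range_add_of_periodic {A : Type*} [AddCommGroup A] {p : ℕ} {G : ℕ → A}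
    (hG : ∀ k, G (k + p) = G k) (m : ℕ) :
    ∑ k ∈ Finset.range p, G (k + m) = ∑ k ∈ Finset.range p, G k := by
  induction m with
  | zero => rfl
  | succ m ih =>
    rw [← ih]
    have h1 := Finset.sum_range_succ (fun k => G (k + m)) p
    have h2 := Finset.sum_range_succ' (fun k => G (k + m)) p
    rw [h1, show G (p + m) = G (0 + m) by rw [zero_add, add_comm, hG]] at h2
    rw [add_right_cancel h2]
    exact Finset.sum_congr rfl fun k _ => by rw [add_right_comm, add_assoc]

namespace CyclicAdams

variable (p : ℕ) {Q : Type u} [CommRing Q] [Algebra (Ap p) Q] {f : Q} {Z : Set (PrimeSpectrum Q)}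
  {A : Type*} [AddCommGroup A] {χ : MF Q f → A}

/-- The class `∑ χ(π X^(ζ)) ⊗ ζ`, where `X^(ζ)` is the `ζ`-eigenspace of `T` and the sum ranges over
the `p`-th roots of unity `ζ`. -/
noncomputable def eigenSum (χ : MF Q f → A) (X : MF Q f) (T π : Module.End Q X.carrier) :
    A ⊗[ℤ] ZZeta p :=
  ∑ k ∈ Finset.range p,
    MF.cutVal χ X (eigenProj (pInv p Q) (zetaQ p Q ^ k) p T * π) ⊗ₜ[ℤ] (zeta p ^ k)

variable [hp : Fact p.Prime]

theorem zeta_pow : zeta p ^ p = 1 := (isPrimitiveRoot_zeta p).pow_eq_one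

theorem zetaQ_pow_self : zetaQ p Q ^ p = 1 := by simpa using zetaQ_pow p Q 1

/-- `cutVal_mode` summed over the eigenvalues. The occupied part is a parity shift of the vacuum
part with eigenvalues multiplied by `ζ^r`, so it contributes `-ζ^r` times the vacuum sum. The
exponent `k + (p - r)` stands for `k - r`, and the sum is reindexed by periodicity. -/
theorem eigenSum_mode (hχ : MF.AdditiveOn Z χ) {X : MF Q f} (hX : X.support ⊆ Z) {r : ℕ} (hr : r < p)
    {T C D π : Module.End Q X.carrier} (hT : T ^ p = 1) (hTe : Commute X.e T) (hTd : Commute X.d T)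
    (hDD : D * D = 0) (hCD : C * D + D * C = 1)
    (hTC : T * C = zetaQ p Q ^ r • (C * T)) (hTD : T * D = zetaQ p Q ^ (p - r) • (D * T))
    (hCe : X.e * C + C * X.e = C) (hDe : X.e * D + D * X.e = D)
    (hCd : X.d * C + C * X.d = 0) (hDd : X.d * D + D * X.d = 0) (hπ : π * π = π)
    (hπe : Commute X.e π) (hπd : Commute X.d π) (hπT : Commute T π) (hπC : Commute C π)
    (hπD : Commute D π) :
    eigenSum p χ X T π = LinearMap.lTensor A (LinearMap.mulLeft ℤ (1 - zeta p ^ r))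
      (eigenSum p χ X T (π * (D * C))) := by
  set z := zetaQ p Q with hz
  have hzp : z ^ p = 1 := zetaQ_pow_self p
  have hstep : ∀ k, MF.cutVal χ X (eigenProj (pInv p Q) (z ^ k) p T * π) =
      MF.cutVal χ X (eigenProj (pInv p Q) (z ^ k) p T * (π * (D * C))) -
      MF.cutVal χ X (eigenProj (pInv p Q) (z ^ (k + (p - r))) p T * (π * (D * C))) := by
    intro k
    have h1 : z ^ (k + (p - r)) * z ^ r = z ^ k := by
      rw [← pow_add, add_assoc, Nat.sub_add_cancel hr.le, pow_add, hzp, mul_one]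
    have := hχ.cutVal_mode hX (pInv_mul p Q) (zetaQ_pow p Q r) (zetaQ_pow p Q (k + (p - r)))
      (by rw [← pow_add, Nat.add_sub_cancel' hr.le, zetaQ_pow_self p]) hT hTe hTd hDD hCD hTC hTD
      hCe hDe hCd hDd hπ hπe hπd hπT hπC hπD
    rwa [h1] at this
  have hper := Finset.sum_range_add_of_periodic (p := p) (G := fun k =>
    MF.cutVal χ X (eigenProj (pInv p Q) (z ^ k) p T * (π * (D * C))) ⊗ₜ[ℤ] (zeta p ^ (k + r)))
    (fun k => by
      rw [pow_add z, hzp, mul_one, add_right_comm, pow_add (zeta p), zeta_pow, mul_one]) (p - r)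
  have hG : ∀ k, (zeta p) ^ (k + (p - r) + r) = zeta p ^ k := fun k => by
    rw [add_assoc, Nat.sub_add_cancel hr.le, pow_add, zeta_pow, mul_one]
  simp only [hG] at hper
  simp only [eigenSum, ← hz, hstep, TensorProduct.sub_tmul, Finset.sum_sub_distrib, map_sum,
    LinearMap.lTensor_tmul, LinearMap.mulLeft_apply, sub_mul, one_mul, TensorProduct.tmul_sub, hper]
  congr 1
  refine Finset.sum_congr rfl fun k _ => ?_
  rw [← pow_add, add_comm r]

/-- Splitting off a family of pairs of creation and annihilation operators. -/
theorem eigenSum_modes (hχ : MF.AdditiveOn Z χ) {X : MF Q f} (hX : X.support ⊆ Z) {I : Type*}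
    [DecidableEq I] {r : I → ℕ} {T : Module.End Q X.carrier} {C D : I → Module.End Q X.carrier}
    (hT : T ^ p = 1) (hTe : Commute X.e T) (hTd : Commute X.d T)
    (hDD : ∀ s, D s * D s = 0)
    (hCC' : ∀ s t, C s * C t + C t * C s = 0) (hDD' : ∀ s t, D s * D t + D t * D s = 0)
    (hCD : ∀ s t, C s * D t + D t * C s = if s = t then 1 else 0) (hr : ∀ s, r s < p)
    (hTC : ∀ s, T * C s = zetaQ p Q ^ r s • (C s * T))
    (hTD : ∀ s, T * D s = zetaQ p Q ^ (p - r s) • (D s * T))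
    (hCe : ∀ s, X.e * C s + C s * X.e = C s) (hDe : ∀ s, X.e * D s + D s * X.e = D s)
    (hDd : ∀ s, X.d * D s + D s * X.d = 0) (l : List I) (hl : l.Nodup)
    (hCd : ∀ s ∈ l, X.d * C s + C s * X.d = 0) (π : Module.End Q X.carrier) (hπ : π * π = π)
    (hπe : Commute X.e π) (hπd : Commute X.d π) (hπT : Commute T π)
    (hπC : ∀ s ∈ l, Commute (C s) π) (hπD : ∀ s ∈ l, Commute (D s) π) :
    eigenSum p χ X T π = LinearMap.lTensor A
      (LinearMap.mulLeft ℤ (l.map fun s => 1 - zeta p ^ r s).prod)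
      (eigenSum p χ X T (π * (l.map fun s => D s * C s).prod)) ∧
    Commute X.e (π * (l.map fun s => D s * C s).prod) ∧
    Commute X.d (π * (l.map fun s => D s * C s).prod) := by
  -- After the mode `s` is split off, `π` is replaced by its restriction to the vacuum of `s`. It
  -- still commutes with the remaining modes, since these anticommute with both `C s` and `D s`.
  induction l generalizing π with
  | nil =>
    simp only [List.map_nil, List.prod_nil, mul_one]
    refine ⟨?_, hπe, hπd⟩
    rw [LinearMap.mulLeft_one, LinearMap.lTensor_id, LinearMap.id_apply]
  | cons s l ih =>
    rw [List.nodup_cons] at hl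
    have hne : ∀ t ∈ l, s ≠ t := fun t ht h => hl.1 (h ▸ ht)
    have hs : s ∈ s :: l := List.mem_cons_self
    have hcomm : ∀ (y a c : Module.End Q X.carrier), y * a + a * y = 0 → y * c + c * y = 0 →
        Commute y (a * c) := fun y a c h1 h2 => by
      change y * (a * c) = a * c * y
      rw [← mul_assoc, eq_neg_of_add_eq_zero_left h1, neg_mul, mul_assoc,
        eq_neg_of_add_eq_zero_left h2, mul_neg, neg_neg, mul_assoc]
    have hDCi : IsIdempotentElem (D s * C s) := by
      have h1 : C s * D s = 1 - D s * C s := eq_sub_of_add_eq ((hCD s s).trans (if_pos rfl))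
      calc D s * C s * (D s * C s) = D s * (C s * D s) * C s := by simp only [mul_assoc]
        _ = D s * C s - D s * D s * C s * C s := by rw [h1]; noncomm_ring
        _ = D s * C s := by rw [hDD, zero_mul, zero_mul, sub_zero]
    have hDCe : Commute X.e (D s * C s) := by
      have hu : X.e * C s = C s * (1 - X.e) := by
        rw [mul_sub, mul_one]; exact eq_sub_of_add_eq (hCe s)
      have hv : X.e * D s = D s * (1 - X.e) := by
        rw [mul_sub, mul_one]; exact eq_sub_of_add_eq (hDe s)
      change X.e * (D s * C s) = D s * C s * X.e
      rw [← mul_assoc, hv, mul_assoc, sub_mul, hu, one_mul, mul_assoc]; noncomm_ring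
    have hDCT : Commute T (D s * C s) := by
      change T * (D s * C s) = D s * C s * T
      rw [← mul_assoc, hTD, smul_mul_assoc, mul_assoc, hTC, mul_smul_comm, smul_smul, ← pow_add,
        Nat.sub_add_cancel (hr s).le, zetaQ_pow_self, one_smul, mul_assoc]
    have h1 := eigenSum_mode p hχ hX (hr s) hT hTe hTd (hDD s)
      ((hCD s s).trans (if_pos rfl)) (hTC s) (hTD s) (hCe s) (hDe s) (hCd s hs) (hDd s) hπ hπe hπd
      hπT (hπC s hs) (hπD s hs)
    have h2 := ih hl.2 (fun t ht => hCd t (List.mem_cons_of_mem _ ht)) (π * (D s * C s))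
      (IsIdempotentElem.mul_of_commute ((hπD s hs).symm.mul_right (hπC s hs).symm) hπ hDCi)
      (hπe.mul_right hDCe) (hπd.mul_right (hcomm _ _ _ (hDd s) (hCd s hs))) (hπT.mul_right hDCT)
      (fun t ht => (hπC t (List.mem_cons_of_mem _ ht)).mul_right (hcomm _ _ _
        ((hCD t s).trans (if_neg (hne t ht).symm)) (hCC' t s)))
      (fun t ht => (hπD t (List.mem_cons_of_mem _ ht)).mul_right (hcomm _ _ _
        (hDD' t s) (by rw [add_comm]; exact (hCD s t).trans (if_neg (hne t ht)))))
    rw [List.map_cons, List.map_cons, List.prod_cons, List.prod_cons, ← mul_assoc π]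
    refine ⟨?_, h2.2⟩
    rw [h1, h2.1, ← LinearMap.comp_apply, ← LinearMap.lTensor_comp, LinearMap.mulLeft_mul]

end CyclicAdams

/-! ### Fourier modes of odd operators on the tensor power. -/

namespace MFTensor

variable {Q : Type u} [CommRing Q] {M : Type u} [AddCommGroup M] [Module Q M] {n : ℕ}
  {e h k : Module.End Q M}

open Module PiTensorProduct

theorem slot_smul (e h : End Q M) (c : Q) (i : Fin n) : slot e (c • h) i = c • slot e h i := by
  have key : ∀ h : End Q M, slot e h i = PiTensorProduct.map (Function.update
      (fun j => if j < i then 1 - 2 • e else 1) i h) := by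
    intro h
    rw [slot]
    congr 1
    ext1 j
    by_cases hj : j = i
    · subst hj; simp
    · simp [hj]
  rw [key, key, PiTensorProduct.map_update_smul]

theorem slot_anticommutator (he : e * e = e) (hh : e * h + h * e = h) (hk : e * k + k * e = k)
    {s : Q} (hs : h * k + k * h = s • 1) (i j : Fin n) :
    slot e h i * slot e k j + slot e k j * slot e h i = if i = j then s • 1 else 0 := by
  split_ifs with hij
  · subst hij
    rw [slot_self he, slot_self he, ← PiTensorProduct.map_update_add, hs,
      PiTensorProduct.map_update_smul]
    have : Function.update (1 : Fin n → End Q M) i 1 = 1 := Function.update_eq_self i _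
    rw [this]
    exact congrArg _ PiTensorProduct.map_one
  · rcases lt_or_gt_of_ne hij with hlt | hlt
    · exact slot_anticomm hh hlt
    · rw [add_comm]
      exact slot_anticomm hk hlt

/-- The discrete Fourier mode `∑ zʲ hⱼ` of an odd endomorphism acting in the slots. -/
def mode (e : End Q M) (z : Q) (h : End Q M) : End Q (⨂[Q] _ : Fin n, M) :=
  ∑ j : Fin n, z ^ (j : ℕ) • slot e h j

theorem mode_one (e h : End Q M) : mode e 1 h = diff n e h := by simp [mode, diff]

theorem mode_odd (he : e * e = e) (hh : e * h + h * e = h) (z : Q) :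
    oddProj n e * mode e z h + mode e z h * oddProj n e = mode e z h := by
  simp only [mode, Finset.mul_sum, Finset.sum_mul, ← Finset.sum_add_distrib, mul_smul_comm,
    smul_mul_assoc, ← smul_add, slot_odd he hh]

/-- The Koszul signs make odd operators in different slots anticommute, so only the diagonal terms
survive and form a geometric sum in `z w`. -/
theorem mode_anticommutator (he : e * e = e) (hh : e * h + h * e = h) (hk : e * k + k * e = k)
    {s : Q} (hs : h * k + k * h = s • 1) (z w : Q) :
    mode e z h * mode e w k + mode e w k * mode e z h =
      ((∑ j ∈ Finset.range n, (z * w) ^ j) * s) • (1 : End Q (⨂[Q] _ : Fin n, M)) := by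
  have h1 : mode (n := n) e w k * mode e z h = ∑ i : Fin n, ∑ j : Fin n,
      (z ^ (i : ℕ) * w ^ (j : ℕ)) • (slot e k j * slot e h i) := by
    rw [mode, mode, Finset.sum_mul_sum, Finset.sum_comm]
    refine Finset.sum_congr rfl fun i _ => Finset.sum_congr rfl fun j _ => ?_
    rw [smul_mul_smul_comm, mul_comm]
  have h2 : mode (n := n) e z h * mode e w k = ∑ i : Fin n, ∑ j : Fin n,
      (z ^ (i : ℕ) * w ^ (j : ℕ)) • (slot e h i * slot e k j) := by
    rw [mode, mode, Finset.sum_mul_sum]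
    refine Finset.sum_congr rfl fun i _ => Finset.sum_congr rfl fun j _ => ?_
    rw [smul_mul_smul_comm]
  rw [h1, h2, ← Finset.sum_add_distrib]
  simp only [← Finset.sum_add_distrib, ← smul_add, slot_anticommutator he hh hk hs]
  simp only [smul_ite, smul_zero, Finset.sum_ite_eq, Finset.mem_univ, if_true, ← mul_pow, smul_smul]
  rw [← Finset.sum_smul, ← Finset.sum_mul, Fin.sum_univ_eq_sum_range (fun j => (z * w) ^ j)]

/-- `mode_anticommutator` would only show that twice the square vanishes, and 2 need not be
invertible. Instead the terms `(i, j)` and `(j, i)` are cancelled in pairs, and the diagonal terms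
vanish by `h0`. -/
theorem mode_mul_self (he : e * e = e) (hh : e * h + h * e = h) (h0 : h * h = 0) (z : Q) :
    mode e z h * mode e z h = (0 : End Q (⨂[Q] _ : Fin n, M)) := by
  have hs : h * h + h * h = (0 : Q) • 1 := by rw [h0, zero_smul, add_zero]
  have key := slot_anticommutator (n := n) he hh hh hs
  have hself : ∀ i : Fin n, slot e h i * slot e h i = 0 := fun i => by
    rw [slot_self he, h0]
    have := PiTensorProduct.map_update_smul (R := Q) (1 : Fin n → End Q M) i 0 1
    rwa [zero_smul, zero_smul] at this
  rw [mode, Finset.sum_mul_sum, ← Finset.sum_product']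
  refine Finset.sum_involution (fun x _ => x.swap) ?_ ?_ ?_ ?_
  · rintro ⟨i, j⟩ -
    simp only [Prod.fst_swap, Prod.snd_swap, smul_mul_smul_comm]
    rw [mul_comm (z ^ (j : ℕ)), ← smul_add, key]
    simp
  · rintro ⟨i, j⟩ - hne hswap
    obtain rfl : j = i := congrArg Prod.fst hswap
    exact hne (by simp only [smul_mul_smul_comm, hself, smul_zero])
  · simp
  · simp

/-- The rotation moves the operator in slot `j` to slot `j + 1`, so a mode is an eigenvector for
conjugation by the rotation, of eigenvalue `z⁻¹`. -/
theorem permAct_mode (he : e * e = e) (hh : e * h + h * e = h) {z : Q} (hz : z ^ n = 1) :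
    mode e z h * permAct e (finRotate n) = z • (permAct e (finRotate n) * mode e z h) := by
  rw [mode, Finset.mul_sum, Finset.sum_mul, Finset.smul_sum,
    ← Equiv.sum_comp (finRotate n) (fun i : Fin n => z ^ (i : ℕ) • slot e h i * permAct e (finRotate n))]
  refine Finset.sum_congr rfl fun i _ => ?_
  rw [mul_smul_comm, permAct_slot he hh, smul_smul, smul_mul_assoc, pow_finRotate hz]

end MFTensor

namespace CyclicAdams

variable (p : ℕ) {Q : Type u} [CommRing Q] [Algebra (Ap p) Q] [hp : Fact p.Prime]

/-- `Q` need not be a domain, so the vanishing for `p ∤ m` is proved for the primitive root `ζ^m` in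
`A_p ⊂ ℂ` and then mapped to `Q`. -/
theorem sum_zetaQ_pow (m : ℕ) :
    ∑ j ∈ Finset.range p, (zetaQ p Q ^ m) ^ j = if p ∣ m then (p : Q) else 0 := by
  split_ifs with h
  · obtain ⟨c, rfl⟩ := h
    rw [pow_mul, zetaQ_pow_self, one_pow]
    simp
  · let w : Ap p := ⟨zetaC p, Algebra.subset_adjoin (by simp)⟩
    have hw : IsPrimitiveRoot w p := by
      refine IsPrimitiveRoot.of_map_of_injective (f := Subalgebra.val _) ?_ Subtype.val_injective
      exact isPrimitiveRoot_zetaC p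
    have hm : IsPrimitiveRoot (w ^ m) p := hw.pow_of_coprime m
      ((Nat.Prime.coprime_iff_not_dvd hp.out).2 h).symm
    have h1 := congrArg (algebraMap (Ap p) Q) (hm.geom_sum_eq_zero hp.out.one_lt)
    rw [map_zero, map_sum] at h1
    rw [← h1]
    exact Finset.sum_congr rfl fun j _ => by rw [map_pow, map_pow]; rfl

end CyclicAdams

/-! ### Linear maps out of exterior algebras and their tensor powers. -/

namespace Koszul

variable {Q : Type u} [CommRing Q] {n : ℕ} {N : Type*} [AddCommGroup N] [Module Q N]

open Module ExteriorAlgebra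

/-- The exterior algebra is generated from 1 by left multiplications with vectors, so the image of 1
and the rule `c` determine a linear map. -/
theorem linearMap_ext {f g : ExteriorAlgebra Q (Fin n → Q) →ₗ[Q] N} (c : (Fin n → Q) → End Q N)
    (h1 : f 1 = g 1) (hf : ∀ v x, f (ι Q v * x) = c v (f x)) (hg : ∀ v x, g (ι Q v * x) = c v (g x)) :
    f = g := by
  refine LinearMap.ext fun x => ?_
  induction x using CliffordAlgebra.left_induction with
  | algebraMap r =>
    have h (φ : ExteriorAlgebra Q (Fin n → Q) →ₗ[Q] N) :
        φ (algebraMap Q (ExteriorAlgebra Q (Fin n → Q)) r) = r • φ 1 := by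
      rw [Algebra.algebraMap_eq_smul_one, map_smul]
    exact (h f).trans (h1 ▸ (h g).symm)
  | add x y hx hy => rw [map_add, map_add, hx, hy]
  | ι_mul x v hx => exact (hf v x).trans (hx ▸ (hg v x).symm)

/-- The linear map out of the exterior algebra determined by the image `Ω` of `1` and the action `c`
of the generators. -/
noncomputable def recMap (c : (Fin n → Q) →ₗ[Q] End Q N) (hc : ∀ v, c v * c v = 0) (Ω : N) :
    ExteriorAlgebra Q (Fin n → Q) →ₗ[Q] N :=
  (ExteriorAlgebra.lift Q ⟨c, hc⟩).toLinearMap.flip Ω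

variable (c : (Fin n → Q) →ₗ[Q] End Q N) (hc : ∀ v, c v * c v = 0) (Ω : N)

theorem recMap_one : recMap c hc Ω 1 = Ω := by simp [recMap]

theorem recMap_ι_mul (v : Fin n → Q) (x) : recMap c hc Ω (ι Q v * x) = c v (recMap c hc Ω x) := by
  simp [recMap]

/-- Left multiplication by a generator. -/
noncomputable def mulι : (Fin n → Q) →ₗ[Q] End Q (ExteriorAlgebra Q (Fin n → Q)) :=
  LinearMap.mul Q (ExteriorAlgebra Q (Fin n → Q)) ∘ₗ ι Q

theorem mulι_apply (v : Fin n → Q) (x) : mulι v x = ι Q v * x := rfl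

theorem oddProj_mul_self : oddProj Q n * oddProj Q n = oddProj Q n :=
  Submodule.isIdempotentElem_projection
    (CliffordAlgebra.evenOdd_isCompl (0 : QuadraticForm Q (Fin n → Q))).symm

theorem mulι_odd (v : Fin n → Q) : oddProj Q n * mulι v + mulι v * oddProj Q n = mulι v := by
  refine LinearMap.ext fun x => ?_
  change oddProj Q n (ι Q v * x) + ι Q v * oddProj Q n x = ι Q v * x
  rw [oddProj_ι_mul, ← mul_add, sub_add_cancel]

theorem mulι_mul_self (v : Fin n → Q) : mulι v * mulι v = 0 := by
  refine LinearMap.ext fun x => ?_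
  change ι Q v * (ι Q v * x) = 0
  rw [← mul_assoc, ι_sq_zero, zero_mul]

theorem mulι_anticomm (v w : Fin n → Q) : mulι v * mulι w + mulι w * mulι v = 0 := by
  refine LinearMap.ext fun x => ?_
  change ι Q v * (ι Q w * x) + ι Q w * (ι Q v * x) = 0
  rw [← mul_assoc, ← mul_assoc, ← add_mul, ι_add_mul_swap, zero_mul]

theorem diff_mulι (a v : Fin n → Q) : diff a * mulι v + mulι v * diff a =
    (Fintype.linearCombination Q a v) • (1 : End Q (ExteriorAlgebra Q (Fin n → Q))) := by
  refine LinearMap.ext fun x => ?_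
  change diff a (ι Q v * x) + ι Q v * diff a x =
    (Fintype.linearCombination Q a v) • x
  rw [diff_ι_mul, sub_add_cancel]

theorem diff_anticomm (a b : Fin n → Q) : diff a * diff b + diff b * diff a = 0 := by
  refine LinearMap.ext fun x => ?_
  exact add_eq_zero_iff_eq_neg.2 (CliffordAlgebra.contractLeft_comm _ _ x)

theorem diff_mul_self (a : Fin n → Q) : diff a * diff a = 0 :=
  LinearMap.ext fun x => CliffordAlgebra.contractLeft_contractLeft _ x

theorem oddProj_one : oddProj Q n 1 = 0 := by
  have := oddProj_algebraMap (n := n) (1 : Q)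
  rwa [map_one] at this

theorem diff_one (a : Fin n → Q) : diff a 1 = 0 := by
  have := diff_algebraMap a (1 : Q)
  rwa [map_one] at this

/-- A linear map out of the exterior algebra is even if it maps `1` to an even element and the
generators act by odd endomorphisms. -/
theorem even_of_ι {f : ExteriorAlgebra Q (Fin n → Q) →ₗ[Q] N} {e : End Q N} {c : (Fin n → Q) → End Q N}
    (hf : ∀ v x, f (ι Q v * x) = c v (f x)) (h1 : e (f 1) = 0) (hc : ∀ v, e * c v + c v * e = c v) :
    e ∘ₗ f = f ∘ₗ oddProj Q n := by
  have hc' : ∀ v x, e (c v x) = c v (x - e x) := fun v x => by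
    have := LinearMap.congr_fun (hc v) x
    rw [map_sub]
    exact eq_sub_of_add_eq this
  -- The recursion for `e ∘ f` also involves `f`, so `linearMap_ext` is applied to the pairs.
  have key : (LinearMap.prod f (e ∘ₗ f)) = LinearMap.prod f (f ∘ₗ oddProj Q n) := by
    refine linearMap_ext (fun v => LinearMap.prod (c v ∘ₗ LinearMap.fst Q N N)
      (c v ∘ₗ (LinearMap.fst Q N N - LinearMap.snd Q N N))) ?_ (fun v x => ?_) (fun v x => ?_)
    · simp [oddProj_one, h1]
    · exact Prod.ext (hf v x) ((congrArg e (hf v x)).trans (hc' v _))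
    · refine Prod.ext (hf v x) ?_
      change f (oddProj Q n (ι Q v * x)) = c v (f x - f (oddProj Q n x))
      rw [oddProj_ι_mul, hf, map_sub]
  exact congrArg (fun φ => LinearMap.snd Q N N ∘ₗ φ) key

/-- A linear map out of the exterior algebra commutes with the differentials if it maps `1` to a cycle
and the generators act accordingly. -/
theorem comm_diff_of_ι {f : ExteriorAlgebra Q (Fin n → Q) →ₗ[Q] N} {d : End Q N}
    {c : (Fin n → Q) → End Q N} {a : Fin n → Q} (hf : ∀ v x, f (ι Q v * x) = c v (f x))
    (h1 : d (f 1) = 0) (hc : ∀ v, d * c v + c v * d = Fintype.linearCombination Q a v • 1) :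
    d ∘ₗ f = f ∘ₗ diff a := by
  have hc' : ∀ v x, d (c v x) = Fintype.linearCombination Q a v • x - c v (d x) := fun v x => by
    have := LinearMap.congr_fun (hc v) x
    exact eq_sub_of_add_eq this
  have key : (LinearMap.prod f (d ∘ₗ f)) = LinearMap.prod f (f ∘ₗ diff a) := by
    refine linearMap_ext (fun v => LinearMap.prod (c v ∘ₗ LinearMap.fst Q N N)
      (Fintype.linearCombination Q a v • LinearMap.fst Q N N - c v ∘ₗ LinearMap.snd Q N N)) ?_
      (fun v x => ?_) (fun v x => ?_)
    · simp [diff_one, h1]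
    · exact Prod.ext (hf v x) ((congrArg d (hf v x)).trans (hc' v _))
    · refine Prod.ext (hf v x) ?_
      change f (diff a (ι Q v * x)) = Fintype.linearCombination Q a v • f x - c v (f (diff a x))
      rw [diff_ι_mul, map_sub, map_smul, hf]
  exact congrArg (fun φ => LinearMap.snd Q N N ∘ₗ φ) key

variable {p : ℕ}

/-- The multiplication map `T^p Λ → Λ`. -/
noncomputable def mulMap (n p : ℕ) : (⨂[Q] _ : Fin p, ExteriorAlgebra Q (Fin n → Q)) →ₗ[Q]
    ExteriorAlgebra Q (Fin n → Q) :=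
  PiTensorProduct.lift (MultilinearMap.mkPiAlgebraFin Q p (ExteriorAlgebra Q (Fin n → Q)))

theorem mulMap_tprod (x : Fin p → ExteriorAlgebra Q (Fin n → Q)) :
    mulMap n p (PiTensorProduct.tprod Q x) = (List.ofFn x).prod := by
  rw [mulMap, PiTensorProduct.lift.tprod, MultilinearMap.mkPiAlgebraFin_apply]

/-- Graded commutativity: `1 - 2 e` is the parity sign. -/
theorem parity_mul_ι (v : Fin n → Q) (x : ExteriorAlgebra Q (Fin n → Q)) :
    (x - 2 • oddProj Q n x) * ι Q v = ι Q v * x := by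
  induction x using CliffordAlgebra.left_induction with
  | algebraMap r =>
    have := oddProj_algebraMap (n := n) r
    rw [this, smul_zero, sub_zero]
    exact Algebra.commutes _ _
  | add x y hx hy =>
    rw [map_add, mul_add, ← hx, ← hy, smul_add, add_sub_add_comm, add_mul]
  | ι_mul x w hx =>
    have h1 := oddProj_ι_mul w x
    have h2 : ι Q v * (ι Q w * x) = - (ι Q w * (ι Q v * x)) := by
      rw [← mul_assoc, ← mul_assoc, ← neg_mul, eq_neg_of_add_eq_zero_left (ι_add_mul_swap v w)]
    refine Eq.trans ?_ h2.symm
    rw [← hx]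
    refine Eq.trans (congrArg (fun y => (ι Q w * x - 2 • y) * ι Q v) h1) ?_
    rw [← mul_assoc, ← neg_mul]
    congr 1
    rw [mul_sub, mul_sub, two_smul, mul_smul_comm, two_smul]
    abel

/-- Moving `v` to the front past the factors before slot `j` costs exactly the sign built into
`slot`, so after multiplication all slots look alike. -/
theorem mulMap_slot (v : Fin n → Q) (j : Fin p) :
    mulMap n p ∘ₗ MFTensor.slot (oddProj Q n) (mulι v) j = mulι v ∘ₗ mulMap n p := by
  refine PiTensorProduct.ext (MultilinearMap.ext fun x => ?_)
  change mulMap n p (MFTensor.slot (oddProj Q n) (mulι v) j (PiTensorProduct.tprod Q x)) =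
    ι Q v * mulMap n p (PiTensorProduct.tprod Q x)
  rw [MFTensor.slot, PiTensorProduct.map_tprod, mulMap_tprod, mulMap_tprod]
  induction p with
  | zero => exact j.elim0
  | succ p ih =>
    rw [List.ofFn_succ, List.ofFn_succ, List.prod_cons, List.prod_cons]
    refine Fin.cases ?_ (fun j => ?_) j
    · simp [mulι_apply, mul_assoc]
    · have := ih j (fun i => x i.succ)
      simp only [Fin.succ_lt_succ_iff, Fin.succ_inj, Fin.succ_pos, if_true]
      rw [this, ← mul_assoc, ← mul_assoc, ← parity_mul_ι v (x 0)]
      simp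

theorem mulMap_tprod_one : mulMap (Q := Q) n p (PiTensorProduct.tprod Q fun _ => 1) = 1 := by
  rw [mulMap_tprod]
  simp

/-- The tensor power of the exterior algebra is generated by `1 ⊗ ⋯ ⊗ 1` under multiplication by
generators in the slots. -/
theorem tensorPower_linearMap_ext
    {f g : (⨂[Q] _ : Fin p, ExteriorAlgebra Q (Fin n → Q)) →ₗ[Q] N}
    (c : Fin p → (Fin n → Q) → End Q N)
    (h1 : f (PiTensorProduct.tprod Q fun _ => 1) = g (PiTensorProduct.tprod Q fun _ => 1))
    (hf : ∀ j v, f ∘ₗ MFTensor.slot (oddProj Q n) (mulι v) j = c j v ∘ₗ f)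
    (hg : ∀ j v, g ∘ₗ MFTensor.slot (oddProj Q n) (mulι v) j = c j v ∘ₗ g) : f = g := by
  -- Induction on `m`, the number of last slots that may differ from 1. The first of these slots is
  -- built up by left multiplications; all factors before it are 1, hence even, so `slot` introduces
  -- no sign.
  have key : ∀ m ≤ p, ∀ x : Fin p → ExteriorAlgebra Q (Fin n → Q),
      (∀ i : Fin p, (i : ℕ) < p - m → x i = 1) → f (PiTensorProduct.tprod Q x) = g (PiTensorProduct.tprod Q x) := by
    intro m
    induction m with
    | zero =>
      intro _ x hx
      obtain rfl : x = fun _ => 1 := funext fun i => hx i i.2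
      exact h1
    | succ m ih =>
      intro hm x hx
      let j : Fin p := ⟨p - (m + 1), by omega⟩
      have hj : ∀ i : Fin p, (i : ℕ) < p - m → i ≠ j → (i : ℕ) < p - (m + 1) := fun i hi hij => by
        have : (i : ℕ) ≠ p - (m + 1) := fun h => hij (Fin.ext h)
        omega
      suffices ∀ y, f (PiTensorProduct.tprod Q (Function.update x j y)) =
          g (PiTensorProduct.tprod Q (Function.update x j y)) by
        simpa using this (x j)
      intro y
      induction y using CliffordAlgebra.left_induction with
      | algebraMap r =>
        have hsm : ∀ F : (⨂[Q] _ : Fin p, ExteriorAlgebra Q (Fin n → Q)) →ₗ[Q] N,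
            F (PiTensorProduct.tprod Q (Function.update x j
              (algebraMap Q (ExteriorAlgebra Q (Fin n → Q)) r))) =
            r • F (PiTensorProduct.tprod Q (Function.update x j 1)) := fun F => by
          rw [Algebra.algebraMap_eq_smul_one, MultilinearMap.map_update_smul, map_smul]
        have h2 := ih (by omega) (Function.update x j 1) (fun i hi => by
          by_cases hij : i = j
          · subst hij; simp
          · rw [Function.update_of_ne hij]
            exact hx i (hj i hi hij))
        exact (hsm f).trans (h2 ▸ (hsm g).symm)
      | add y z hy hz =>
        rw [MultilinearMap.map_update_add, map_add, map_add, hy, hz]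
      | ι_mul y v hy =>
        have hs : MFTensor.slot (oddProj Q n) (mulι v) j (PiTensorProduct.tprod Q
            (Function.update x j y)) = PiTensorProduct.tprod Q (Function.update x j (ι Q v * y)) := by
          rw [MFTensor.slot, PiTensorProduct.map_tprod]
          congr 1
          ext1 i
          rcases lt_trichotomy i j with hij | rfl | hij
          · have hxi : x i = 1 := hx i hij
            simp [hij, hij.ne, hxi, oddProj_one]
          · simp [mulι_apply]
          · simp [hij.not_gt, hij.ne']
        refine Eq.trans (congrArg f hs.symm) (Eq.trans ?_ (congrArg g hs))
        rw [← LinearMap.comp_apply f, ← LinearMap.comp_apply g, hf, hg, LinearMap.comp_apply, hy]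
        rfl
  exact PiTensorProduct.ext (MultilinearMap.ext fun x => key p le_rfl x fun i hi => by omega)

end Koszul

/-! ### The Koszul complex is unchanged by rescaling half of its differential. -/

/-- A matrix factorization of `f` viewed as a matrix factorization of an element equal to `f`. -/
abbrev MF.copy {Q : Type u} [CommRing Q] {f f' : Q} (P : MF Q f) (hf : f = f') : MF Q f' where
  carrier := P.carrier
  e := P.e
  e_mul_e := P.e_mul_e
  d := P.d
  d_odd := P.d_odd
  d_mul_d := hf ▸ P.d_mul_d

theorem MF.support_copy {Q : Type u} [CommRing Q] {f f' : Q} (P : MF Q f) (hf : f = f') :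
    (P.copy hf).support ⊆ P.support :=
  support_subset fun _ h h1 h2 => ⟨h, h1, h2⟩

namespace Koszul

variable {Q : Type u} [CommRing Q] {n : ℕ}

open Module ExteriorAlgebra

/-- Multiplication by `b` on the odd part. -/
noncomputable def oddScale (n : ℕ) (b : Q) : End Q (ExteriorAlgebra Q (Fin n → Q)) :=
  1 - oddProj Q n + b • oddProj Q n

/-- Multiplication by `b` on the even part. -/
noncomputable def evenScale (n : ℕ) (b : Q) : End Q (ExteriorAlgebra Q (Fin n → Q)) :=
  oddProj Q n + b • (1 - oddProj Q n)

theorem oddScale_mul {b c : Q} (h : b * c = 1) : oddScale n b * oddScale n c = 1 := by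
  simp only [oddScale, mul_add, add_mul, mul_sub, sub_mul, mul_smul_comm, smul_mul_assoc, one_mul,
    mul_one, oddProj_mul_self, smul_add, smul_sub, smul_smul, mul_comm c b, h, one_smul]
  abel

theorem evenScale_mul {b c : Q} (h : b * c = 1) : evenScale n b * evenScale n c = 1 := by
  simp only [evenScale, mul_add, add_mul, mul_sub, sub_mul, mul_smul_comm, smul_mul_assoc, one_mul,
    mul_one, oddProj_mul_self, smul_add, smul_sub, smul_smul, mul_comm c b, h, one_smul]
  abel

theorem oddProj_oddScale (b : Q) : oddProj Q n * oddScale n b = oddScale n b * oddProj Q n := by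
  simp only [oddScale, mul_add, add_mul, mul_sub, sub_mul, mul_smul_comm, smul_mul_assoc, one_mul,
    mul_one, oddProj_mul_self]

theorem evenScale_mul_of_odd {h : End Q (ExteriorAlgebra Q (Fin n → Q))}
    (hh : oddProj Q n * h + h * oddProj Q n = h) (b : Q) : evenScale n b * h = h * oddScale n b := by
  have : oddProj Q n * h = h - h * oddProj Q n := eq_sub_of_add_eq hh
  simp only [evenScale, oddScale, mul_add, add_mul, mul_sub, sub_mul, mul_smul_comm, smul_mul_assoc,
    one_mul, mul_one, this, smul_sub]
  abel

theorem oddScale_mul_of_odd {h : End Q (ExteriorAlgebra Q (Fin n → Q))}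
    (hh : oddProj Q n * h + h * oddProj Q n = h) (b : Q) : oddScale n b * h = h * evenScale n b := by
  have : oddProj Q n * h = h - h * oddProj Q n := eq_sub_of_add_eq hh
  simp only [evenScale, oddScale, mul_add, add_mul, mul_sub, sub_mul, mul_smul_comm, smul_mul_assoc,
    one_mul, mul_one, this, smul_sub]
  abel

/-- `mult` rescales only the half of the differential that starts on the even part. -/
theorem mult_d (a : Fin n → Q) (c : Q) :
    diff a * oddProj Q n + c • (oddProj Q n * diff a) = diff a * evenScale n c := by
  have : oddProj Q n * diff a = diff a - diff a * oddProj Q n := eq_sub_of_add_eq (diff_odd a)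
  rw [this, evenScale, mul_add, mul_smul_comm, mul_sub, mul_one]

/-- Multiplication by generators followed by scaling of the odd part. -/
noncomputable def scaledMulι (b : Q) : (Fin n → Q) →ₗ[Q] End Q (ExteriorAlgebra Q (Fin n → Q)) :=
  LinearMap.mulRight Q (oddScale n b) ∘ₗ mulι

theorem scaledMulι_apply (b : Q) (v : Fin n → Q) : scaledMulι b v = mulι v * oddScale n b := rfl

theorem scaledMulι_mul_self (b : Q) (v : Fin n → Q) : scaledMulι b v * scaledMulι b v = 0 := by
  rw [scaledMulι_apply, mul_assoc, ← mul_assoc (oddScale n b), oddScale_mul_of_odd (mulι_odd v),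
    ← mul_assoc, ← mul_assoc, mulι_mul_self, zero_mul, zero_mul]

theorem scaledMulι_odd (b : Q) (v : Fin n → Q) :
    oddProj Q n * scaledMulι b v + scaledMulι b v * oddProj Q n = scaledMulι b v := by
  rw [scaledMulι_apply, mul_assoc, ← oddProj_oddScale, ← mul_assoc, ← mul_assoc, ← add_mul, mulι_odd]

/-- The rescaling of the exterior algebra intertwining `diff a` with its rescaling. -/
noncomputable def rescale (n : ℕ) (b : Q) : End Q (ExteriorAlgebra Q (Fin n → Q)) :=
  recMap (scaledMulι b) (scaledMulι_mul_self b) 1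

theorem rescale_one (b : Q) : rescale n b 1 = 1 := recMap_one _ _ _

theorem rescale_ι_mul (b : Q) (v : Fin n → Q) (x) :
    rescale n b (ι Q v * x) = scaledMulι b v (rescale n b x) := recMap_ι_mul _ _ _ _ _

theorem oddProj_rescale (b : Q) : oddProj Q n * rescale n b = rescale n b * oddProj Q n :=
  even_of_ι (rescale_ι_mul b) (by rw [rescale_one, oddProj_one]) (scaledMulι_odd b)

theorem rescale_oddScale (b c : Q) : rescale n b * oddScale n c = oddScale n c * rescale n b := by
  simp only [oddScale, mul_add, add_mul, mul_sub, sub_mul, mul_smul_comm, smul_mul_assoc, one_mul,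
    mul_one, oddProj_rescale]

theorem rescale_mul {b c : Q} (h : b * c = 1) : rescale n b * rescale n c = 1 := by
  refine linearMap_ext (fun v => mulι v) ?_ (fun v x => ?_) (fun v x => rfl)
  · rw [End.mul_apply, rescale_one, rescale_one, End.one_apply]
  · rw [End.mul_apply, rescale_ι_mul]
    change rescale n b (ι Q v * oddScale n c (rescale n c x)) = _
    rw [rescale_ι_mul, ← End.mul_apply (rescale n b), rescale_oddScale, ← End.mul_apply,
      ← mul_assoc, scaledMulι_apply, mul_assoc (mulι v), oddScale_mul h, mul_one]
    rfl

/-- `rescale n b` multiplies `Λ^k` by `b^⌊k/2⌋`. For the proof it suffices to compare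
anticommutators with the generators: passing an odd operator exchanges `evenScale` and `oddScale`,
and the scalings then cancel by `b c = 1`. -/
theorem rescale_diff {b c : Q} (h : b * c = 1) (a : Fin n → Q) :
    (diff a * oddProj Q n + c • (oddProj Q n * diff a)) * rescale n b = rescale n b * diff a := by
  have hcb : c * b = 1 := by rw [mul_comm, h]
  refine comm_diff_of_ι (rescale_ι_mul b) ?_ (fun v => ?_)
  · rw [rescale_one, LinearMap.add_apply, LinearMap.smul_apply, End.mul_apply, End.mul_apply,
      oddProj_one, diff_one, map_zero, map_zero, smul_zero, add_zero]
  · rw [mult_d, scaledMulι_apply, ← diff_mulι]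
    congr 1
    · rw [mul_assoc, ← mul_assoc _ (mulι v), evenScale_mul_of_odd (mulι_odd v), mul_assoc (mulι v),
        oddScale_mul hcb, mul_one]
    · rw [mul_assoc, ← mul_assoc _ (diff a), oddScale_mul_of_odd (diff_odd a), mul_assoc (diff a),
        evenScale_mul h, mul_one]

end Koszul

/-- The Koszul complex is invariant under `mult`. -/
noncomputable def MF.koszulMultIso {Q : Type u} [CommRing Q] {n : ℕ} (a : Fin n → Q) {b c f : Q}
    (h : b * c = 1) (hf : 0 = f) (hf' : 0 = c * f) :
    Iso (koszul a) (((koszul a).copy hf).mult c 0 hf') where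
  hom := ⟨Koszul.rescale n b, Koszul.oddProj_rescale b, Koszul.rescale_diff h a⟩
  inv := Koszul.rescale n c
  inv_hom := Koszul.rescale_mul (b := c) (c := b) (by rw [mul_comm, h])
  hom_inv := Koszul.rescale_mul h

theorem CyclicAdams.multClass_koszul (p : ℕ) {Q : Type u} [CommRing Q] [Algebra (Ap p) Q]
    [Fact p.Prime] {n : ℕ} (a : Fin n → Q) {Z : Set (PrimeSpectrum Q)} (hZ : (MF.koszul a).support ⊆ Z) :
    multClass p 0 Z ((MF.koszul a).copy (mul_zero (p : Q)).symm) = K0.mk ⟨MF.koszul a, hZ⟩ := by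
  rw [← MF.cls_val]
  exact ((MF.additiveOn_cls Z).iso (MF.koszulMultIso a (by rw [mul_comm, pInv_mul]) _ _) hZ).symm

/-! ### The vacuum projection of a family of anticommuting modes. -/

section

variable {R I : Type*} [Ring R] {C D : I → R}

theorem commute_mul_of_anticomm {y a c : R} (h1 : y * a + a * y = 0) (h2 : y * c + c * y = 0) :
    Commute y (a * c) := by
  change y * (a * c) = a * c * y
  rw [← mul_assoc, eq_neg_of_add_eq_zero_left h1, neg_mul, mul_assoc,
    eq_neg_of_add_eq_zero_left h2, mul_neg, neg_neg, mul_assoc]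

variable [DecidableEq I]

theorem commute_vacuum (hCC' : ∀ s t, C s * C t + C t * C s = 0)
    (hCD : ∀ s t, C s * D t + D t * C s = if s = t then 1 else 0) (l : List I) {s : I} (hs : s ∉ l) :
    Commute (C s) (l.map fun t => D t * C t).prod := by
  refine Commute.list_prod_right _ _ fun x hx => ?_
  obtain ⟨t, ht, rfl⟩ := List.mem_map.1 hx
  have hst : s ≠ t := fun h => hs (h ▸ ht)
  exact commute_mul_of_anticomm ((hCD s t).trans (if_neg hst)) (hCC' s t)

/-- `C s` commutes past the factors belonging to the other modes until it meets `D s * C s`, where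
`C s` squares to zero. -/
theorem vacuum_mul (hCC : ∀ s, C s * C s = 0) (hCC' : ∀ s t, C s * C t + C t * C s = 0)
    (hCD : ∀ s t, C s * D t + D t * C s = if s = t then 1 else 0) (l : List I) (hl : l.Nodup) {s : I} (hs : s ∈ l) :
    (l.map fun t => D t * C t).prod * C s = 0 := by
  induction l with
  | nil => simp at hs
  | cons t l ih =>
    rw [List.nodup_cons] at hl
    rw [List.map_cons, List.prod_cons, mul_assoc]
    rcases List.mem_cons.1 hs with rfl | hs
    · rw [← (commute_vacuum hCC' hCD l hl.1).eq, ← mul_assoc, mul_assoc (D s), hCC, mul_zero, zero_mul]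
    · rw [ih hl.2 hs, mul_zero]

end

/-- The number `p - k + l` lies strictly between 0 and `2p`, so the only multiple of `p` it can be
is `p` itself. -/
theorem dvd_sub_add_iff {p : ℕ} (k l : Fin p) : p ∣ p - (k : ℕ) + l ↔ k = l := by
  have hk := k.2
  have hl := l.2
  constructor
  · rintro ⟨c, hc⟩
    have h1 : p * c < p * 2 := by omega
    have h2 : 0 < p * c := by omega
    have h3 := Nat.lt_of_mul_lt_mul_left h1
    have h4 := Nat.pos_of_mul_pos_left h2
    obtain rfl : c = 1 := by omega
    exact Fin.ext (by omega)
  · rintro rfl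
    rw [Nat.sub_add_cancel hk.le]

namespace MFTensor

variable {Q : Type u} [CommRing Q] {M : Type u} [AddCommGroup M] [Module Q M] {n : ℕ}

open Module PiTensorProduct

/-- The action of an endomorphism in a slot, as a linear map. -/
def slotLin (e : End Q M) (i : Fin n) : End Q M →ₗ[Q] End Q (⨂[Q] _ : Fin n, M) where
  toFun h := slot e h i
  map_add' h k := slot_add e h k i
  map_smul' c h := slot_smul e h c i

/-- The differential of the tensor power, as a linear function of the differential. -/
def diffLin (n : ℕ) (e : End Q M) : End Q M →ₗ[Q] End Q (⨂[Q] _ : Fin n, M) :=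
  ∑ i, slotLin e i

theorem diffLin_apply (e h : End Q M) : diffLin n e h = diff n e h := by
  simp [diffLin, diff, slotLin]

theorem homog_of_even {e : End Q M} {x : M} (hx : e x = 0) : Homog e ∅ (fun _ : Fin n => x) :=
  fun i => by simp [hx]

theorem slot_tprod_of_even {e : End Q M} {x : M} (hx : e x = 0) (h : End Q M) (i : Fin n) :
    slot e h i (tprod Q fun _ => x) = tprod Q (Function.update (fun _ => x) i (h x)) := by
  rw [slot_tprod (homog_of_even hx)]
  simp

theorem permAct_tprod_of_even {e : End Q M} {x : M} (hx : e x = 0) (σ : Equiv.Perm (Fin n)) :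
    permAct e σ (tprod Q fun _ => x) = tprod Q fun _ => x := by
  rw [permAct_tprod (homog_of_even hx), koszulSign_empty, Int.cast_one, one_smul]

theorem oddProj_tprod_of_even {e : End Q M} {x : M} (hx : e x = 0) :
    oddProj n e (tprod Q fun _ => x) = 0 := by
  rw [oddProj_tprod (homog_of_even hx)]
  simp

theorem slot_tprod_of_ker {e h : End Q M} {x : M} (hx : e x = 0) (hh : h x = 0) (i : Fin n) :
    slot e h i (tprod Q fun _ => x) = 0 := by
  rw [slot_tprod_of_even hx, hh]
  exact MultilinearMap.map_update_zero _ _ _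

end MFTensor

/-! ### Fourier decomposition of the tensor power of the Koszul complex. -/

namespace CyclicAdams

variable (p : ℕ) {Q : Type u} [CommRing Q] [Algebra (Ap p) Q] [hp : Fact p.Prime] {n : ℕ}

open Module Koszul


/-- The product of the exterior multiplications in the slots of the tensor power by `v`, divided
by `p`. -/
noncomputable def meanMulι : (Fin n → Q) →ₗ[Q] End Q (⨂[Q] _ : Fin p, ExteriorAlgebra Q (Fin n → Q)) :=
  pInv p Q • (MFTensor.diffLin p (oddProj Q n) ∘ₗ mulι)

theorem meanMulι_apply (v : Fin n → Q) :
    meanMulι p v = pInv p Q • MFTensor.diff p (oddProj Q n) (mulι v) := by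
  rw [meanMulι, LinearMap.smul_apply, LinearMap.comp_apply, MFTensor.diffLin_apply]

theorem meanMulι_mul_self (v : Fin n → Q) : meanMulι p v * meanMulι p v = 0 := by
  rw [meanMulι_apply, smul_mul_smul_comm, ← MFTensor.mode_one,
    MFTensor.mode_mul_self oddProj_mul_self (mulι_odd v) (mulι_mul_self v), smul_zero]

/-- The embedding of the exterior algebra into its tensor power as the part on which only the
invariant generators act. -/
noncomputable def diagonal (Q : Type u) [CommRing Q] [Algebra (Ap p) Q] (n : ℕ) :
    ExteriorAlgebra Q (Fin n → Q) →ₗ[Q] (⨂[Q] _ : Fin p, ExteriorAlgebra Q (Fin n → Q)) :=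
  recMap (meanMulι p) (meanMulι_mul_self p) (PiTensorProduct.tprod Q fun _ => 1)

theorem diagonal_one : diagonal p Q n 1 = PiTensorProduct.tprod Q fun _ => 1 := recMap_one _ _ _

theorem diagonal_ι_mul (v : Fin n → Q) (x) :
    diagonal p Q n (ExteriorAlgebra.ι Q v * x) = meanMulι p v (diagonal p Q n x) :=
  recMap_ι_mul _ _ _ _ _

theorem even_diagonal : MFTensor.oddProj p (oddProj Q n) ∘ₗ diagonal p Q n =
    diagonal p Q n ∘ₗ oddProj Q n := by
  refine even_of_ι (diagonal_ι_mul p) ?_ fun v => ?_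
  · rw [diagonal_one, MFTensor.oddProj_tprod_of_even oddProj_one]
  · rw [meanMulι_apply, mul_smul_comm, smul_mul_assoc, ← smul_add,
      MFTensor.diff_odd oddProj_mul_self (mulι_odd v)]

/-- The differential pairs with the generator once in each of the `p` slots, and the factor `1/p` in
`meanMulι` compensates for this. -/
theorem comm_diff_diagonal (a : Fin n → Q) :
    MFTensor.diff p (oddProj Q n) (diff a) ∘ₗ diagonal p Q n = diagonal p Q n ∘ₗ diff a := by
  refine comm_diff_of_ι (diagonal_ι_mul p) ?_ fun v => ?_
  · rw [diagonal_one, MFTensor.diff, LinearMap.sum_apply]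
    exact Finset.sum_eq_zero fun i _ => MFTensor.slot_tprod_of_ker oddProj_one (diff_one a) i
  · rw [meanMulι_apply, mul_smul_comm, smul_mul_assoc, ← smul_add, ← MFTensor.mode_one,
      ← MFTensor.mode_one, MFTensor.mode_anticommutator oddProj_mul_self (diff_odd a) (mulι_odd v)
        (diff_mulι a v), smul_smul, ← mul_assoc]
    simp [pInv_mul]

theorem permAct_diagonal : MFTensor.permAct (oddProj Q n) (finRotate p) ∘ₗ diagonal p Q n =
    diagonal p Q n := by
  refine linearMap_ext (fun v => meanMulι p v) ?_ (fun v x => ?_) (diagonal_ι_mul p)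
  · rw [LinearMap.comp_apply, diagonal_one, MFTensor.permAct_tprod_of_even oddProj_one]
  · rw [LinearMap.comp_apply, LinearMap.comp_apply, diagonal_ι_mul, ← End.mul_apply, ← End.mul_apply,
      meanMulι_apply, mul_smul_comm, smul_mul_assoc,
      MFTensor.permAct_diff oddProj_mul_self (mulι_odd v)]

/-- Under multiplication the action of `v` in any slot becomes multiplication by `v`, and so does
the mean over the slots. -/
theorem mulMap_diagonal : mulMap n p ∘ₗ diagonal p Q n = LinearMap.id := by
  refine linearMap_ext (fun v => mulι v) ?_ (fun v x => ?_) (fun v x => rfl)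
  · rw [LinearMap.comp_apply, diagonal_one, mulMap_tprod_one, LinearMap.id_apply]
  · have h : mulMap n p ∘ₗ meanMulι (Q := Q) p v = mulι v ∘ₗ mulMap n p := by
      rw [meanMulι_apply, LinearMap.comp_smul, MFTensor.diff]
      have : mulMap n p ∘ₗ (∑ i, MFTensor.slot (oddProj Q n) (mulι v) i) =
          (p : Q) • (mulι v ∘ₗ mulMap n p) := by
        refine LinearMap.ext fun x => ?_
        rw [LinearMap.comp_apply, LinearMap.sum_apply, map_sum]
        refine (Finset.sum_congr rfl fun i _ => LinearMap.congr_fun (mulMap_slot v i) x).trans ?_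
        simp [Nat.cast_smul_eq_nsmul]
      rw [this, smul_smul, pInv_mul, one_smul]
    rw [LinearMap.comp_apply, diagonal_ι_mul]
    exact LinearMap.congr_fun h _

/-- The creation operators of weight `k`. -/
noncomputable def creation (Q : Type u) [CommRing Q] [Algebra (Ap p) Q] {n : ℕ} (s : Fin n × Fin p) :
    End Q (⨂[Q] _ : Fin p, ExteriorAlgebra Q (Fin n → Q)) :=
  pInv p Q • MFTensor.mode (oddProj Q n) (zetaQ p Q ^ (p - (s.2 : ℕ))) (mulι (Pi.single s.1 1))

/-- The annihilation operators dual to the creation operators. -/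
noncomputable def annihilation (Q : Type u) [CommRing Q] [Algebra (Ap p) Q] {n : ℕ}
    (s : Fin n × Fin p) : End Q (⨂[Q] _ : Fin p, ExteriorAlgebra Q (Fin n → Q)) :=
  MFTensor.mode (oddProj Q n) (zetaQ p Q ^ (s.2 : ℕ)) (diff (Pi.single s.1 1))

theorem creation_mul_self (s : Fin n × Fin p) : creation p Q s * creation p Q s = 0 := by
  rw [creation, smul_mul_smul_comm, MFTensor.mode_mul_self oddProj_mul_self (mulι_odd _)
    (mulι_mul_self _), smul_zero]

theorem annihilation_mul_self (s : Fin n × Fin p) : annihilation p Q s * annihilation p Q s = 0 :=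
  MFTensor.mode_mul_self oddProj_mul_self (Koszul.diff_odd _) (Koszul.diff_mul_self _) _

theorem creation_anticomm (s t : Fin n × Fin p) :
    creation p Q s * creation p Q t + creation p Q t * creation p Q s = 0 := by
  rw [creation, creation, smul_mul_smul_comm, smul_mul_smul_comm, ← smul_add,
    MFTensor.mode_anticommutator oddProj_mul_self (mulι_odd _) (mulι_odd _) (s := 0)
      (by rw [mulι_anticomm, zero_smul]), mul_zero, zero_smul, smul_zero]

theorem annihilation_anticomm (s t : Fin n × Fin p) :
    annihilation p Q s * annihilation p Q t + annihilation p Q t * annihilation p Q s = 0 := by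
  rw [annihilation, annihilation, MFTensor.mode_anticommutator oddProj_mul_self (Koszul.diff_odd _)
    (Koszul.diff_odd _) (s := 0) (by rw [diff_anticomm, zero_smul]), mul_zero, zero_smul]

/-- Orthogonality of the characters of the cyclic group, combined with the duality of basis vectors
and coordinate forms; the exponent `p - k` stands for `-k`. -/
theorem creation_annihilation (s t : Fin n × Fin p) :
    creation p Q s * annihilation p Q t + annihilation p Q t * creation p Q s =
      if s = t then 1 else 0 := by
  obtain ⟨i, k⟩ := s
  obtain ⟨j, l⟩ := t
  have hs : mulι (Pi.single i 1) * diff (Pi.single j (1 : Q)) +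
      diff (Pi.single j 1) * mulι (Pi.single i 1) =
      (if i = j then (1 : Q) else 0) • (1 : End Q (ExteriorAlgebra Q (Fin n → Q))) := by
    rw [add_comm, diff_mulι, Fintype.linearCombination_apply_single, Pi.single_apply, one_smul]
  rw [creation, annihilation, smul_mul_assoc, mul_smul_comm, ← smul_add,
    MFTensor.mode_anticommutator oddProj_mul_self (mulι_odd _) (Koszul.diff_odd _) hs, smul_smul,
    ← pow_add, sum_zetaQ_pow, ← mul_assoc]
  simp only [dvd_sub_add_iff, Prod.mk.injEq]
  by_cases h1 : k = l <;> by_cases h2 : i = j <;> simp [h1, h2, pInv_mul]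

theorem creation_odd (s : Fin n × Fin p) : MFTensor.oddProj p (oddProj Q n) * creation p Q s +
    creation p Q s * MFTensor.oddProj p (oddProj Q n) = creation p Q s := by
  rw [creation, mul_smul_comm, smul_mul_assoc, ← smul_add,
    MFTensor.mode_odd oddProj_mul_self (mulι_odd _)]

theorem annihilation_odd (s : Fin n × Fin p) : MFTensor.oddProj p (oddProj Q n) * annihilation p Q s +
    annihilation p Q s * MFTensor.oddProj p (oddProj Q n) = annihilation p Q s :=
  MFTensor.mode_odd oddProj_mul_self (Koszul.diff_odd _) _

theorem permAct_creation (s : Fin n × Fin p) :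
    MFTensor.permAct (oddProj Q n) (finRotate p) * creation p Q s = zetaQ p Q ^ (s.2 : ℕ) •
      (creation p Q s * MFTensor.permAct (oddProj Q n) (finRotate p)) := by
  rw [creation, smul_mul_assoc, MFTensor.permAct_mode oddProj_mul_self (mulι_odd _) (zetaQ_pow p Q _),
    mul_smul_comm, smul_comm (zetaQ p Q ^ _) (pInv p Q), smul_smul (zetaQ p Q ^ _), ← pow_add,
    Nat.add_sub_cancel' s.2.2.le, zetaQ_pow_self, one_smul]

theorem permAct_annihilation (s : Fin n × Fin p) :
    MFTensor.permAct (oddProj Q n) (finRotate p) * annihilation p Q s = zetaQ p Q ^ (p - (s.2 : ℕ)) •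
      (annihilation p Q s * MFTensor.permAct (oddProj Q n) (finRotate p)) := by
  rw [annihilation, MFTensor.permAct_mode oddProj_mul_self (Koszul.diff_odd _) (zetaQ_pow p Q _),
    smul_smul, ← pow_add, Nat.sub_add_cancel s.2.2.le, zetaQ_pow_self, one_smul]

theorem diff_annihilation (a : Fin n → Q) (s : Fin n × Fin p) :
    MFTensor.diff p (oddProj Q n) (diff a) * annihilation p Q s +
      annihilation p Q s * MFTensor.diff p (oddProj Q n) (diff a) = 0 := by
  rw [← MFTensor.mode_one, annihilation, MFTensor.mode_anticommutator oddProj_mul_self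
    (Koszul.diff_odd _) (Koszul.diff_odd _) (s := 0) (by rw [diff_anticomm, zero_smul]), mul_zero,
    zero_smul]

/-- The differential is the Fourier mode of weight 0, hence orthogonal to every creation operator of
nonzero weight. This is why the non-invariant modes split off without affecting the differential. -/
theorem diff_creation (a : Fin n → Q) (s : Fin n × Fin p) (hs : (s.2 : ℕ) ≠ 0) :
    MFTensor.diff p (oddProj Q n) (diff a) * creation p Q s +
      creation p Q s * MFTensor.diff p (oddProj Q n) (diff a) = 0 := by
  have h : ¬ p ∣ p - (s.2 : ℕ) := fun h => by
    have := Nat.le_of_dvd (Nat.sub_pos_of_lt s.2.2) h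
    have := s.2.2
    omega
  rw [← MFTensor.mode_one, creation, mul_smul_comm, smul_mul_assoc, ← smul_add,
    MFTensor.mode_anticommutator oddProj_mul_self (Koszul.diff_odd _) (mulι_odd _) (diff_mulι _ _),
    one_mul, sum_zetaQ_pow, if_neg h, zero_mul, zero_smul, smul_zero]

/-- Fourier inversion: the action in a slot in terms of the modes. -/
theorem slot_eq_sum (h : End Q (ExteriorAlgebra Q (Fin n → Q))) (j : Fin p) :
    MFTensor.slot (oddProj Q n) h j = ∑ k : Fin p, zetaQ p Q ^ ((k : ℕ) * j) •
      (pInv p Q • MFTensor.mode (oddProj Q n) (zetaQ p Q ^ (p - (k : ℕ))) h) := by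
  -- Both exponents are congruent to `k (j - i)` modulo `p`; multiples of `p` are added to both
  -- sides to stay within the natural numbers.
  have h1 : ∀ i k : Fin p, zetaQ p Q ^ ((k : ℕ) * j) * (zetaQ p Q ^ (p - (k : ℕ))) ^ (i : ℕ) =
      (zetaQ p Q ^ ((p - (i : ℕ)) + j)) ^ (k : ℕ) := by
    intro i k
    rw [← pow_mul, ← pow_mul, ← pow_add]
    have h2 : (p - (k : ℕ)) * i + k * i = p * i := by
      rw [← add_mul, Nat.sub_add_cancel k.2.le]
    have h3 : (p - (i : ℕ)) * k + i * k = p * k := by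
      rw [← add_mul, Nat.sub_add_cancel i.2.le]
    have h4 : k * j + (p - (k : ℕ)) * i + p * k = ((p - (i : ℕ)) + j) * k + p * i := by
      rw [← h2, ← h3]
      ring
    have := congrArg (zetaQ p Q ^ ·) h4
    simpa [pow_add, pow_mul (zetaQ p Q) p, zetaQ_pow_self] using this
  have h2 : ∀ k : Fin p, zetaQ p Q ^ ((k : ℕ) * j) •
      (pInv p Q • MFTensor.mode (oddProj Q n) (zetaQ p Q ^ (p - (k : ℕ))) h) =
      ∑ i : Fin p, (pInv p Q * (zetaQ p Q ^ ((p - (i : ℕ)) + j)) ^ (k : ℕ)) •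
        MFTensor.slot (oddProj Q n) h i := by
    intro k
    rw [MFTensor.mode, Finset.smul_sum, Finset.smul_sum]
    refine Finset.sum_congr rfl fun i _ => ?_
    rw [smul_smul, smul_smul, ← h1, mul_left_comm, mul_assoc]
  have h3 : ∀ i : Fin p, ∑ k : Fin p, (pInv p Q * (zetaQ p Q ^ ((p - (i : ℕ)) + j)) ^ (k : ℕ)) •
      MFTensor.slot (oddProj Q n) h i = if i = j then MFTensor.slot (oddProj Q n) h i else 0 := by
    intro i
    rw [← Finset.sum_smul, ← Finset.mul_sum,
      Fin.sum_univ_eq_sum_range (fun k => (zetaQ p Q ^ ((p - (i : ℕ)) + j)) ^ k), sum_zetaQ_pow]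
    simp only [dvd_sub_add_iff]
    split_ifs
    · rw [pInv_mul, one_smul]
    · rw [mul_zero, zero_smul]
  rw [Finset.sum_congr rfl fun k _ => h2 k, Finset.sum_comm, Finset.sum_congr rfl fun i _ => h3 i]
  simp

/-- The weights of the non-invariant modes. -/
noncomputable def modeList (n : ℕ) : List (Fin n × Fin p) :=
  (Finset.univ.filter fun s : Fin n × Fin p => (s.2 : ℕ) ≠ 0).toList

theorem mem_modeList {s : Fin n × Fin p} : s ∈ modeList p n ↔ (s.2 : ℕ) ≠ 0 := by
  simp [modeList]

/-- The projection of the tensor power onto the part without non-invariant excitations. -/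
noncomputable def vacuumProj (Q : Type u) [CommRing Q] [Algebra (Ap p) Q] (n : ℕ) :
    End Q (⨂[Q] _ : Fin p, ExteriorAlgebra Q (Fin n → Q)) :=
  ((modeList p n).map fun s => annihilation p Q s * creation p Q s).prod

/-- Every annihilation operator kills `1 ⊗ ⋯ ⊗ 1`, so each factor `D C = 1 - C D` fixes it. -/
theorem vacuumProj_tprod_one : vacuumProj p Q n (PiTensorProduct.tprod Q fun _ => 1) =
    PiTensorProduct.tprod Q fun _ => 1 := by
  have h1 : ∀ s : Fin n × Fin p,
      (annihilation p Q s * creation p Q s) (PiTensorProduct.tprod Q fun _ => 1) =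
        PiTensorProduct.tprod Q fun _ => 1 := by
    intro s
    have h2 : annihilation p Q s (PiTensorProduct.tprod Q fun _ => 1) = 0 := by
      rw [annihilation, MFTensor.mode, LinearMap.sum_apply]
      refine Finset.sum_eq_zero fun i _ => ?_
      rw [LinearMap.smul_apply, MFTensor.slot_tprod_of_ker oddProj_one (diff_one _), smul_zero]
    have h3 := LinearMap.congr_fun ((creation_annihilation (Q := Q) p s s).trans (if_pos rfl))
      (PiTensorProduct.tprod Q fun _ => 1)
    rw [LinearMap.add_apply, End.mul_apply, h2, map_zero, zero_add] at h3
    exact h3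
  rw [vacuumProj]
  induction modeList p n with
  | nil => rfl
  | cons s l ih => rw [List.map_cons, List.prod_cons, End.mul_apply, ih, h1]

theorem vacuumProj_creation {s : Fin n × Fin p} :
    vacuumProj p Q n * creation p Q s =
      if (s.2 : ℕ) = 0 then creation p Q s * vacuumProj p Q n else 0 := by
  split_ifs with h
  · exact (commute_vacuum (creation_anticomm p) (creation_annihilation p) _
      (fun hs => (mem_modeList p).1 hs h)).eq.symm
  · exact vacuum_mul (creation_mul_self p) (creation_anticomm p) (creation_annihilation p) _
      (Finset.nodup_toList _) ((mem_modeList p).2 h)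

/-- Expand the action in slot `j` into Fourier modes. The vacuum projection kills all modes of
nonzero weight and commutes with the one of weight 0, which is the mean over the slots. -/
theorem vacuumProj_slot (v : Fin n → Q) (j : Fin p) :
    vacuumProj p Q n * MFTensor.slot (oddProj Q n) (mulι v) j = meanMulι p v * vacuumProj p Q n := by
  have : NeZero p := ⟨hp.out.ne_zero⟩
  suffices LinearMap.mulLeft Q (vacuumProj p Q n) ∘ₗ MFTensor.slotLin (oddProj Q n) j ∘ₗ mulι =
      LinearMap.mulRight Q (vacuumProj p Q n) ∘ₗ meanMulι p from LinearMap.congr_fun this v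
  refine (Pi.basisFun Q (Fin n)).ext fun i => ?_
  rw [Pi.basisFun_apply]
  change vacuumProj p Q n * MFTensor.slot (oddProj Q n) (mulι (Pi.single i 1)) j =
    meanMulι p (Pi.single i 1) * vacuumProj p Q n
  rw [slot_eq_sum, Finset.mul_sum, Finset.sum_eq_single 0]
  · have := vacuumProj_creation p (Q := Q) (s := (i, (0 : Fin p)))
    rw [if_pos (by simp)] at this
    have h0 : creation p Q (i, (0 : Fin p)) = meanMulι p (Pi.single i 1) := by
      rw [creation, meanMulι_apply, ← MFTensor.mode_one]
      simp [zetaQ_pow_self]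
    rw [← h0, ← this]
    simp [creation]
  · intro k _ hk
    have := vacuumProj_creation p (Q := Q) (s := (i, k))
    rw [if_neg (fun h => hk (Fin.ext (by simpa using h)))] at this
    rw [mul_smul_comm]
    exact (congrArg _ this).trans (smul_zero _)
  · simp

/-- Both sides fix `1 ⊗ ⋯ ⊗ 1` and turn the action of `v` in any slot into its mean, so they agree
on generators. With `mulMap_diagonal` this identifies the vacuum part with a single exterior
algebra. -/
theorem diagonal_mulMap : diagonal p Q n ∘ₗ mulMap n p = vacuumProj p Q n := by
  refine tensorPower_linearMap_ext (fun _ v => meanMulι p v) ?_ (fun j v => ?_)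
    fun j v => vacuumProj_slot p v j
  · rw [LinearMap.comp_apply, mulMap_tprod_one, diagonal_one, vacuumProj_tprod_one]
  · rw [LinearMap.comp_assoc, mulMap_slot, ← LinearMap.comp_assoc, ← LinearMap.comp_assoc]
    congr 1
    exact LinearMap.ext fun x => diagonal_ι_mul p v x

/-- For each of the `n` basis vectors the product of `1 - ζ^k` over `0 < k < p` is `p`, the value at
1 of `1 + X + ⋯ + X^(p-1)`. -/
theorem prod_modeList :
    ((modeList p n).map fun s => 1 - zeta p ^ (s.2 : ℕ)).prod = ((p ^ n : ℕ) : ZZeta p) := by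
  have h1 : ∏ k : Fin p, (if (k : ℕ) ≠ 0 then 1 - zeta p ^ (k : ℕ) else 1) = (p : ZZeta p) := by
    have hz := isPrimitiveRoot_zeta p
    have hp0 := hp.out.pos
    clear hp
    obtain ⟨m, rfl⟩ : ∃ m, p = m + 1 := ⟨p - 1, by omega⟩
    rw [Fin.prod_univ_eq_prod_range (fun k => if k ≠ 0 then 1 - zeta (m + 1) ^ k else 1),
      Finset.prod_range_succ']
    simp only [ne_eq, Nat.succ_ne_zero, not_false_eq_true, if_true, not_true, if_false, mul_one]
    rw [hz.prod_one_sub_pow_eq_order]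
    push_cast
    rfl
  rw [modeList, Finset.prod_map_toList, Finset.prod_filter, Fintype.prod_prod_type]
  simp only [h1]
  simp

/-- Splitting off all non-invariant modes leaves the vacuum part, which is a copy of `K(a)` fixed by
the rotation, multiplied by the scalar of `prod_modeList`. -/
theorem sum_eigenPart_koszul (a : Fin n → Q) {Z : Set (PrimeSpectrum Q)}
    (hZ : (MF.koszul a).support ⊆ Z) :
    ∑ k ∈ Finset.range p, K0.mk (eigenPart p ⟨MF.koszul a, hZ⟩ k) ⊗ₜ[ℤ] (zeta p ^ k) =
      (p ^ n • K0.mk ⟨MF.koszul a, hZ⟩ : K0 0 Z) ⊗ₜ[ℤ] (1 : ZZeta p) := by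
  have : NeZero p := ⟨hp.out.ne_zero⟩
  set X := ((MF.koszul a).tensorPower p).toMF with hXdef
  set T : End Q X.carrier := MFTensor.permAct (oddProj Q n) (finRotate p) with hTdef
  set S : End Q X.carrier := vacuumProj p Q n with hSdef
  have hχ := additiveOn_multClass (f := (0 : Q)) (Z := Z) p
  have hX : X.support ⊆ Z := ((MF.koszul a).tensorPower_support p).trans hZ
  have hTe : Commute X.e T := (MFTensor.permAct_oddProj oddProj_mul_self _).symm
  have hTd : Commute X.d T := (MFTensor.permAct_diff oddProj_mul_self (Koszul.diff_odd a) _).symm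
  obtain ⟨h1, h2, h3⟩ := eigenSum_modes p hχ hX (r := fun s : Fin n × Fin p => (s.2 : ℕ)) (T := T)
    (C := creation p Q) (D := annihilation p Q) ((MF.koszul a).permAct_finRotate_pow p) hTe hTd
    (annihilation_mul_self p) (creation_anticomm p) (annihilation_anticomm p)
    (creation_annihilation p) (fun s => s.2.2) (permAct_creation p) (permAct_annihilation p)
    (creation_odd p) (annihilation_odd p) (diff_annihilation p a) (modeList p n)
    (Finset.nodup_toList _) (fun s hs => diff_creation p a s ((mem_modeList p).1 hs)) 1 (one_mul 1)
    (Commute.one_right _) (Commute.one_right _) (Commute.one_right _) (fun _ _ => Commute.one_right _)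
    (fun _ _ => Commute.one_right _)
  rw [one_mul] at h1 h2 h3
  change eigenSum p _ X T 1 = LinearMap.lTensor _ _ (eigenSum p _ X T S) at h1
  change Commute X.e S at h2
  change Commute X.d S at h3
  have hSS : S * S = S := by
    change vacuumProj p Q n * vacuumProj p Q n = vacuumProj p Q n
    rw [← diagonal_mulMap]
    change diagonal p Q n ∘ₗ (mulMap n p ∘ₗ diagonal p Q n) ∘ₗ mulMap n p = _
    rw [mulMap_diagonal, LinearMap.id_comp]
  have hTS : T * S = S := by
    change MFTensor.permAct (oddProj Q n) (finRotate p) * vacuumProj p Q n = vacuumProj p Q n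
    rw [← diagonal_mulMap]
    exact congrArg (fun y => y ∘ₗ mulMap n p) (permAct_diagonal p)
  have hval : MF.cutVal (multClass p 0 Z) X S = K0.mk ⟨MF.koszul a, hZ⟩ := by
    rw [← multClass_koszul p a hZ]
    -- The tensor power factors `p * 0`, so `K(a)` has to be regarded as a factorization of `p * 0`
    -- before the two are compared.
    have hK : ((MF.koszul a).copy (mul_zero (p : Q)).symm).support ⊆ Z :=
      (MF.support_copy _ _).trans hZ
    refine (hχ.cutVal_iso (MF.CutIn.of_commute hK (one_mul 1) (by simp) (by simp))
      (.of_commute hSS h2 h3) (diagonal p Q n) (mulMap n p) (mulMap_diagonal p) (diagonal_mulMap p)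
      (even_diagonal p) ?_).symm.trans (hχ.cutVal_one hK)
    exact congrArg (fun y => S ∘ₗ y) (comm_diff_diagonal p a)
  -- The rotation fixes the vacuum part, so only the eigenvalue 1 contributes.
  have hsum : eigenSum p (multClass p 0 Z) X T S = K0.mk ⟨MF.koszul a, hZ⟩ ⊗ₜ[ℤ] (1 : ZZeta p) := by
    rw [eigenSum, Finset.sum_eq_single_of_mem 0 (Finset.mem_range.2 hp.out.pos)]
    · rw [eigenProj_mul_of_fixed hTS, pow_zero, pow_zero, one_pow]
      simp [pInv_mul, hval]
    · intro k hk hk0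
      suffices h : ¬ p ∣ k * (p - 1) by
        have h0 : eigenProj (pInv p Q) (zetaQ p Q ^ k) p T * S = 0 := by
          rw [eigenProj_mul_of_fixed hTS, ← pow_mul, sum_zetaQ_pow, if_neg h]
          simp
        rw [h0, hχ.cutVal_zero, TensorProduct.zero_tmul]
      rw [hp.out.dvd_mul, not_or]
      rw [Finset.mem_range] at hk
      have := hp.out.two_le
      exact ⟨Nat.not_dvd_of_pos_of_lt (by omega) hk, Nat.not_dvd_of_pos_of_lt (by omega) (by omega)⟩
  have hlhs : ∑ k ∈ Finset.range p, K0.mk (eigenPart p ⟨MF.koszul a, hZ⟩ k) ⊗ₜ[ℤ] (zeta p ^ k) =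
      eigenSum p (multClass p 0 Z) X T 1 := by
    refine Finset.sum_congr rfl fun k _ => ?_
    rw [mk_eigenPart, mul_one]
    rfl
  rw [hlhs, h1, hsum, prod_modeList, LinearMap.lTensor_tmul, LinearMap.mulLeft_apply, mul_one,
    ← nsmul_one, TensorProduct.tmul_smul, TensorProduct.smul_tmul']

end CyclicAdams

theorem corollary2p4 {Q : Type u} [CommRing Q] [IsNoetherianRing Q] (p : ℕ) [Fact p.Prime]
    [Algebra (Ap p) Q] {n : ℕ} (a : Fin n → Q) :
    (∃! ψ : K0 (0 : Q) (PrimeSpectrum.zeroLocus (Set.range a)) →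
        K0 (0 : Q) (PrimeSpectrum.zeroLocus (Set.range a)), CyclicAdams.IsAdams p ψ) ∧
    ∀ ψ : K0 (0 : Q) (PrimeSpectrum.zeroLocus (Set.range a)) →
        K0 (0 : Q) (PrimeSpectrum.zeroLocus (Set.range a)), CyclicAdams.IsAdams p ψ →
      ψ (K0.mk ⟨MF.koszul a, MF.koszul_support a⟩) =
        p ^ n • K0.mk ⟨MF.koszul a, MF.koszul_support a⟩ := by
  refine ⟨CyclicAdams.existsUnique_isAdams p, fun ψ hψ => ?_⟩
  exact CyclicAdams.tmul_one_injective p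
    ((hψ _).trans (CyclicAdams.sum_eigenPart_koszul p a (MF.koszul_support a)))
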